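/- **Theorem 1.** Consider on the plane the quasi-linear system for $U=(\Lambda,u_0,f,g)^T$ $$f_x+g_y=0,\quad (f\Lambda)_x-(g\Lambda)_y=0,\quad (u_0)_x+2\Lambda_x-\tfrac12 g(f_y-g_x)=0,\quad -(u_0)_y+2\Lambda_y+\tfrac12 f(f_y-g_x)=0, \qquad (S)$$ written in matrix form as $A(U)U_x+B(U)U_y=0$ with $$A=\begin{pmatrix}0&0&1&0\\ f&0&\Lambda&0\\ 2&1&0&\frac g2\\ 0&0&0&-\frac f2\end{pmatrix},\qquad B=\begin{pmatrix}0&0&0&1\\ -g&0&0&-\Lambda\\ 0&0&-\frac g2&0\\ 2&-1&\frac f2&0\end{pmatrix},$$ and the evolution system $$\Lambda_t=(g\Lambda)_x+(f\Lambda)_y,\quad (u_0)_t=-2(g\Lambda)_x+g(u_0)_x+2(f\Lambda)_y+f(u_0)_y,\quad f_t=2(u_0)_y,\quad g_t=-2(u_0)_x. \qquad (E)$$ To $U$ with $\Lambda>0$ associate the metric $\Lambda(dx^2+dy^2)$, with $H=\frac{p_1^2+p_2^2}{2\Lambda}$, the magnetic form $\Omega\,dx\wedge dy$, $\Omega=\frac14(g_x-f_y)$,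 and the function $F=2(p_1^2-p_2^2)+2fp_1-2gp_2+u_0$. The magnetic Poisson bracket is $$\{F,H\}_{mg}=\sum_{i=1}^2\Big(\frac{\partial F}{\partial x^i}\frac{\partial H}{\partial p_i}-\frac{\partial F}{\partial p_i}\frac{\partial H}{\partial x^i}\Big)+\Omega\Big(\frac{\partial F}{\partial p_1}\frac{\partial H}{\partial p_2}-\frac{\partial F}{\partial p_2}\frac{\partial H}{\partial p_1}\Big).$$ 1. The system (S) is semi-Hamiltonian: near every $U$ with $\det A(U)\ne0$ at which $A^{-1}B$ has four distinct real eigenvalues, it can be written in Riemann invariants, $(r_j)_x+\lambda_j(r_j)_y=0$, and in conservation-law form, $(Q_j)_x+(R_j)_y=0$, $j=1,\dots,4$, where $(r_j)$ and $(Q_j)$ are smooth coordinate systems. It is not linearly degenerate: at some such $U$ the derivative of some eigenvalue of $A^{-1}B$ along one of its own eigenvectors is non-zero. 2. A $C^1$ function $U$ with $\Lambda>0$ solves (S) if and only if $\{F,H\}_{mg}=0$ on $\{H=\frac12\}$. 3. Let $\Lambda_1,\Lambda_2:\mathbb R\to\mathbb R$ be real-analytic, positive, $1$-periodic and non-constant,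 and let $U_0=(\Lambda_1(x)+\Lambda_2(y),\,2\Lambda_2(y)-2\Lambda_1(x),\,0,\,0)^T$ (a Liouville metric with zero magnetic field). Then there are $\varepsilon>0$ and a real-analytic solution $U(x,y,t)$, $(x,y)\in\mathbb R^2$, $|t|<\varepsilon$, of (E) with $U|_{t=0}=U_0$. It is unique: every real-analytic solution of this Cauchy problem on $\mathbb R^2\times(-\delta,\delta)$, $0<\delta\le\varepsilon$, coincides with $U$ there. It has the following properties. * For all $|t|<\varepsilon$, $U(\cdot,\cdot,t)$ is $1$-periodic in $x$ and in $y$, has $\Lambda>0$ and solves (S). Consequently $\Lambda(dx^2+dy^2)$ is a real-analytic Riemannian metric on the torus $\mathbb R^2/\mathbb Z^2$, $\Omega$ is a real-analytic magnetic field on the torus, and $F$ is a first integral of the magnetic geodesic flow on $\{H=\frac12\}$. The function $F$ has degree two in the momenta, with real-analytic periodic coefficients; its quadratic part is not proportional to $H$; and $F$ and $H$ are functionally independent almost everywhere on $\{H=\frac12\}$. * For $0<|t|<\varepsilon$ the metric is not a Liouville metric, that is, in no global smooth coordinates $(u,v)$ on the universal cover $\mathbb R^2$ does it have the form $(h_1(u)+h_2(v))(du^2+dv^2)$;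 and $\Omega\not\equiv0$. * As $t\to0$, $\Lambda(\cdot,\cdot,t)\to\Lambda_1(x)+\Lambda_2(y)$ and $\Omega(\cdot,\cdot,t)\to0$ in every $C^k$ norm on the torus. In particular there are real-analytic Riemannian metrics on the $2$-torus, arbitrarily close to Liouville metrics but not Liouville, and non-zero analytic magnetic fields, whose magnetic geodesic flow on $\{H=\frac12\}$ has a first integral quadratic in momenta. -/

import Mathlib

open scoped Matrix ContDiff Topology

noncomputable section

/-- The coordinate plane, the universal cover of the torus `ℝ² / ℤ²`. Functions on the torus are
the functions on the plane that are 1-periodic in both variables. -/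
abbrev Plane := Fin 2 → ℝ

/-- Points `(x, p)` of the cotangent bundle of the plane. -/
abbrev Phase := Plane × Plane

/-- Values `U = (Λ, u₀, f, g)` of the unknowns of the quasi-linear system. -/
abbrev State := Fin 4 → ℝ

/-- 1-periodic in `x` and in `y`. -/
def DoublyPeriodic {E : Type*} (u : Plane → E) : Prop :=
  ∀ (q : Plane) (i : Fin 2), u (q + Pi.single i 1) = u q

/-- Partial derivative with respect to the `i`-th coordinate. -/
def pd {n : ℕ} {E : Type*} [NormedAddCommGroup E] [NormedSpace ℝ E] (i : Fin n)
    (u : (Fin n → ℝ) → E) (q : Fin n → ℝ) : E :=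
  fderiv ℝ u q (Pi.single i 1)

/-- Jacobian matrix. -/
def jac {n : ℕ} (r : (Fin n → ℝ) → (Fin n → ℝ)) (q : Fin n → ℝ) : Matrix (Fin n) (Fin n) ℝ :=
  Matrix.of fun i j => pd j r q i

/-! ### Metrics, magnetic geodesic flows and their integrals -/

/-- A real-analytic Riemannian metric on the torus, `G q` being the matrix `(g_ij)` at `q`. -/
def IsAnalyticTorusMetric (G : Plane → Matrix (Fin 2) (Fin 2) ℝ) : Prop :=
  (∀ i j, AnalyticOnNhd ℝ (fun q => G q i j) Set.univ) ∧ DoublyPeriodic G ∧ ∀ q, (G q).PosDef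

/-- The metric `Λ (dx² + dy²)`. -/
def conformalMetric (L : Plane → ℝ) (q : Plane) : Matrix (Fin 2) (Fin 2) ℝ :=
  L q • (1 : Matrix (Fin 2) (Fin 2) ℝ)

/-- In some global coordinates `(u, v)` the metric is `(h₁(u) + h₂(v)) (du² + dv²)`. The
coordinates are those of the universal cover; they are not required to be adapted to the lattice
`ℤ²`. -/
def IsLiouvilleMetric (G : Plane → Matrix (Fin 2) (Fin 2) ℝ) : Prop :=
  ∃ (ψ : Plane ≃ Plane) (h₁ h₂ : ℝ → ℝ), ContDiff ℝ ∞ ψ ∧ ContDiff ℝ ∞ ψ.symm ∧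
    ∀ w : Plane, (jac ψ w)ᵀ * G (ψ w) * jac ψ w =
      (h₁ (w 0) + h₂ (w 1)) • (1 : Matrix (Fin 2) (Fin 2) ℝ)

/-- `H = ½ g^{ij} p_i p_j`. -/
def hamiltonian (G : Plane → Matrix (Fin 2) (Fin 2) ℝ) (z : Phase) : ℝ :=
  (1 / 2) * (z.2 ⬝ᵥ ((G z.1)⁻¹ *ᵥ z.2))

/-- `∂F/∂xⁱ` on phase space. -/
def dpos (i : Fin 2) (F : Phase → ℝ) (z : Phase) : ℝ := fderiv ℝ F z (Pi.single i 1, 0)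

/-- `∂F/∂p_i` on phase space. -/
def dmom (i : Fin 2) (F : Phase → ℝ) (z : Phase) : ℝ := fderiv ℝ F z (0, Pi.single i 1)

/-- The Poisson bracket twisted by the magnetic form `Ω dx ∧ dy`. -/
def magBracket (Om : Plane → ℝ) (F H : Phase → ℝ) (z : Phase) : ℝ :=
  (∑ i : Fin 2, (dpos i F z * dmom i H z - dmom i F z * dpos i H z))
    + Om z.1 * (dmom 0 F z * dmom 1 H z - dmom 1 F z * dmom 0 H z)

/-- `F` is constant along the magnetic geodesic flow on the energy level `{H = ½}`. -/
def IsConservedOnLevel (G : Plane → Matrix (Fin 2) (Fin 2) ℝ) (Om : Plane → ℝ)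
    (F : Phase → ℝ) : Prop :=
  ∀ z : Phase, hamiltonian G z = 1 / 2 → magBracket Om F (hamiltonian G) z = 0

/-- `F` and `H` are functionally independent almost everywhere on `{H = ½}`; this three-dimensional
manifold is parametrized by the base point `w.1` and the angle `w.2` of the momentum. -/
def IsIndependentOnLevel (G : Plane → Matrix (Fin 2) (Fin 2) ℝ) (F : Phase → ℝ) : Prop :=
  ∀ᵐ w : Plane × ℝ, ∀ r : ℝ, 0 < r →
    hamiltonian G (w.1, r • ![Real.cos w.2, Real.sin w.2]) = 1 / 2 →
    LinearIndependent ℝ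
      ![fderiv ℝ (hamiltonian G) (w.1, r • ![Real.cos w.2, Real.sin w.2]),
        fderiv ℝ F (w.1, r • ![Real.cos w.2, Real.sin w.2])]

/-- `F` is a polynomial of degree two in the momenta, with real-analytic coefficients on the torus.
The last condition says that the degree remains two on `{H = ½}`: the quadratic part is not a
multiple of `H`. -/
def IsQuadraticInMomenta (G : Plane → Matrix (Fin 2) (Fin 2) ℝ) (F : Phase → ℝ) : Prop :=
  ∃ (a : Plane → Matrix (Fin 2) (Fin 2) ℝ) (b : Plane → Plane) (c : Plane → ℝ),
    (∀ i j, AnalyticOnNhd ℝ (fun q => a q i j) Set.univ) ∧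
    AnalyticOnNhd ℝ b Set.univ ∧ AnalyticOnNhd ℝ c Set.univ ∧
    DoublyPeriodic a ∧ DoublyPeriodic b ∧ DoublyPeriodic c ∧
    (∀ q, (a q).IsSymm) ∧
    (∀ z : Phase, F z = z.2 ⬝ᵥ (a z.1 *ᵥ z.2) + b z.1 ⬝ᵥ z.2 + c z.1) ∧
    ∃ q, ∀ s : ℝ, a q ≠ s • (G q)⁻¹

/-- `F` is a first integral, quadratic in momenta, of the magnetic geodesic flow on `{H = ½}`. -/
def IsQuadraticIntegralOnLevel (G : Plane → Matrix (Fin 2) (Fin 2) ℝ) (Om : Plane → ℝ)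
    (F : Phase → ℝ) : Prop :=
  IsQuadraticInMomenta G F ∧ IsConservedOnLevel G Om F ∧ IsIndependentOnLevel G F

/-- `u` and `v` are `δ`-close in the `C^k` norm. -/
def CkClose (k : ℕ) (δ : ℝ) (u v : Plane → ℝ) : Prop :=
  ∀ j ≤ k, ∀ q, ‖iteratedFDeriv ℝ j (fun q' => u q' - v q') q‖ ≤ δ

/-! ### Quasi-linear systems `A(U) U_x + B(U) U_y = 0` -/

section Quasilinear

variable {n : ℕ}

/-- `U` is a solution of `A(U) U_x + B(U) U_y = 0` on the plane. -/
def SolvesSystem (A B : (Fin n → ℝ) → Matrix (Fin n) (Fin n) ℝ) (U : Plane → Fin n → ℝ) : Prop :=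
  ∀ q, A (U q) *ᵥ pd 0 U q + B (U q) *ᵥ pd 1 U q = 0

/-- Strict hyperbolicity at the value `U`: the matrix `A⁻¹ B` makes sense and has `n` distinct real
eigenvalues. -/
def IsStrictlyHyperbolicAt (A B : (Fin n → ℝ) → Matrix (Fin n) (Fin n) ℝ) (U : Fin n → ℝ) : Prop :=
  (A U).det ≠ 0 ∧ ∃ lam : Fin n → ℝ, Function.Injective lam ∧
    ∀ i, (B U - lam i • A U).det = 0

/-- Near `U₀` there are functions `r₁, …, r_n` of `U`, forming a coordinate system, in which
the system reads `(r_j)_x + λ_j (r_j)_y = 0` with distinct real `λ_j`. -/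
def HasRiemannInvariantsNear (A B : (Fin n → ℝ) → Matrix (Fin n) (Fin n) ℝ)
    (U₀ : Fin n → ℝ) : Prop :=
  ∃ N : Set (Fin n → ℝ), IsOpen N ∧ U₀ ∈ N ∧
    ∃ (r : (Fin n → ℝ) → Fin n → ℝ) (lam : (Fin n → ℝ) → Fin n → ℝ), ContDiffOn ℝ ∞ r N ∧
      ∀ U ∈ N, (A U).det ≠ 0 ∧ (jac r U).det ≠ 0 ∧ Function.Injective (lam U) ∧
        jac r U * ((A U)⁻¹ * B U) = Matrix.diagonal (lam U) * jac r U

/-- Near `U₀` there are functions `Q₁, …, Q_n` of `U`, forming a coordinate system, and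
`R₁, …, R_n` such that the system reads `(Q_j)_x + (R_j)_y = 0`. -/
def HasConservationFormNear (A B : (Fin n → ℝ) → Matrix (Fin n) (Fin n) ℝ)
    (U₀ : Fin n → ℝ) : Prop :=
  ∃ N : Set (Fin n → ℝ), IsOpen N ∧ U₀ ∈ N ∧
    ∃ (Q R : (Fin n → ℝ) → Fin n → ℝ), ContDiffOn ℝ ∞ Q N ∧ ContDiffOn ℝ ∞ R N ∧
      ∀ U ∈ N, (A U).det ≠ 0 ∧ (jac Q U).det ≠ 0 ∧
        jac R U = jac Q U * ((A U)⁻¹ * B U)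

/-- Semi-Hamiltonian (rich): in the hyperbolic region the system can be written both in Riemann
invariants and in the form of conservation laws. -/
def IsSemiHamiltonian (A B : (Fin n → ℝ) → Matrix (Fin n) (Fin n) ℝ) : Prop :=
  ∀ U, IsStrictlyHyperbolicAt A B U →
    HasRiemannInvariantsNear A B U ∧ HasConservationFormNear A B U

/-- Linear degeneracy: in the hyperbolic region every eigenvalue `λ` of `A⁻¹ B` is stationary in the
direction of its own eigenvectors (in Riemann invariants, `∂λ_i/∂r_i = 0`). -/
def IsLinearlyDegenerate (A B : (Fin n → ℝ) → Matrix (Fin n) (Fin n) ℝ) : Prop :=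
  ∀ U, IsStrictlyHyperbolicAt A B U →
    ∀ lam : (Fin n → ℝ) → ℝ, ContDiffAt ℝ ∞ lam U →
      (∀ᶠ W in 𝓝 U, (B W - lam W • A W).det = 0) →
      ∀ v : Fin n → ℝ, B U *ᵥ v = lam U • (A U *ᵥ v) → fderiv ℝ lam U v = 0

end Quasilinear

/-! ### The system of the problem, with `U = (Λ, u₀, f, g)` -/

/-- The matrix `A(U)`. -/
def magA (U : State) : Matrix (Fin 4) (Fin 4) ℝ :=
  !![0, 0, 1, 0;
     U 2, 0, U 0, 0;
     2, 1, 0, U 3 / 2;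
     0, 0, 0, -(U 2 / 2)]

/-- The matrix `B(U)`. -/
def magB (U : State) : Matrix (Fin 4) (Fin 4) ℝ :=
  !![0, 0, 0, 1;
     -U 3, 0, 0, -U 0;
     0, 0, -(U 3 / 2), 0;
     2, -1, U 2 / 2, 0]

/-- The matrix `A₁(U)` of the symmetry `U_t = A₁(U) U_x + B₁(U) U_y`. -/
def symA (U : State) : Matrix (Fin 4) (Fin 4) ℝ :=
  !![U 3, 0, 0, U 0;
     -(2 * U 3), U 3, 0, -(2 * U 0);
     0, 0, 0, 0;
     0, -2, 0, 0]

/-- The matrix `B₁(U)` of the symmetry. -/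
def symB (U : State) : Matrix (Fin 4) (Fin 4) ℝ :=
  !![U 2, 0, U 0, 0;
     2 * U 2, U 2, 2 * U 0, 0;
     0, 2, 0, 0;
     0, 0, 0, 0]

/-- The conformal factor `Λ` of the metric given by `U`. -/
def confFactor (U : Plane → State) (q : Plane) : ℝ := U q 0

/-- The magnetic field `Ω = ¼ (g_x - f_y)`. -/
def magField (U : Plane → State) (q : Plane) : ℝ :=
  (1 / 4) * (pd 0 (fun q' => U q' 3) q - pd 1 (fun q' => U q' 2) q)

/-- `F = 2 (p₁² - p₂²) + 2 f p₁ - 2 g p₂ + u₀`. On `{H = ½}`, where `p = √Λ (cos φ, sin φ)`,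
this is `∑ a_k exp (i k φ)` with `a_{-k} = conj a_k`, `a₂ = Λ`, `a₁ = √Λ (f + i g)`,
`a₀ = u₀`. -/
def magIntegral (U : Plane → State) (z : Phase) : ℝ :=
  2 * (z.2 0 ^ 2 - z.2 1 ^ 2) + 2 * U z.1 2 * z.2 0 - 2 * U z.1 3 * z.2 1 + U z.1 1

/-- The state of the Liouville metric `(Λ₁(x) + Λ₂(y)) (dx² + dy²)` without magnetic field. -/
def liouvilleState (L₁ L₂ : ℝ → ℝ) (q : Plane) : State :=
  ![L₁ (q 0) + L₂ (q 1), 2 * L₂ (q 1) - 2 * L₁ (q 0), 0, 0]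

/-- `U` is a real-analytic solution of `U_t = A₁(U) U_x + B₁(U) U_y` for `|t| < ε`, defined on the
whole plane, with initial value `U₀`. -/
def IsSymmetryFlow (ε : ℝ) (U₀ : Plane → State) (U : ℝ → Plane → State) : Prop :=
  AnalyticOnNhd ℝ (fun z : ℝ × Plane => U z.1 z.2) {z | |z.1| < ε} ∧
  U 0 = U₀ ∧
  ∀ t, |t| < ε → ∀ q, deriv (fun s => U s q) t =
    symA (U t q) *ᵥ pd 0 (U t) q + symB (U t q) *ᵥ pd 1 (U t) q

end

noncomputable section

/-! ### The Cauchy–Kovalevskaya majorant -/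

/-! Write p = √Λ (cos φ, sin φ) on {H = ½}. Then F becomes u₀ + 2Λ cos 2φ + 2√Λ (f cos φ - g sin φ),
and most of the argument rests on this trigonometric polynomial.

Structure of (S). The Riemann invariants are the critical values of F in φ, and the eigenvalue
attached to a critical phase φ is tan φ. Eliminating φ gives the characteristic quartic (fλ + g)² (1
+ λ²) = 16 Λ λ² (`det_magB_sub`, `exists_phase`). Since φ is critical, its own derivative drops out
of the gradient of the critical value (`fderiv_riemannInvariant`), and that gradient is a left
eigenvector of A⁻¹B (`riemannGradient_vecMul`). Conservation laws come from explicit polynomials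
whose Jacobians are ZA and ZB for one matrix Z. Linear degeneracy fails at a state with a rational
eigenvalue, by implicit differentiation of the quartic.

Integrals. Λ times the bracket, restricted to the level, is a polynomial of degree two in p built
from the four residuals of (S) (`magBracket_eq`). Four momenta on the coordinate axes recover them
all.

Deformation. (E) has the form U_t = B(U, DU) + L(DU). Periodic analytic data satisfy Cauchy
estimates uniform over the plane, so the method of majorants gives a solution on all of ℝ² for a
common time (`exists_analytic_solution`). Along (E) the time derivatives of the residuals of (S) are
linear in the residuals and their space derivatives (`dT_residuals`). They vanish at t = 0, so all
their time derivatives vanish there and analyticity makes them zero (`eqOn_zero_of_evolution`). The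
same principle, applied to differences of solutions, gives uniqueness.

Not Liouville. Global Liouville coordinates for a conformal metric give a conformal diffeomorphism
of the plane, which must be affine (`exists_affine_of_conformal`). Hence Λ satisfies ab (Λ_yy -
Λ_xx) + (a² - b²) Λ_xy = 0 with constants a, b not both zero. Periodicity then leaves two cases:
Λ_xy ≡ 0, or Λ_xx has a zero on every line x = const. At t = 0 one has ∂_t² Λ_xy = 4 (Λ₁''' Λ₂' +
Λ₁' Λ₂'''), which is non-zero somewhere; this excludes the first case for small t ≠ 0. In the
second, Λ_xx stays close to Λ₁''(x₀) ≠ 0 on the line x = x₀. Finally ∂_t Ω = Λ₁'' - Λ₂'' at t = 0,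
which is not identically zero. -/

lemma sum_range_inv_sq_le (N : ℕ) :
    ∑ i ∈ Finset.range (N + 1), 1 / ((i : ℝ) + 1) ^ 2 ≤ 2 - 1 / ((N : ℝ) + 1) := by
  induction N with
  | zero => norm_num
  | succ N ih =>
    rw [Finset.sum_range_succ]
    have h1 : (0 : ℝ) < (N : ℝ) + 1 := by positivity
    have h2 : 1 / (((N + 1 : ℕ) : ℝ) + 1) ^ 2 ≤
        1 / ((N : ℝ) + 1) - 1 / (((N + 1 : ℕ) : ℝ) + 1) := by
      push_cast
      rw [div_sub_div _ _ (by positivity) (by positivity), div_le_div_iff₀ (by positivity)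
        (by positivity)]
      nlinarith
    linarith

lemma sum_antidiagonal_inv_sq_le (N : ℕ) :
    ∑ x ∈ Finset.HasAntidiagonal.antidiagonal N, 1 / ((x.1 : ℝ) + 1) ^ 2 ≤ 2 := by
  rw [Finset.Nat.sum_antidiagonal_eq_sum_range_succ_mk]
  have := sum_range_inv_sq_le N
  have : (0 : ℝ) ≤ 1 / ((N : ℝ) + 1) := by positivity
  simp only at *
  linarith

/-- This is why the majorant carries the denominator (n + k + 1)²: convolution against it reproduces
the same weight up to a constant. On the antidiagonal (a + 1) + (b + 2) = N + 3, so partial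
fractions extract 1/(N + 3) and leave convergent sums of inverse squares. -/
lemma sum_antidiagonal_weight_le (N : ℕ) :
    ∑ x ∈ Finset.HasAntidiagonal.antidiagonal N,
      ((x.2 : ℝ) + 1) / (((x.1 : ℝ) + 1) ^ 2 * ((x.2 : ℝ) + 2) ^ 2) ≤
      6 * ((N : ℝ) + 1) / ((N : ℝ) + 2) ^ 2 := by
  have h1 : ∀ x ∈ Finset.HasAntidiagonal.antidiagonal N,
      ((x.2 : ℝ) + 1) / (((x.1 : ℝ) + 1) ^ 2 * ((x.2 : ℝ) + 2) ^ 2) ≤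
      1 / ((N : ℝ) + 3) * (3 / 2 * (1 / ((x.1 : ℝ) + 1) ^ 2) + 1 / 2 * (1 / ((x.2 : ℝ) + 1) ^ 2)) := by
    intro x hx
    have hN : (N : ℝ) = x.1 + x.2 := by exact_mod_cast (Finset.HasAntidiagonal.mem_antidiagonal.1 hx).symm
    have ha : (0 : ℝ) ≤ x.1 := by positivity
    have hb : (0 : ℝ) ≤ x.2 := by positivity
    generalize (x.1 : ℝ) = a at *
    generalize (x.2 : ℝ) = b at *
    have e1 : (b + 1) / ((a + 1) ^ 2 * (b + 2) ^ 2) ≤ 1 / ((a + 1) ^ 2 * (b + 2)) := by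
      rw [div_le_div_iff₀ (by positivity) (by positivity)]
      have : 0 ≤ (a + 1) ^ 2 * (b + 2) := by positivity
      nlinarith
    have e2 : 1 / ((a + 1) ^ 2 * (b + 2)) =
        1 / (N + 3) * (1 / (a + 1) ^ 2 + (1 / (a + 1)) * (1 / (b + 2))) := by
      rw [hN]; field_simp; ring
    have e3 : (1 / (a + 1)) * (1 / (b + 2)) ≤
        1 / 2 * (1 / (a + 1) ^ 2) + 1 / 2 * (1 / (b + 1) ^ 2) := by
      have : 1 / (b + 2) ≤ 1 / (b + 1) := one_div_le_one_div_of_le (by positivity) (by linarith)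
      have h0 : 0 ≤ 1 / (a + 1) := by positivity
      have := mul_le_mul_of_nonneg_left this h0
      have h2 := sq_nonneg (1 / (a + 1) - 1 / (b + 1))
      have h3 : 1 / (a + 1) ^ 2 = (1 / (a + 1)) ^ 2 := by simp
      have h4 : 1 / (b + 1) ^ 2 = (1 / (b + 1)) ^ 2 := by simp
      rw [h3, h4]
      nlinarith
    calc _ ≤ _ := e1
      _ = _ := e2
      _ ≤ _ := by
        have : (0 : ℝ) ≤ 1 / (N + 3) := by positivity
        apply mul_le_mul_of_nonneg_left _ this
        linarith
  refine (Finset.sum_le_sum h1).trans ?_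
  rw [← Finset.mul_sum, Finset.sum_add_distrib, ← Finset.mul_sum, ← Finset.mul_sum]
  have h2 := sum_antidiagonal_inv_sq_le N
  have h3 : ∑ x ∈ Finset.HasAntidiagonal.antidiagonal N, 1 / ((x.2 : ℝ) + 1) ^ 2 ≤ 2 := by
    rw [← Finset.Nat.sum_antidiagonal_swap]
    simpa using h2
  have h4 : 1 / ((N : ℝ) + 3) * 4 ≤ 6 * ((N : ℝ) + 1) / ((N : ℝ) + 2) ^ 2 := by
    rw [one_div_mul_eq_div, div_le_div_iff₀ (by positivity) (by positivity)]
    have : (0 : ℝ) ≤ N := by positivity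
    nlinarith
  refine le_trans (mul_le_mul_of_nonneg_left ?_ (by positivity)) h4
  linarith

/-- Vandermonde's identity: for fixed y the shift x ↦ x + y embeds one antidiagonal into that of n +
k, and summing the products of binomials over y gives a single binomial. It reduces the double
convolution in (n, k) to one in n + k. -/
lemma sum_antidiagonal_choose_mul_le (n k : ℕ) (φ : ℕ → ℕ → ℝ) (hφ : ∀ i j, 0 ≤ φ i j) :
    ∑ x ∈ Finset.HasAntidiagonal.antidiagonal n, ∑ y ∈ Finset.HasAntidiagonal.antidiagonal k,
      ((x.1 + y.1).choose y.1 : ℝ) * ((x.2 + y.2).choose y.2 : ℝ) * φ (x.1 + y.1) (x.2 + y.2) ≤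
    ((n + k).choose k : ℝ) * ∑ z ∈ Finset.HasAntidiagonal.antidiagonal (n + k), φ z.1 z.2 := by
  rw [Finset.sum_comm, Finset.mul_sum]
  have : ∀ z ∈ Finset.HasAntidiagonal.antidiagonal (n + k), ((n + k).choose k : ℝ) * φ z.1 z.2 =
      ∑ y ∈ Finset.HasAntidiagonal.antidiagonal k, ((z.1.choose y.1 : ℝ) * (z.2.choose y.2 : ℝ)) * φ z.1 z.2 := by
    intro z hz
    rw [← Finset.sum_mul, ← Finset.HasAntidiagonal.mem_antidiagonal.1 hz, Nat.add_choose_eq]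
    push_cast
    rfl
  rw [Finset.sum_congr rfl this, Finset.sum_comm (s := Finset.HasAntidiagonal.antidiagonal (n + k))]
  refine Finset.sum_le_sum fun y hy => ?_
  have hy' := Finset.HasAntidiagonal.mem_antidiagonal.1 hy
  let e : ℕ × ℕ → ℕ × ℕ := fun x => (x.1 + y.1, x.2 + y.2)
  have he : Function.Injective e := by
    intro a b h
    simp only [e, Prod.mk.injEq] at h
    ext <;> omega
  rw [← Finset.sum_image (s := Finset.HasAntidiagonal.antidiagonal n) (g := e)
    (f := fun z => ((z.1.choose y.1 : ℝ) * (z.2.choose y.2 : ℝ)) * φ z.1 z.2) he.injOn]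
  refine Finset.sum_le_sum_of_subset_of_nonneg ?_ ?_
  · intro z hz
    obtain ⟨x, hx, rfl⟩ := Finset.mem_image.1 hz
    rw [Finset.HasAntidiagonal.mem_antidiagonal] at hx ⊢
    simp only [e]
    omega
  · intro z _ _
    have := hφ z.1 z.2
    positivity

/-- The majorant of the `k`-th Taylor coefficient in space of the `n`-th one in time. -/
def ckMajorant (C R T : ℝ) (n k : ℕ) : ℝ :=
  C * R ^ k * T ^ n * ((n + k).choose k : ℝ) / ((n + k : ℕ) + 1 : ℝ) ^ 2

lemma ckMajorant_nonneg {C R T : ℝ} (hC : 0 ≤ C) (hR : 0 ≤ R) (hT : 0 ≤ T) (n k : ℕ) :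
    0 ≤ ckMajorant C R T n k := by
  unfold ckMajorant; positivity

/-- A space derivative at (n, k) and a time derivative at (n, k) of the majorant carry the same
combinatorial weight (compare `add_one_mul_ckMajorant_succ`). They differ only by trading a factor R
for a factor T. -/
lemma succ_mul_ckMajorant (C R T : ℝ) (n k : ℕ) :
    ((k : ℝ) + 1) * ckMajorant C R T n (k + 1) =
      C * R ^ (k + 1) * T ^ n * (((n + k).choose k : ℝ) *
        (((n + k : ℕ) + 1 : ℝ) / ((n + k : ℕ) + 2 : ℝ) ^ 2)) := by
  have h : ((n + (k + 1)).choose (k + 1) : ℝ) * ((k : ℝ) + 1) =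
      ((n + k : ℕ) + 1 : ℝ) * ((n + k).choose k : ℝ) := by
    exact_mod_cast (Nat.add_one_mul_choose_eq (n + k) k).symm
  have h2 : (((n + (k + 1) : ℕ) : ℝ) + 1) = ((n + k : ℕ) + 2 : ℝ) := by push_cast; ring
  unfold ckMajorant
  rw [h2]
  calc _ = C * R ^ (k + 1) * T ^ n * (((n + (k + 1)).choose (k + 1) : ℝ) * ((k : ℝ) + 1)) /
        ((n + k : ℕ) + 2 : ℝ) ^ 2 := by ring
    _ = _ := by rw [h]; ring

lemma add_one_mul_ckMajorant_succ (C R T : ℝ) (n k : ℕ) :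
    ((n : ℝ) + 1) * ckMajorant C R T (n + 1) k =
      C * R ^ k * T ^ (n + 1) * (((n + k).choose k : ℝ) *
        (((n + k : ℕ) + 1 : ℝ) / ((n + k : ℕ) + 2 : ℝ) ^ 2)) := by
  have h : ((n + 1 + k).choose k : ℝ) * ((n : ℝ) + 1) =
      ((n + k : ℕ) + 1 : ℝ) * ((n + k).choose k : ℝ) := by
    have := Nat.add_one_mul_choose_eq (n + k) n
    rw [Nat.choose_symm_add, Nat.choose_symm_of_eq_add (show n + k + 1 = (n + 1) + k by ring),
      show n + k + 1 = n + 1 + k by ring] at this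
    rw [show (((n + k : ℕ) : ℝ) + 1) = ((n + 1 + k : ℕ) : ℝ) by push_cast; ring]
    exact_mod_cast this.symm
  have h2 : (((n + 1 + k : ℕ) : ℝ) + 1) = ((n + k : ℕ) + 2 : ℝ) := by push_cast; ring
  unfold ckMajorant
  rw [h2]
  calc _ = C * R ^ k * T ^ (n + 1) * (((n + 1 + k).choose k : ℝ) * ((n : ℝ) + 1)) /
        ((n + k : ℕ) + 2 : ℝ) ^ 2 := by ring
    _ = _ := by rw [h]; ring

/-- The method of majorants for a quadratic first-order evolution equation. -/
lemma le_ckMajorant {a : ℕ → ℕ → ℝ} {K L C R T : ℝ} (ha : ∀ n k, 0 ≤ a n k)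
    (hK : 0 ≤ K) (hL : 0 ≤ L) (hC : 0 ≤ C) (hR : 0 ≤ R) (hT : (6 * K * C + L) * R ≤ T)
    (h0 : ∀ k : ℕ, a 0 k ≤ ckMajorant C R T 0 k)
    (hs : ∀ n k : ℕ, ((n : ℝ) + 1) * a (n + 1) k ≤
      K * ∑ x ∈ Finset.HasAntidiagonal.antidiagonal n, ∑ y ∈ Finset.HasAntidiagonal.antidiagonal k,
        a x.1 y.1 * (((y.2 : ℝ) + 1) * a x.2 (y.2 + 1)) + L * (((k : ℝ) + 1) * a n (k + 1))) :
    ∀ n k : ℕ, a n k ≤ ckMajorant C R T n k := by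
  have hT0 : 0 ≤ T := le_trans (by positivity) hT
  intro n
  -- The recursion lowers n but raises k by one, so the induction is on n with all k at once.
  induction n using Nat.strong_induction_on with
  | _ n ih =>
  intro k
  rcases n with _ | n
  · exact h0 k
  have hpos : (0 : ℝ) < (n : ℝ) + 1 := by positivity
  refine le_of_mul_le_mul_left ((hs n k).trans ?_) hpos
  have h1 : ∑ x ∈ Finset.HasAntidiagonal.antidiagonal n, ∑ y ∈ Finset.HasAntidiagonal.antidiagonal k,
        a x.1 y.1 * (((y.2 : ℝ) + 1) * a x.2 (y.2 + 1)) ≤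
      ∑ x ∈ Finset.HasAntidiagonal.antidiagonal n, ∑ y ∈ Finset.HasAntidiagonal.antidiagonal k, C ^ 2 * R ^ (k + 1) * T ^ n *
        (((x.1 + y.1).choose y.1 : ℝ) * ((x.2 + y.2).choose y.2 : ℝ) *
        ((((x.2 + y.2 : ℕ) : ℝ) + 1) /
          ((((x.1 + y.1 : ℕ) : ℝ) + 1) ^ 2 * (((x.2 + y.2 : ℕ) : ℝ) + 2) ^ 2))) := by
    refine Finset.sum_le_sum fun x hx => Finset.sum_le_sum fun y hy => ?_
    have hx' := Finset.HasAntidiagonal.mem_antidiagonal.1 hx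
    have hy' := Finset.HasAntidiagonal.mem_antidiagonal.1 hy
    calc a x.1 y.1 * (((y.2 : ℝ) + 1) * a x.2 (y.2 + 1))
        ≤ ckMajorant C R T x.1 y.1 * (((y.2 : ℝ) + 1) * ckMajorant C R T x.2 (y.2 + 1)) := by
          refine mul_le_mul (ih _ (by omega) _) ?_ ?_ (ckMajorant_nonneg hC hR hT0 _ _)
          · exact mul_le_mul_of_nonneg_left (ih _ (by omega) _) (by positivity)
          · exact mul_nonneg (by positivity) (ha _ _)
      _ = _ := by
          rw [succ_mul_ckMajorant, ckMajorant, ← hx', ← hy']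
          have hb : (((x.1 + y.1 : ℕ) : ℝ) + 1) ≠ 0 := by positivity
          have hc : (((x.2 + y.2 : ℕ) : ℝ) + 2) ≠ 0 := by positivity
          field_simp
          ring
  have h2 := sum_antidiagonal_choose_mul_le n k
    (fun i j => (((j : ℝ) + 1) / (((i : ℝ) + 1) ^ 2 * ((j : ℝ) + 2) ^ 2)))
    (fun i j => by positivity)
  have h3 := sum_antidiagonal_weight_le (n + k)
  have h4 : L * (((k : ℝ) + 1) * a n (k + 1)) ≤ L * (((k : ℝ) + 1) * ckMajorant C R T n (k + 1)) :=
    mul_le_mul_of_nonneg_left (mul_le_mul_of_nonneg_left (ih n (by omega) _) (by positivity)) hL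
  rw [succ_mul_ckMajorant] at h4
  simp only [← Finset.mul_sum] at h1
  rw [add_one_mul_ckMajorant_succ]
  set W : ℝ := ((n + k).choose k : ℝ) * (((n + k : ℕ) + 1 : ℝ) / ((n + k : ℕ) + 2 : ℝ) ^ 2) with hW
  have hW0 : 0 ≤ W := by positivity
  have h5 : ∑ x ∈ Finset.HasAntidiagonal.antidiagonal n, ∑ y ∈ Finset.HasAntidiagonal.antidiagonal k,
        a x.1 y.1 * (((y.2 : ℝ) + 1) * a x.2 (y.2 + 1)) ≤ C ^ 2 * R ^ (k + 1) * T ^ n * (6 * W) := by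
    refine h1.trans (mul_le_mul_of_nonneg_left ?_ (by positivity))
    refine h2.trans ((mul_le_mul_of_nonneg_left h3 (by positivity)).trans_eq ?_)
    rw [hW]; ring
  -- Every term is now a multiple of the same W, and the choice of T is exactly what closes the
  -- induction.
  calc _ ≤ K * (C ^ 2 * R ^ (k + 1) * T ^ n * (6 * W)) + L * (C * R ^ (k + 1) * T ^ n * W) :=
        add_le_add (mul_le_mul_of_nonneg_left h5 hK) h4
    _ = (C * R ^ k * T ^ n * W) * ((6 * K * C + L) * R) := by ring
    _ ≤ (C * R ^ k * T ^ n * W) * T := mul_le_mul_of_nonneg_left hT (by positivity)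
    _ = _ := by ring

lemma ckMajorant_le {C R T : ℝ} (hC : 0 ≤ C) (hR : 0 ≤ R) (hT : 0 ≤ T) (n k : ℕ) :
    ckMajorant C R T n k ≤ C * (2 * T) ^ n * (2 * R) ^ k := by
  have h1 : ((n + k).choose k : ℝ) ≤ 2 ^ (n + k) := by exact_mod_cast Nat.choose_le_two_pow _ _
  have h2 : (1 : ℝ) ≤ ((n + k : ℕ) + 1 : ℝ) ^ 2 := by
    apply one_le_pow₀; push_cast; linarith [(n.cast_nonneg : (0 : ℝ) ≤ n), (k.cast_nonneg : (0 : ℝ) ≤ k)]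
  unfold ckMajorant
  refine (div_le_self (by positivity) h2).trans ?_
  calc _ ≤ C * R ^ k * T ^ n * 2 ^ (n + k) := mul_le_mul_of_nonneg_left h1 (by positivity)
    _ = _ := by rw [mul_pow, mul_pow, pow_add]; ring

end

/-! ### Taylor coefficients in time: estimates and convergence. -/

noncomputable section

section CauchyKovalevskaya

open Finset.HasAntidiagonal

set_option maxSynthPendingDepth 3

variable {P E : Type*} [NormedAddCommGroup P] [NormedSpace ℝ P] [NormedAddCommGroup E]
  [NormedSpace ℝ E]

/-- Taylor coefficients in time of the solution of `U_t = B(U, DU) + L(DU)`, `U|_{t=0} = u`. -/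
def timeCoeff (B : E →L[ℝ] (P →L[ℝ] E) →L[ℝ] E) (L : (P →L[ℝ] E) →L[ℝ] E) (u : P → E) :
    ℕ → P → E
  | 0 => u
  | n + 1 => fun q => ((n : ℝ) + 1)⁻¹ •
      (∑ i : Fin (n + 1), B (timeCoeff B L u i q) (fderiv ℝ (timeCoeff B L u (n - i)) q) +
        L (fderiv ℝ (timeCoeff B L u n) q))

variable {B : E →L[ℝ] (P →L[ℝ] E) →L[ℝ] E} {L : (P →L[ℝ] E) →L[ℝ] E} {u : P → E}

lemma timeCoeff_zero : timeCoeff B L u 0 = u := by rw [timeCoeff]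

lemma add_one_smul_timeCoeff_succ (n : ℕ) :
    (fun q => ((n : ℝ) + 1) • timeCoeff B L u (n + 1) q) = fun q =>
      ∑ x ∈ antidiagonal n, B (timeCoeff B L u x.1 q) (fderiv ℝ (timeCoeff B L u x.2) q) +
        L (fderiv ℝ (timeCoeff B L u n) q) := by
  funext q
  have : ((n : ℝ) + 1) ≠ 0 := by positivity
  rw [timeCoeff, smul_smul, mul_inv_cancel₀ this, one_smul,
    Finset.Nat.sum_antidiagonal_eq_sum_range_succ_mk, Finset.sum_range]

lemma contDiff_timeCoeff (hu : ContDiff ℝ ∞ u) (n : ℕ) : ContDiff ℝ ∞ (timeCoeff B L u n) := by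
  induction n using Nat.strong_induction_on with
  | _ n ih =>
  rcases n with _ | n
  · rwa [timeCoeff_zero]
  have h : ∀ i ≤ n, ContDiff ℝ ∞ (fderiv ℝ (timeCoeff B L u i)) := fun i hi =>
    (ih i (by omega)).fderiv_right (by simp)
  have h2 : ∀ i ≤ n, ContDiff ℝ ∞ (timeCoeff B L u i) := fun i hi => ih i (by omega)
  rw [timeCoeff]
  refine ContDiff.const_smul _ (ContDiff.add (ContDiff.sum fun i _ => ?_) ?_)
  · exact B.isBoundedBilinearMap.contDiff.comp₂ (h2 i (by omega)) (h _ (by omega))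
  · exact L.contDiff.comp (h n le_rfl)

/-- `‖D^k c_n(q)‖ / k!`. -/
def timeCoeffNorm (B : E →L[ℝ] (P →L[ℝ] E) →L[ℝ] E) (L : (P →L[ℝ] E) →L[ℝ] E) (u : P → E) (q : P)
    (n k : ℕ) : ℝ :=
  ‖iteratedFDeriv ℝ k (timeCoeff B L u n) q‖ / k.factorial

lemma timeCoeffNorm_fderiv (q : P) (n k : ℕ) :
    ‖iteratedFDeriv ℝ k (fderiv ℝ (timeCoeff B L u n)) q‖ / k.factorial =
      ((k : ℝ) + 1) * timeCoeffNorm B L u q n (k + 1) := by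
  rw [norm_iteratedFDeriv_fderiv, timeCoeffNorm, Nat.factorial_succ]
  have : (k.factorial : ℝ) ≠ 0 := by positivity
  push_cast
  field_simp

/-- After division by k!, the Leibniz bound for a bilinear map loses its binomials and becomes a
Cauchy product. The result is the recursive inequality required by `le_ckMajorant`. -/
lemma timeCoeffNorm_succ_le (hu : ContDiff ℝ ∞ u) (q : P) (n k : ℕ) :
    ((n : ℝ) + 1) * timeCoeffNorm B L u q (n + 1) k ≤
      ‖B‖ * ∑ x ∈ antidiagonal n, ∑ y ∈ antidiagonal k, timeCoeffNorm B L u q x.1 y.1 *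
        (((y.2 : ℝ) + 1) * timeCoeffNorm B L u q x.2 (y.2 + 1)) +
      ‖L‖ * (((k : ℝ) + 1) * timeCoeffNorm B L u q n (k + 1)) := by
  have hc := contDiff_timeCoeff (B := B) (L := L) hu
  have hd : ∀ i, ContDiff ℝ ∞ (fderiv ℝ (timeCoeff B L u i)) := fun i =>
    (hc i).fderiv_right (by simp)
  have hb : ∀ x : ℕ × ℕ, ContDiff ℝ ∞
      (fun q => B (timeCoeff B L u x.1 q) (fderiv ℝ (timeCoeff B L u x.2) q)) := fun x =>
    B.isBoundedBilinearMap.contDiff.comp₂ (hc _) (hd _)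
  have hk : (k : WithTop ℕ∞) ≤ ∞ := by exact_mod_cast le_top
  have hf : (0 : ℝ) < k.factorial := by positivity
  have e1 : ((n : ℝ) + 1) * ‖iteratedFDeriv ℝ k (timeCoeff B L u (n + 1)) q‖ ≤
      ∑ x ∈ antidiagonal n, ‖iteratedFDeriv ℝ k
        (fun q => B (timeCoeff B L u x.1 q) (fderiv ℝ (timeCoeff B L u x.2) q)) q‖ +
        ‖L‖ * ‖iteratedFDeriv ℝ k (fderiv ℝ (timeCoeff B L u n)) q‖ := by
    have e2 := congrArg (fun f => iteratedFDeriv ℝ k f q)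
      (add_one_smul_timeCoeff_succ (B := B) (L := L) (u := u) n)
    have e3 : iteratedFDeriv ℝ k (fun q => ((n : ℝ) + 1) • timeCoeff B L u (n + 1) q) q =
        ((n : ℝ) + 1) • iteratedFDeriv ℝ k (timeCoeff B L u (n + 1)) q :=
      iteratedFDeriv_const_smul_apply (((hc _).of_le hk).contDiffAt)
    have e4 : (fun q => ∑ x ∈ antidiagonal n,
        B (timeCoeff B L u x.1 q) (fderiv ℝ (timeCoeff B L u x.2) q) +
        L (fderiv ℝ (timeCoeff B L u n) q)) = (∑ x ∈ antidiagonal n, fun q =>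
          B (timeCoeff B L u x.1 q) (fderiv ℝ (timeCoeff B L u x.2) q)) +
        (L ∘ fderiv ℝ (timeCoeff B L u n)) := by
      funext q; simp
    simp only [e3] at e2
    rw [e4, iteratedFDeriv_add_apply, iteratedFDeriv_sum_apply] at e2
    · have e5 : ((n : ℝ) + 1) * ‖iteratedFDeriv ℝ k (timeCoeff B L u (n + 1)) q‖ =
          ‖((n : ℝ) + 1) • iteratedFDeriv ℝ k (timeCoeff B L u (n + 1)) q‖ := by
        rw [norm_smul, Real.norm_of_nonneg (by positivity)]
      rw [e5, e2]
      refine (norm_add_le _ _).trans (add_le_add (norm_sum_le _ _) ?_)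
      exact L.norm_iteratedFDeriv_comp_left (hd n).contDiffAt hk
    · exact fun x _ => ((hb x).of_le hk).contDiffAt
    · rw [Finset.sum_fn]
      exact (ContDiff.sum fun x _ => (hb x).of_le hk).contDiffAt
    · exact ((L.contDiff.comp (hd n)).of_le hk).contDiffAt
  have e6 : ∀ x : ℕ × ℕ, ‖iteratedFDeriv ℝ k
        (fun q => B (timeCoeff B L u x.1 q) (fderiv ℝ (timeCoeff B L u x.2) q)) q‖ ≤
      k.factorial * (‖B‖ * ∑ y ∈ antidiagonal k, timeCoeffNorm B L u q x.1 y.1 *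
        (((y.2 : ℝ) + 1) * timeCoeffNorm B L u q x.2 (y.2 + 1))) := by
    intro x
    refine (B.norm_iteratedFDeriv_le_of_bilinear (hc _) (hd _) q hk).trans_eq ?_
    rw [← mul_assoc, mul_comm (k.factorial : ℝ), mul_assoc, Finset.mul_sum (s := antidiagonal k),
      ← Finset.Nat.sum_antidiagonal_eq_sum_range_succ (fun i j => (k.choose i : ℝ) *
        ‖iteratedFDeriv ℝ i (timeCoeff B L u x.1) q‖ *
        ‖iteratedFDeriv ℝ j (fderiv ℝ (timeCoeff B L u x.2)) q‖)]
    congr 1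
    refine Finset.sum_congr rfl fun y hy => ?_
    rw [← timeCoeffNorm_fderiv, timeCoeffNorm]
    have h1 := mem_antidiagonal.1 hy
    have h2 : (k.choose y.1 : ℝ) * y.1.factorial * y.2.factorial = k.factorial := by
      have := Nat.choose_mul_factorial_mul_factorial (show y.1 ≤ k by omega)
      rw [show k - y.1 = y.2 by omega] at this
      exact_mod_cast this
    rw [← h2]
    have h3 : (y.1.factorial : ℝ) ≠ 0 := by positivity
    have h4 : (y.2.factorial : ℝ) ≠ 0 := by positivity
    field_simp
  rw [timeCoeffNorm, ← mul_div_assoc, div_le_iff₀ hf]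
  refine e1.trans ?_
  rw [← timeCoeffNorm_fderiv, add_mul, mul_assoc ‖L‖, div_mul_cancel₀ _ hf.ne']
  gcongr
  rw [mul_comm, Finset.mul_sum, Finset.mul_sum]
  exact Finset.sum_le_sum fun x _ => e6 x

/-- Uniform Cauchy estimates for the time coefficients. -/
lemma exists_norm_iteratedFDeriv_timeCoeff_le (hu : ContDiff ℝ ∞ u) {C A : ℝ}
    (hC : 0 ≤ C) (hA : 0 ≤ A)
    (h : ∀ k q, ‖iteratedFDeriv ℝ k u q‖ ≤ C * A ^ k * k.factorial) :
    ∃ M ρ : ℝ, 0 < M ∧ 0 < ρ ∧ ∀ n k q,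
      ‖iteratedFDeriv ℝ k (timeCoeff B L u n) q‖ ≤ M * ρ ^ n * ρ ^ k * k.factorial := by
  -- The factor 4 absorbs the majorant's denominator at n = 0, because (k + 1)² ≤ 4^k. The 1 keeps R
  -- positive.
  set R : ℝ := 4 * A + 1 with hR
  have hR0 : 0 < R := by positivity
  -- The extra summand R gives R ≤ T, so that one constant 2T serves both in time and in space.
  set T : ℝ := (6 * ‖B‖ * C + ‖L‖) * R + R with hT
  have hT0 : 0 < T := by positivity
  have hRT : R ≤ T := by
    have : 0 ≤ (6 * ‖B‖ * C + ‖L‖) * R := by positivity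
    linarith
  refine ⟨C + 1, 2 * T, by positivity, by positivity, fun n k q => ?_⟩
  have h1 := le_ckMajorant (a := timeCoeffNorm B L u q) (K := ‖B‖) (L := ‖L‖) (C := C) (R := R)
    (T := T) (fun n k => by unfold timeCoeffNorm; positivity) (by positivity) (by positivity) hC
    hR0.le (by rw [hT]; linarith) ?_ (timeCoeffNorm_succ_le hu q) n k
  · have h2 := h1.trans (ckMajorant_le hC hR0.le hT0.le n k)
    rw [timeCoeffNorm, div_le_iff₀ (by positivity)] at h2
    refine h2.trans ?_
    gcongr
    linarith
  · intro k
    rw [timeCoeffNorm, timeCoeff_zero, div_le_iff₀ (by positivity)]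
    refine (h k q).trans ?_
    gcongr
    rw [ckMajorant, zero_add, Nat.choose_self, pow_zero, le_div_iff₀ (by positivity)]
    have h3 : ((k : ℝ) + 1) ^ 2 ≤ 4 ^ k := by
      have : k + 1 ≤ 2 ^ k := Nat.lt_two_pow_self
      have : ((k : ℝ) + 1) ≤ 2 ^ k := by exact_mod_cast this
      calc ((k : ℝ) + 1) ^ 2 ≤ (2 ^ k) ^ 2 := by gcongr
        _ = 4 ^ k := by rw [← pow_mul, mul_comm, pow_mul]; norm_num
    calc C * A ^ k * ((k : ℝ) + 1) ^ 2 ≤ C * A ^ k * 4 ^ k := by gcongr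
      _ = C * (4 * A) ^ k := by rw [mul_pow]; ring
      _ ≤ C * R ^ k := by gcongr; linarith
      _ = _ := by push_cast; ring

/-- Taylor series converge under Cauchy estimates. -/
lemma hasSum_taylor [CompleteSpace E] {f : P → E} (hf : ContDiff ℝ ∞ f) {C A : ℝ}
    (h : ∀ k q, ‖iteratedFDeriv ℝ k f q‖ ≤ C * A ^ k * k.factorial) (hA : 0 ≤ A) (x : P) {y : P}
    (hy : A * ‖y‖ < 1) :
    HasSum (fun k : ℕ => ((k.factorial : ℝ)⁻¹ • iteratedFDeriv ℝ k f x) fun _ => y) (f (x + y)) := by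
  have hC : 0 ≤ C := by simpa using (norm_nonneg _).trans (h 0 x)
  set r := A * ‖y‖ with hr
  have hr0 : 0 ≤ r := by positivity
  have hterm : ∀ k z, ‖iteratedFDeriv ℝ k f z fun _ => y‖ ≤ C * r ^ k * k.factorial := by
    intro k z
    refine (ContinuousMultilinearMap.le_opNorm _ _).trans ?_
    rw [Finset.prod_const, Finset.card_univ, Fintype.card_fin]
    calc _ ≤ C * A ^ k * k.factorial * ‖y‖ ^ k := by gcongr; exact h k z
      _ = _ := by rw [hr, mul_pow]; ring
  have hs : Summable (fun k : ℕ =>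
      ((k.factorial : ℝ)⁻¹ • iteratedFDeriv ℝ k f x) fun _ => y) := by
    refine Summable.of_norm_bounded ((summable_geometric_of_lt_one hr0 hy).mul_left C) fun k => ?_
    rw [smul_apply, norm_smul, norm_inv, Real.norm_natCast,
      inv_mul_le_iff₀ (by positivity)]
    refine (hterm k x).trans_eq (by ring)
  rw [hs.hasSum_iff_tendsto_nat]
  rw [← Filter.tendsto_add_atTop_iff_nat 1, tendsto_iff_norm_sub_tendsto_zero]
  -- The integral remainder has 1/n! against (n + 1)! from the estimate on the derivative of order n
  -- + 1. The surplus factor n + 1 is harmless since r < 1.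
  have hlim : Filter.Tendsto (fun n : ℕ => C * (((n + 1 : ℕ) : ℝ) * r ^ (n + 1))) Filter.atTop
      (𝓝 0) := by
    have := (tendsto_self_mul_const_pow_of_lt_one hr0 hy).const_mul C
    rw [mul_zero] at this
    exact (Filter.tendsto_add_atTop_iff_nat 1).2 this
  refine squeeze_zero (fun _ => norm_nonneg _) (fun n => ?_) hlim
  have ht := map_add_eq_sum_add_integral_iteratedFDeriv (n := n) (f := f) (x := x) (y := y)
    (fun t _ => (hf.of_le (by exact_mod_cast le_top)).contDiffAt)
  rw [ht]
  simp only [smul_apply, sub_add_cancel_left, norm_neg]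
  rw [norm_smul, norm_inv, Real.norm_natCast, inv_mul_le_iff₀ (by positivity)]
  have := intervalIntegral.norm_integral_le_of_norm_le_const (a := (0 : ℝ)) (b := 1)
    (f := fun t => (1 - t) ^ n • iteratedFDeriv ℝ (n + 1) f (x + t • y) fun _ => y)
    (C := C * r ^ (n + 1) * (n + 1).factorial) ?_
  · refine this.trans_eq ?_
    rw [Nat.factorial_succ]
    push_cast
    simp
    ring
  · intro t ht
    rw [Set.uIoc_of_le zero_le_one] at ht
    rw [norm_smul, norm_pow]
    have h1 : ‖(1 - t : ℝ)‖ ≤ 1 := by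
      rw [Real.norm_eq_abs, abs_le]; constructor <;> linarith [ht.1, ht.2]
    calc _ ≤ 1 * (C * r ^ (n + 1) * (n + 1).factorial) := by
          gcongr
          · exact pow_le_one₀ (norm_nonneg _) h1
          · exact hterm _ _
      _ = _ := one_mul _

/-- The homogeneous parts of `∑ tⁿ aₙ(h)`, shifted by `m` in `n`. -/
def jointSeries (a : ℕ → FormalMultilinearSeries ℝ P E) :
    (N : ℕ) → ℕ → ContinuousMultilinearMap ℝ (fun _ : Fin N => ℝ × P) E
  | 0, m => (a m 0).compContinuousLinearMap fun _ => ContinuousLinearMap.snd ℝ ℝ P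
  | N + 1, m => ((ContinuousLinearMap.fst ℝ ℝ P).smulRight (jointSeries a N (m + 1))).uncurryLeft +
      (a m (N + 1)).compContinuousLinearMap fun _ => ContinuousLinearMap.snd ℝ ℝ P

/-- The recursion peels off one time variable at a time, and `m` counts those already removed. For
`m = 0` this is the part of ∑ tⁿ aₙ(h) of total degree N in (t, h). -/
lemma jointSeries_apply (a : ℕ → FormalMultilinearSeries ℝ P E) (N m : ℕ) (z : ℝ × P) :
    jointSeries a N m (fun _ => z) =
      ∑ x ∈ antidiagonal N, z.1 ^ x.1 • a (m + x.1) x.2 (fun _ => z.2) := by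
  induction N generalizing m with
  | zero => simp [jointSeries]
  | succ N ih =>
    rw [Finset.Nat.sum_antidiagonal_succ, jointSeries]
    simp only [add_apply, ContinuousLinearMap.uncurryLeft_apply,
      ContinuousLinearMap.smulRight_apply, ContinuousLinearMap.coe_fst',
      smul_apply, ContinuousMultilinearMap.compContinuousLinearMap_apply,
      ContinuousLinearMap.coe_snd', pow_zero, one_smul, add_zero]
    have : (Fin.tail fun _ : Fin (N + 1) => z) = fun _ => z := rfl
    rw [this, ih, Finset.smul_sum, add_comm]
    congr 1
    refine Finset.sum_congr rfl fun x _ => ?_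
    rw [smul_smul, pow_succ', add_right_comm, add_assoc]

lemma norm_jointSeries_le (a : ℕ → FormalMultilinearSeries ℝ P E) (N m : ℕ) :
    ‖jointSeries a N m‖ ≤ ∑ x ∈ antidiagonal N, ‖a (m + x.1) x.2‖ := by
  have hsnd : ∀ n k, ‖(a n k).compContinuousLinearMap fun _ => ContinuousLinearMap.snd ℝ ℝ P‖ ≤
      ‖a n k‖ := by
    intro n k
    refine (ContinuousMultilinearMap.norm_compContinuousLinearMap_le _ _).trans ?_
    refine mul_le_of_le_one_right (norm_nonneg _) (Finset.prod_le_one (fun _ _ => norm_nonneg _) ?_)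
    exact fun _ _ => ContinuousLinearMap.norm_snd_le ..
  induction N generalizing m with
  | zero => simpa [jointSeries] using hsnd m 0
  | succ N ih =>
    rw [Finset.Nat.sum_antidiagonal_succ, jointSeries]
    refine (norm_add_le _ _).trans ((add_comm _ _).trans_le
      (add_le_add (by simpa using hsnd m (N + 1)) ?_))
    rw [ContinuousLinearMap.uncurryLeft_norm, ContinuousLinearMap.norm_smulRight_apply]
    refine (mul_le_of_le_one_left (norm_nonneg _) (ContinuousLinearMap.norm_fst_le ..)).trans ?_
    refine (ih (m + 1)).trans_eq (Finset.sum_congr rfl fun x _ => ?_)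
    rw [add_right_comm, add_assoc]

/-- A power series in `t` whose coefficients have uniformly bounded power series is a power series
in all variables. -/
lemma hasFPowerSeriesOnBall_tsum [CompleteSpace E] {c : ℕ → P → E}
    {a : ℕ → FormalMultilinearSeries ℝ P E} {M ρ : ℝ} (hM : 0 ≤ M) (hρ : 0 < ρ)
    (hb : ∀ n k, ‖a n k‖ ≤ M * ρ ^ n * ρ ^ k) {q : P}
    (hc : ∀ n h, ρ * ‖h‖ < 1 → HasSum (fun k => a n k fun _ => h) (c n (q + h))) :
    HasFPowerSeriesOnBall (fun z : ℝ × P => ∑' n, z.1 ^ n • c n z.2)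
      (fun N => jointSeries a N 0) (0, q) (ENNReal.ofReal (1 / (2 * ρ))) where
  r_le := by
    refine FormalMultilinearSeries.le_radius_of_bound _ M fun N => ?_
    rw [Real.coe_toNNReal _ (by positivity)]
    -- There are N + 1 ≤ 2^N terms of total degree N, which costs a factor 2 in the radius: hence
    -- 1/(2ρ) rather than 1/ρ.
    have h1 : ‖jointSeries a N 0‖ ≤ M * ((N : ℝ) + 1) * ρ ^ N := by
      refine (norm_jointSeries_le a N 0).trans ?_
      refine (Finset.sum_le_card_nsmul _ _ (M * ρ ^ N) fun x hx => ?_).trans_eq ?_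
      · refine (hb _ _).trans_eq ?_
        rw [mul_assoc, ← pow_add, zero_add, mem_antidiagonal.1 hx]
      · rw [Finset.Nat.card_antidiagonal, nsmul_eq_mul]; push_cast; ring
    have h2 : ((N : ℝ) + 1) ≤ 2 ^ N := by
      have : N + 1 ≤ 2 ^ N := Nat.lt_two_pow_self
      exact_mod_cast this
    calc ‖jointSeries a N 0‖ * (1 / (2 * ρ)) ^ N ≤ M * 2 ^ N * ρ ^ N * (1 / (2 * ρ)) ^ N := by
          gcongr
          exact h1.trans (by gcongr)
      _ = M * (2 * ρ * (1 / (2 * ρ))) ^ N := by rw [mul_pow, mul_pow]; ring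
      _ = M := by rw [mul_one_div_cancel (by positivity), one_pow, mul_one]
  r_pos := by
    rw [ENNReal.ofReal_pos]; positivity
  hasSum := by
    intro z hz
    have hz' : ‖z‖ < 1 / (2 * ρ) := by
      rw [mem_eball_zero_iff, ← ofReal_norm] at hz
      exact (ENNReal.ofReal_lt_ofReal_iff (by positivity)).1 hz
    have key : ρ * ‖z‖ < 1 := by
      have := mul_lt_mul_of_pos_left hz' hρ
      have h2 : ρ * (1 / (2 * ρ)) = 1 / 2 := by field_simp
      linarith
    have h1 : ρ * |z.1| < 1 := by
      refine lt_of_le_of_lt ?_ key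
      gcongr
      exact norm_fst_le z
    have h2 : ρ * ‖z.2‖ < 1 := by
      refine lt_of_le_of_lt ?_ key
      gcongr
      exact norm_snd_le z
    have hsum : Summable (fun x : ℕ × ℕ => z.1 ^ x.1 • a x.1 x.2 fun _ => z.2) := by
      have g := ((summable_geometric_of_lt_one (by positivity) h1).mul_left M).mul_of_nonneg
        (summable_geometric_of_lt_one (by positivity) h2) (fun _ => by positivity)
        (fun _ => by positivity)
      refine Summable.of_norm_bounded g fun x => ?_
      rw [norm_smul, norm_pow, Real.norm_eq_abs]
      calc _ ≤ |z.1| ^ x.1 * (M * ρ ^ x.1 * ρ ^ x.2 * ‖z.2‖ ^ x.2) := by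
            gcongr
            refine (ContinuousMultilinearMap.le_opNorm _ _).trans ?_
            rw [Finset.prod_const, Finset.card_univ, Fintype.card_fin]
            gcongr
            exact hb _ _
        _ = _ := by rw [mul_pow, mul_pow]; ring
    -- The double series converges absolutely. Summed first in the space degree it gives ∑ tⁿ cₙ;
    -- regrouped by total degree it gives the joint power series.
    have hval : ∑' x : ℕ × ℕ, (z.1 ^ x.1 • a x.1 x.2 fun _ => z.2) =
        ∑' n, z.1 ^ n • c n (q + z.2) :=
      (hsum.hasSum.prod_fiberwise fun n => (hc n z.2 h2).const_smul (z.1 ^ n)).tsum_eq.symm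
    have h3 := hsum.hasSum
    rw [hval] at h3
    replace h3 := (sigmaAntidiagonalEquivProd (A := ℕ)).hasSum_iff.2 h3
    have h4 := h3.sigma fun N => hasSum_fintype _
    simp only [Prod.fst_add, Prod.snd_add, zero_add]
    convert! h4 using 2 with N
    rw [jointSeries_apply]
    simp only [zero_add]
    rw [← Finset.sum_coe_sort (antidiagonal N)]
    rfl

end CauchyKovalevskaya

end

/-! ### The Cauchy–Kovalevskaya existence theorem. -/

noncomputable section

section CauchyKovalevskaya

open Finset.HasAntidiagonal

set_option maxSynthPendingDepth 3

variable {P E : Type*} [NormedAddCommGroup P] [NormedSpace ℝ P] [NormedAddCommGroup E]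
  [NormedSpace ℝ E]

/-- The recursion has constant coefficients in q and so commutes with translations. Periods of the
initial data pass to the series itself, with no appeal to uniqueness. -/
lemma timeCoeff_add_period {B : E →L[ℝ] (P →L[ℝ] E) →L[ℝ] E} {L : (P →L[ℝ] E) →L[ℝ] E} {u : P → E}
    {v : P} (hv : ∀ q, u (q + v) = u q) (n : ℕ) (q : P) :
    timeCoeff B L u n (q + v) = timeCoeff B L u n q := by
  induction n using Nat.strong_induction_on generalizing q with
  | _ n ih =>
  rcases n with _ | n
  · simp only [timeCoeff_zero, hv]
  have hd : ∀ i ≤ n, fderiv ℝ (timeCoeff B L u i) (q + v) = fderiv ℝ (timeCoeff B L u i) q := by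
    intro i hi
    rw [← fderiv_comp_add_right]
    congr 1
    funext q
    exact ih i (by omega) q
  rw [timeCoeff]
  simp only
  rw [hd n le_rfl]
  congr 2
  refine Finset.sum_congr rfl fun i _ => ?_
  rw [hd _ (by omega), ih i (by omega)]

/-- Cauchy product for a continuous bilinear map. -/
lemma hasSum_bilinear_antidiagonal {F G : Type*} [NormedAddCommGroup F] [NormedSpace ℝ F]
    [NormedAddCommGroup G] [NormedSpace ℝ G] [CompleteSpace E] [CompleteSpace F] [CompleteSpace G]
    (B : E →L[ℝ] F →L[ℝ] G) {f : ℕ → E} {g : ℕ → F}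
    (hf : Summable fun n => ‖f n‖) (hg : Summable fun n => ‖g n‖) :
    HasSum (fun n => ∑ x ∈ antidiagonal n, B (f x.1) (g x.2)) (B (∑' n, f n) (∑' n, g n)) := by
  have hs : Summable (fun x : ℕ × ℕ => B (f x.1) (g x.2)) := by
    refine Summable.of_norm_bounded ((hf.mul_left ‖B‖).mul_of_nonneg hg (fun _ => by positivity)
      (fun _ => by positivity)) fun x => ?_
    exact B.le_opNorm₂ _ _
  have h1 : ∀ n, HasSum (fun m => B (f n) (g m)) (B (f n) (∑' n, g n)) := fun n =>
    (B (f n)).hasSum hg.of_norm.hasSum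
  have h2 : HasSum (fun n => B (f n) (∑' n, g n)) (B (∑' n, f n) (∑' n, g n)) :=
    (B.flip (∑' n, g n)).hasSum hf.of_norm.hasSum
  have h3 := hs.hasSum
  rw [(h3.prod_fiberwise h1).unique h2] at h3
  replace h3 := (sigmaAntidiagonalEquivProd (A := ℕ)).hasSum_iff.2 h3
  have h4 := h3.sigma fun N => hasSum_fintype _
  convert! h4 using 2 with N
  rw [← Finset.sum_coe_sort (antidiagonal N)]
  rfl

/-- The Cauchy–Kovalevskaya theorem for `U_t = B(U, DU) + L(DU)`, with initial data satisfying
uniform Cauchy estimates on the whole space. -/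
theorem exists_analytic_solution [CompleteSpace E] (B : E →L[ℝ] (P →L[ℝ] E) →L[ℝ] E)
    (L : (P →L[ℝ] E) →L[ℝ] E) {u : P → E} (hu : ContDiff ℝ ∞ u) {C A : ℝ}
    (hC : 0 ≤ C) (hA : 0 ≤ A)
    (h : ∀ k q, ‖iteratedFDeriv ℝ k u q‖ ≤ C * A ^ k * k.factorial) :
    ∃ ε : ℝ, 0 < ε ∧ ∃ U : ℝ → P → E,
      AnalyticOnNhd ℝ (fun z : ℝ × P => U z.1 z.2) {z | |z.1| < ε} ∧ U 0 = u ∧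
      (∀ t, |t| < ε → ∀ q, HasDerivAt (fun s => U s q)
        (B (U t q) (fderiv ℝ (U t) q) + L (fderiv ℝ (U t) q)) t) ∧
      (∀ v, (∀ q, u (q + v) = u q) → ∀ t q, U t (q + v) = U t q) ∧
      ∀ k, ∃ M : ℝ, 0 < M ∧ ∀ t, |t| < ε → ∀ q,
        ‖iteratedFDeriv ℝ k (fun q => U t q - u q) q‖ ≤ M * |t| := by
  obtain ⟨M, ρ, hM, hρ, hb⟩ := exists_norm_iteratedFDeriv_timeCoeff_le (B := B) (L := L) hu hC hA h
  set c := timeCoeff B L u with hcdef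
  have hc : ∀ n, ContDiff ℝ ∞ (c n) := contDiff_timeCoeff hu
  have hgeom : ∀ t : ℝ, |t| < 1 / (2 * ρ) → |t| * ρ < 1 / 2 := by
    intro t ht
    have := mul_lt_mul_of_pos_right ht hρ
    have h2 : 1 / (2 * ρ) * ρ = 1 / 2 := by field_simp
    linarith
  have hgs : ∀ t : ℝ, |t| < 1 / (2 * ρ) → Summable fun n : ℕ => (|t| * ρ) ^ n := fun t ht =>
    summable_geometric_of_lt_one (by positivity) (by linarith [hgeom t ht])
  have hterm : ∀ (t : ℝ) (n k : ℕ) (q : P),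
      ‖iteratedFDeriv ℝ k (fun q => t ^ n • c n q) q‖ ≤
        M * ρ ^ k * k.factorial * (|t| * ρ) ^ n := by
    intro t n k q
    have : iteratedFDeriv ℝ k (fun q => t ^ n • c n q) q = t ^ n • iteratedFDeriv ℝ k (c n) q :=
      iteratedFDeriv_const_smul_apply ((hc n).of_le (by exact_mod_cast le_top)).contDiffAt
    rw [this, norm_smul, norm_pow, Real.norm_eq_abs]
    calc _ ≤ |t| ^ n * (M * ρ ^ n * ρ ^ k * k.factorial) := by gcongr; exact hb n k q
      _ = _ := by rw [mul_pow]; ring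
  have hterm0 : ∀ (t : ℝ) (n : ℕ) (q : P), ‖t ^ n • c n q‖ ≤ M * (|t| * ρ) ^ n := by
    intro t n q
    simpa using hterm t n 0 q
  have hterm1 : ∀ (t : ℝ) (n : ℕ) (q : P),
      ‖t ^ n • fderiv ℝ (c n) q‖ ≤ M * ρ * (|t| * ρ) ^ n := by
    intro t n q
    have h1 := hterm t n 1 q
    rw [norm_iteratedFDeriv_one] at h1
    have : fderiv ℝ (fun q => t ^ n • c n q) q = t ^ n • fderiv ℝ (c n) q :=
      fderiv_const_smul ((hc n).differentiable (by simp) q) (t ^ n)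
    rw [this] at h1
    simpa using h1
  set U : ℝ → P → E := fun t q => ∑' n, t ^ n • c n q with hU
  have hU0 : U 0 = u := by
    funext q
    rw [hU]
    simp only
    rw [tsum_eq_single 0 (fun n hn => by simp [hn])]
    simp [hcdef, timeCoeff_zero]
  -- This is the radius of the joint power series. As it does not depend on the centre q, the
  -- solution lives on a full slab. It also gives |t| ρ < 1/2, hence geometric sums bounded by 2.
  refine ⟨1 / (2 * ρ), by positivity, U, ?_, hU0, ?_, ?_, ?_⟩
  · rintro ⟨t, q⟩ ht
    let a : ℕ → FormalMultilinearSeries ℝ P E :=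
      fun n k => (k.factorial : ℝ)⁻¹ • iteratedFDeriv ℝ k (c n) q
    have hps : HasFPowerSeriesOnBall (fun z : ℝ × P => U z.1 z.2) (fun N => jointSeries a N 0)
        (0, q) (ENNReal.ofReal (1 / (2 * ρ))) := by
      refine hasFPowerSeriesOnBall_tsum (M := M) (ρ := ρ) hM.le hρ ?_ ?_
      · intro n k
        simp only [a]
        rw [norm_smul, norm_inv, Real.norm_natCast, inv_mul_le_iff₀ (by positivity)]
        exact (hb n k q).trans_eq (by ring)
      · intro n y hy
        exact hasSum_taylor (hc n) (C := M * ρ ^ n) (fun k q => hb n k q) hρ.le q hy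
    refine hps.analyticOnNhd (t, q) ?_
    rw [Metric.mem_eball, edist_dist, ENNReal.ofReal_lt_ofReal_iff (by positivity)]
    simpa [Prod.dist_eq] using ht
  · intro t ht q
    have hfd : HasFDerivAt (U t) (∑' n, t ^ n • fderiv ℝ (c n) q) q := by
      refine hasFDerivAt_tsum (u := fun n => M * ρ * (|t| * ρ) ^ n) ((hgs t ht).mul_left _)
        (fun n x => ((hc n).differentiable (by simp) x).hasFDerivAt.const_smul (t ^ n))
        (fun n x => hterm1 t n x) (x₀ := q) ?_ q
      exact Summable.of_norm_bounded ((hgs t ht).mul_left M) fun n => hterm0 t n q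
    have htd : HasDerivAt (fun s => U s q) (∑' n : ℕ, ((n : ℝ) * t ^ (n - 1)) • c n q) t := by
      -- Termwise differentiation in time needs a summable bound uniform near t, taken on a slightly
      -- larger ball |s| < r.
      obtain ⟨r, hr, hr2⟩ := exists_between ht
      have hr0 : 0 < r := lt_of_le_of_lt (abs_nonneg t) hr
      have hrr := hgeom r (by rwa [abs_of_pos hr0])
      rw [abs_of_pos hr0] at hrr
      have hsm : Summable fun n : ℕ => M / r * ((n : ℝ) * (r * ρ) ^ n) := by
        have := summable_pow_mul_geometric_of_norm_lt_one 1 (r := r * ρ) (by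
          rw [Real.norm_of_nonneg (by positivity)]; linarith)
        simpa using this.mul_left (M / r)
      refine hasDerivAt_tsum_of_isPreconnected hsm (t := Metric.ball 0 r) Metric.isOpen_ball
        (convex_ball 0 r).isPreconnected (y₀ := t)
        (fun n y _ => (hasDerivAt_pow n y).smul_const (c n q)) ?_ (by simpa using hr) ?_
        (by simpa using hr)
      · intro n y hy
        rcases n with _ | n
        · simp
        have hy' : |y| ≤ r := by simpa using (mem_ball_zero_iff.1 hy).le
        rw [norm_smul, norm_mul, norm_pow, Real.norm_natCast, Real.norm_eq_abs]
        calc _ ≤ ((n + 1 : ℕ) : ℝ) * r ^ n * (M * ρ ^ (n + 1)) := by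
              gcongr
              · rw [Nat.add_sub_cancel]; gcongr
              · simpa using hb (n + 1) 0 q
          _ = _ := by rw [mul_pow]; field_simp; ring
      · exact Summable.of_norm_bounded ((hgs t ht).mul_left M) fun n => hterm0 t n q
    convert! htd using 1
    have hs0 : Summable fun n => ‖t ^ n • c n q‖ :=
      Summable.of_nonneg_of_le (fun _ => norm_nonneg _) (fun n => hterm0 t n q)
        ((hgs t ht).mul_left M)
    have hs1 : Summable fun n => ‖t ^ n • fderiv ℝ (c n) q‖ :=
      Summable.of_nonneg_of_le (fun _ => norm_nonneg _) (fun n => hterm1 t n q)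
        ((hgs t ht).mul_left _)
    have k1 := (hasSum_bilinear_antidiagonal B hs0 hs1).add (L.hasSum hs1.of_norm.hasSum)
    rw [hfd.fderiv]
    refine k1.tsum_eq.symm.trans ?_
    -- By the recursion, the shifted series of time derivatives is term by term the Cauchy product
    -- for B plus the series for L.
    have hsd : Summable fun n : ℕ => ((n : ℝ) * t ^ (n - 1)) • c n q := by
      rw [← summable_nat_add_iff 1]
      refine k1.summable.congr fun n => ?_
      have k2 := congrFun (add_one_smul_timeCoeff_succ (B := B) (L := L) (u := u) n) q
      rw [Nat.add_sub_cancel, mul_comm, mul_smul, Nat.cast_succ, k2, smul_add, Finset.smul_sum,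
        map_smul]
      congr 1
      refine Finset.sum_congr rfl fun x hx => ?_
      rw [map_smul, map_smul, smul_apply, smul_smul, ← pow_add, ← mem_antidiagonal.1 hx,
        add_comm x.2]
    rw [hsd.tsum_eq_zero_add]
    simp only [Nat.cast_zero, zero_mul, zero_smul, zero_add]
    refine tsum_congr fun n => ?_
    have k2 := congrFun (add_one_smul_timeCoeff_succ (B := B) (L := L) (u := u) n) q
    rw [Nat.add_sub_cancel, mul_comm, mul_smul, Nat.cast_succ, k2, smul_add, Finset.smul_sum,
      map_smul]
    congr 1
    refine Finset.sum_congr rfl fun x hx => ?_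
    rw [map_smul, map_smul, smul_apply, smul_smul, ← pow_add, ← mem_antidiagonal.1 hx,
      add_comm x.2]
  · intro v hv t q
    simp only [hU, hcdef, timeCoeff_add_period hv]
  · intro k
    -- The term n = 0 is u, so the difference starts at n = 1. This produces the factor |t| ρ, and
    -- the 2 bounds 1/(1 - |t| ρ).
    refine ⟨M * ρ ^ k * k.factorial * ρ * 2, by positivity, fun t ht q => ?_⟩
    have hle := hgeom t ht
    have e1 : (fun q => U t q - u q) = fun q => ∑' n, t ^ (n + 1) • c (n + 1) q := by
      funext q
      have hs0 : Summable fun n => t ^ n • c n q :=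
        Summable.of_norm_bounded ((hgs t ht).mul_left M) fun n => hterm0 t n q
      simp only [hU]
      rw [hs0.tsum_eq_zero_add]
      simp [hcdef, timeCoeff_zero]
    have hs : ∀ k : ℕ, Summable fun n : ℕ => M * ρ ^ k * k.factorial * (|t| * ρ) ^ (n + 1) :=
      fun k => ((summable_nat_add_iff 1).2 (hgs t ht)).mul_left _
    rw [e1, iteratedFDeriv_tsum_apply (N := ⊤) (v := fun k n =>
        M * ρ ^ k * k.factorial * (|t| * ρ) ^ (n + 1))
      (f := fun n q => t ^ (n + 1) • c (n + 1) q) (fun i => contDiff_const.smul (hc (i + 1))) (fun k _ => hs k)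
      (fun k n x _ => hterm t (n + 1) k x) le_top]
    refine (tsum_of_norm_bounded (hs k).hasSum fun n => hterm t (n + 1) k q).trans ?_
    rw [tsum_mul_left]
    simp only [pow_succ]
    rw [tsum_mul_right, tsum_geometric_of_lt_one (by positivity) (by linarith)]
    have : (1 - |t| * ρ)⁻¹ ≤ 2 := by
      rw [inv_le_comm₀ (by linarith) (by norm_num)]
      linarith
    calc _ ≤ M * ρ ^ k * k.factorial * (2 * (|t| * ρ)) := by gcongr
      _ = _ := by ring

end CauchyKovalevskaya

end

noncomputable section

/-! ### Directional derivatives of scalar functions -/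

section DirDeriv

variable {V : Type*} [NormedAddCommGroup V] [NormedSpace ℝ V]

/-- Derivative of a scalar function in the direction `v`. -/
def dirDeriv (v : V) (Y : V → ℝ) (z : V) : ℝ := fderiv ℝ Y z v

variable {v w : V} {Y Y' : V → ℝ} {z : V}

lemma AnalyticOnNhd.dirDeriv {S : Set V} (h : AnalyticOnNhd ℝ Y S) (v : V) :
    AnalyticOnNhd ℝ (dirDeriv v Y) S := fun z hz =>
  ((ContinuousLinearMap.apply ℝ ℝ v).analyticAt _).comp (h.fderiv z hz)

lemma dirDeriv_congr {S : Set V} (hS : IsOpen S) (h : Set.EqOn Y Y' S) (v : V) :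
    Set.EqOn (dirDeriv v Y) (dirDeriv v Y') S := fun z hz => by
  rw [dirDeriv, dirDeriv, (h.eventuallyEq_of_mem (hS.mem_nhds hz)).fderiv_eq]

lemma dirDeriv_add (h : DifferentiableAt ℝ Y z) (h' : DifferentiableAt ℝ Y' z) :
    dirDeriv v (fun z => Y z + Y' z) z = dirDeriv v Y z + dirDeriv v Y' z := by
  simp only [dirDeriv]
  rw [fderiv_fun_add h h']; rfl

lemma dirDeriv_sub (h : DifferentiableAt ℝ Y z) (h' : DifferentiableAt ℝ Y' z) :
    dirDeriv v (fun z => Y z - Y' z) z = dirDeriv v Y z - dirDeriv v Y' z := by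
  simp only [dirDeriv]
  rw [fderiv_fun_sub h h']; rfl

lemma dirDeriv_mul (h : DifferentiableAt ℝ Y z) (h' : DifferentiableAt ℝ Y' z) :
    dirDeriv v (fun z => Y z * Y' z) z = Y z * dirDeriv v Y' z + Y' z * dirDeriv v Y z := by
  simp only [dirDeriv]
  rw [fderiv_fun_mul h h']; rfl

lemma dirDeriv_const_mul (c : ℝ) (h : DifferentiableAt ℝ Y z) :
    dirDeriv v (fun z => c * Y z) z = c * dirDeriv v Y z := by
  simp only [dirDeriv]
  rw [fderiv_const_mul h]; rfl

lemma dirDeriv_const (c : ℝ) : dirDeriv v (fun _ => c) z = 0 := by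
  simp [dirDeriv]

lemma dirDeriv_comm (h : AnalyticAt ℝ Y z) (v w : V) :
    dirDeriv v (dirDeriv w Y) z = dirDeriv w (dirDeriv v Y) z := by
  have hs : IsSymmSndFDerivAt ℝ Y z := h.contDiffAt.isSymmSndFDerivAt_of_omega
  have key : ∀ v w : V, dirDeriv v (dirDeriv w Y) z = fderiv ℝ (fderiv ℝ Y) z v w := by
    intro v w
    have h1 : dirDeriv w Y = fun z => fderiv ℝ Y z w := rfl
    rw [h1, dirDeriv, fderiv_clm_apply h.fderiv.differentiableAt (differentiableAt_const w)]
    simp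
  rw [key, key, hs v w]

end DirDeriv

/-! ### Uniqueness for linear evolution equations -/

section Uniqueness

variable {P : Type*} [NormedAddCommGroup P] [NormedSpace ℝ P]

/-- The slab `|t| < ε`. -/
def slab (P : Type*) (ε : ℝ) : Set (ℝ × P) := {z | |z.1| < ε}

omit [NormedSpace ℝ P] in
lemma isOpen_slab (ε : ℝ) : IsOpen (slab P ε) :=
  isOpen_lt (continuous_abs.comp continuous_fst) continuous_const

/-- `Y` is analytic on the slab and its time derivatives of order less than `n` vanish at time
zero. -/
def VanishesToOrder (ε : ℝ) : ℕ → (ℝ × P → ℝ) → Prop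
  | 0, Y => AnalyticOnNhd ℝ Y (slab P ε)
  | n + 1, Y => AnalyticOnNhd ℝ Y (slab P ε) ∧ (∀ q, Y (0, q) = 0) ∧
      VanishesToOrder ε n (dirDeriv (1, 0) Y)

namespace VanishesToOrder

variable {ε : ℝ} {n : ℕ} {Y Y' : ℝ × P → ℝ}

lemma analyticOnNhd (h : VanishesToOrder ε n Y) : AnalyticOnNhd ℝ Y (slab P ε) := by
  cases n with
  | zero => exact h
  | succ n => exact h.1

lemma of_succ (h : VanishesToOrder ε (n + 1) Y) : VanishesToOrder ε n Y := by
  induction n generalizing Y with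
  | zero => exact h.1
  | succ n ih => exact ⟨h.1, h.2.1, ih h.2.2⟩

lemma congr (hε : 0 < ε) (h : VanishesToOrder ε n Y) (he : Set.EqOn Y Y' (slab P ε)) :
    VanishesToOrder ε n Y' := by
  induction n generalizing Y Y' with
  | zero => exact AnalyticOnNhd.congr (isOpen_slab ε) h he
  | succ n ih =>
    refine ⟨AnalyticOnNhd.congr (isOpen_slab ε) h.1 he, fun q => ?_,
      ih h.2.2 (dirDeriv_congr (isOpen_slab ε) he _)⟩
    rw [← he (by simpa [slab] using hε), h.2.1]

lemma add (hε : 0 < ε) (h : VanishesToOrder ε n Y) (h' : VanishesToOrder ε n Y') :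
    VanishesToOrder ε n (fun z => Y z + Y' z) := by
  induction n generalizing Y Y' with
  | zero => exact AnalyticOnNhd.add h h'
  | succ n ih =>
    refine ⟨h.1.add h'.1, fun q => by simp [h.2.1, h'.2.1],
      (ih h.2.2 h'.2.2).congr hε fun z hz => ?_⟩
    exact (dirDeriv_add (h.1 z hz).differentiableAt (h'.1 z hz).differentiableAt).symm

lemma mul (hε : 0 < ε) (h : VanishesToOrder ε n Y') (hY : AnalyticOnNhd ℝ Y (slab P ε)) :
    VanishesToOrder ε n (fun z => Y z * Y' z) := by
  induction n generalizing Y Y' with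
  | zero => exact AnalyticOnNhd.mul hY h
  | succ n ih =>
    refine ⟨hY.mul h.1, fun q => by simp [h.2.1], ?_⟩
    refine ((ih h.2.2 hY).add hε (ih h.of_succ (hY.dirDeriv (1, 0)))).congr hε fun z hz => ?_
    rw [dirDeriv_mul (hY z hz).differentiableAt (h.1 z hz).differentiableAt]
    ring

/-- A function vanishing on {t = 0} has vanishing tangential derivatives there, and ∂_t commutes
with ∂_v. Thus the space derivatives on the right of an evolution equation cost no order of
vanishing in time. -/
lemma dirDeriv_space (hε : 0 < ε) (h : VanishesToOrder ε n Y) (v : P) :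
    VanishesToOrder ε n (dirDeriv (0, v) Y) := by
  induction n generalizing Y with
  | zero => exact AnalyticOnNhd.dirDeriv h _
  | succ n ih =>
    refine ⟨h.1.dirDeriv _, fun q => ?_, (ih h.2.2).congr hε fun z hz =>
      dirDeriv_comm (h.1 z hz) _ _⟩
    have hd : HasFDerivAt Y (fderiv ℝ Y (0, q)) (0, q) :=
      (h.1 (0, q) (by simpa [slab] using hε)).differentiableAt.hasFDerivAt
    have h1 : HasFDerivAt (fun q => Y (0, q))
        ((fderiv ℝ Y (0, q)).comp (ContinuousLinearMap.inr ℝ ℝ P)) q :=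
      hd.comp q (hasFDerivAt_prodMk_right 0 q)
    have h2 : (fun q => Y (0, q)) = fun _ => 0 := funext h.2.1
    rw [h2] at h1
    have h3 := congrArg (fun f => f v) (h1.unique (hasFDerivAt_const 0 q))
    simpa [dirDeriv] using h3

lemma iteratedDeriv_eq_zero (hε : 0 < ε) (h : VanishesToOrder ε n Y) (q : P) {k : ℕ} (hk : k < n) :
    iteratedDeriv k (fun t => Y (t, q)) 0 = 0 := by
  induction n generalizing Y k with
  | zero => omega
  | succ n ih =>
    rcases k with _ | k
    · simpa using h.2.1 q
    rw [iteratedDeriv_succ']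
    have he : deriv (fun t => Y (t, q)) =ᶠ[𝓝 0] fun t => dirDeriv (1, 0) Y (t, q) := by
      have : ∀ᶠ t : ℝ in 𝓝 0, |t| < ε := by
        have := Metric.ball_mem_nhds (0 : ℝ) hε
        filter_upwards [this] with t ht using by simpa using ht
      filter_upwards [this] with t ht
      have hd : HasFDerivAt Y (fderiv ℝ Y (t, q)) (t, q) :=
        (h.1 (t, q) ht).differentiableAt.hasFDerivAt
      have h1 : HasFDerivAt (fun t => Y (t, q))
          ((fderiv ℝ Y (t, q)).comp (ContinuousLinearMap.inl ℝ ℝ P)) t :=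
        hd.comp t (hasFDerivAt_prodMk_left t q)
      rw [h1.hasDerivAt.deriv]
      simp [dirDeriv]
    rw [he.iteratedDeriv_eq]
    exact ih h.2.2 (by omega)

/-- On each line q = const the function of t is analytic with infinite order of vanishing at 0,
hence zero on the whole interval by the identity theorem. -/
lemma eqOn_zero (hε : 0 < ε) (h : ∀ n, VanishesToOrder ε n Y) {z : ℝ × P} (hz : z ∈ slab P ε) :
    Y z = 0 := by
  obtain ⟨t, q⟩ := z
  have ha : AnalyticOnNhd ℝ (fun t => Y (t, q)) (Metric.ball 0 ε) := by
    intro s hs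
    refine ((h 0).analyticOnNhd (s, q) (by simpa [slab] using hs)).comp_of_eq ?_ rfl
    exact analyticAt_id.prod analyticAt_const
  have h0 := ha 0 (by simpa using hε)
  have htop : analyticOrderAt (fun t => Y (t, q)) 0 = ⊤ := by
    refine ENat.eq_top_iff_forall_ge.2 fun n => ?_
    rw [natCast_le_analyticOrderAt_iff_iteratedDeriv_eq_zero h0]
    exact fun i hi => (h n).iteratedDeriv_eq_zero hε q hi
  rw [analyticOrderAt_eq_top] at htop
  exact ha.eqOn_zero_of_preconnected_of_eventuallyEq_zero (convex_ball 0 ε).isPreconnected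
    (by simpa using hε) htop (by simpa [slab] using hz)

end VanishesToOrder

/-- Uniqueness for analytic solutions of linear evolution equations. -/
theorem eqOn_zero_of_evolution {ι : Type*} {ε : ℝ} (hε : 0 < ε) {Z : ι → ℝ × P → ℝ}
    (ha : ∀ i, AnalyticOnNhd ℝ (Z i) (slab P ε)) (h0 : ∀ i q, Z i (0, q) = 0)
    (hs : ∀ n, (∀ j, VanishesToOrder ε n (Z j)) →
      ∀ i, VanishesToOrder ε n (dirDeriv (1, 0) (Z i))) (i : ι) {z : ℝ × P} (hz : z ∈ slab P ε) :
    Z i z = 0 := by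
  -- Bootstrap: if all Z vanish to order n, the equation makes ∂_t Z vanish to order n, and with
  -- zero initial values Z vanishes to order n + 1.
  have : ∀ n i, VanishesToOrder ε n (Z i) := by
    intro n
    induction n with
    | zero => exact ha
    | succ n ih => exact fun i => ⟨ha i, h0 i, hs n ih i⟩
  exact VanishesToOrder.eqOn_zero hε (fun n => this n i) hz

end Uniqueness

end

noncomputable section

/-! ### The symmetry flow in components -/

/-- `∂/∂t` on space-time. -/
abbrev dT : (ℝ × Plane → ℝ) → ℝ × Plane → ℝ := dirDeriv (1, 0)

/-- `∂/∂x` on space-time. -/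
abbrev dX : (ℝ × Plane → ℝ) → ℝ × Plane → ℝ := dirDeriv (0, Pi.single 0 1)

/-- `∂/∂y` on space-time. -/
abbrev dY : (ℝ × Plane → ℝ) → ℝ × Plane → ℝ := dirDeriv (0, Pi.single 1 1)

/-- Analytic solutions of the evolution system, in components. -/
structure EvolutionSolution (ε : ℝ) (L u f g : ℝ × Plane → ℝ) : Prop where
  anL : AnalyticOnNhd ℝ L (slab Plane ε)
  anu : AnalyticOnNhd ℝ u (slab Plane ε)
  anf : AnalyticOnNhd ℝ f (slab Plane ε)
  ang : AnalyticOnNhd ℝ g (slab Plane ε)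
  dTL : ∀ z ∈ slab Plane ε, dT L z = g z * dX L z + L z * dX g z + f z * dY L z + L z * dY f z
  dTu : ∀ z ∈ slab Plane ε, dT u z = -2 * (g z * dX L z) + g z * dX u z - 2 * (L z * dX g z) +
    2 * (f z * dY L z) + f z * dY u z + 2 * (L z * dY f z)
  dTf : ∀ z ∈ slab Plane ε, dT f z = 2 * dY u z
  dTg : ∀ z ∈ slab Plane ε, dT g z = -2 * dX u z

/-- The difference of two solutions satisfies a linear homogeneous system with analytic
coefficients, because a ∂b - a' ∂c = (a - a') ∂b + a' ∂(b - c). Then `eqOn_zero_of_evolution`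
applies. -/
theorem EvolutionSolution.unique {ε : ℝ} (hε : 0 < ε) {L u f g L' u' f' g' : ℝ × Plane → ℝ}
    (h : EvolutionSolution ε L u f g) (h' : EvolutionSolution ε L' u' f' g')
    (hL : ∀ q, L (0, q) = L' (0, q)) (hu : ∀ q, u (0, q) = u' (0, q))
    (hf : ∀ q, f (0, q) = f' (0, q)) (hg : ∀ q, g (0, q) = g' (0, q)) :
    ∀ z ∈ slab Plane ε, L z = L' z ∧ u z = u' z ∧ f z = f' z ∧ g z = g' z := by
  intro z hz
  have key := fun i => eqOn_zero_of_evolution (ι := Fin 4) hε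
    (Z := ![fun z => L z - L' z, fun z => u z - u' z, fun z => f z - f' z, fun z => g z - g' z])
    (by
      intro i
      fin_cases i
      · exact h.anL.sub h'.anL
      · exact h.anu.sub h'.anu
      · exact h.anf.sub h'.anf
      · exact h.ang.sub h'.ang)
    (by
      intro i q
      fin_cases i <;> simp [hL, hu, hf, hg])
    (by
      intro n hV i
      have vL : VanishesToOrder ε n (fun z => L z - L' z) := hV 0
      have vu : VanishesToOrder ε n (fun z => u z - u' z) := hV 1
      have vf : VanishesToOrder ε n (fun z => f z - f' z) := hV 2
      have vg : VanishesToOrder ε n (fun z => g z - g' z) := hV 3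
      have du := fun v => (vu.dirDeriv_space hε v)
      have A : ∀ {a b : ℝ × Plane → ℝ}, AnalyticOnNhd ℝ a (slab Plane ε) →
          AnalyticOnNhd ℝ b (slab Plane ε) → ∀ v, ∀ z ∈ slab Plane ε,
          dirDeriv v (fun z => a z - b z) z = dirDeriv v a z - dirDeriv v b z :=
        fun ha hb v z hz => dirDeriv_sub (ha z hz).differentiableAt (hb z hz).differentiableAt
      have c2 : ∀ c : ℝ, AnalyticOnNhd ℝ (fun _ : ℝ × Plane => c) (slab Plane ε) :=
        fun c => analyticOnNhd_const
      have X : ∀ {a b c : ℝ × Plane → ℝ} {a' : ℝ × Plane → ℝ} (v : Plane),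
          AnalyticOnNhd ℝ b (slab Plane ε) → AnalyticOnNhd ℝ a' (slab Plane ε) →
          VanishesToOrder ε n (fun z => a z - a' z) → VanishesToOrder ε n (fun z => b z - c z) →
          AnalyticOnNhd ℝ c (slab Plane ε) →
          VanishesToOrder ε n (fun z => a z * dirDeriv (0, v) b z - a' z * dirDeriv (0, v) c z) := by
        intro a b c a' v hb ha' h1 h2 hc
        refine ((h1.mul hε (hb.dirDeriv (0, v))).add hε
          ((h2.dirDeriv_space hε v).mul hε ha')).congr hε fun z hz => ?_
        simp only [A hb hc _ z hz]
        ring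
      have gL := X (Pi.single 0 1) h.anL h'.ang vg vL h'.anL
      have Lg := X (Pi.single 0 1) h.ang h'.anL vL vg h'.ang
      have fL := X (Pi.single 1 1) h.anL h'.anf vf vL h'.anL
      have Lf := X (Pi.single 1 1) h.anf h'.anL vL vf h'.anf
      have gu := X (Pi.single 0 1) h.anu h'.ang vg vu h'.anu
      have fu := X (Pi.single 1 1) h.anu h'.anf vf vu h'.anu
      fin_cases i
      · refine (((gL.add hε Lg).add hε fL).add hε Lf).congr
          (Y' := dT fun z => L z - L' z) hε fun z hz => ?_
        simp only [A h.anL h'.anL _ z hz]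
        linear_combination - h.dTL z hz + h'.dTL z hz
      · refine ((((((gL.mul hε (c2 (-2))).add hε (Lg.mul hε (c2 (-2)))).add hε
          (fL.mul hε (c2 2))).add hε (Lf.mul hε (c2 2))).add hε gu).add hε fu).congr
          (Y' := dT fun z => u z - u' z) hε fun z hz => ?_
        simp only [A h.anu h'.anu _ z hz]
        linear_combination - h.dTu z hz + h'.dTu z hz
      · refine ((du (Pi.single 1 1)).mul hε (c2 2)).congr
          (Y' := dT fun z => f z - f' z) hε fun z hz => ?_
        simp only [A h.anu h'.anu _ z hz, A h.anf h'.anf _ z hz]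
        linear_combination - h.dTf z hz + h'.dTf z hz
      · refine ((du (Pi.single 0 1)).mul hε (c2 (-2))).congr
          (Y' := dT fun z => g z - g' z) hε fun z hz => ?_
        simp only [A h.anu h'.anu _ z hz, A h.ang h'.ang _ z hz]
        linear_combination - h.dTg z hz + h'.dTg z hz)
    i hz
  have k0 := key 0
  have k1 := key 1
  have k2 := key 2
  have k3 := key 3
  simp only [Matrix.cons_val] at k0 k1 k2 k3
  exact ⟨sub_eq_zero.1 k0, sub_eq_zero.1 k1, sub_eq_zero.1 k2, sub_eq_zero.1 k3⟩

/-! ### Propagation of the quasi-linear system along the evolution. -/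

section Residuals

variable (L u f g : ℝ × Plane → ℝ)

/-- Left-hand side of the first equation of the quasi-linear system. -/
def res1 (z : ℝ × Plane) : ℝ := dX f z + dY g z

/-- Left-hand side of the second equation of the quasi-linear system. -/
def res2 (z : ℝ × Plane) : ℝ := f z * dX L z + L z * dX f z - g z * dY L z - L z * dY g z

/-- Left-hand side of the third equation of the quasi-linear system. -/
def res3 (z : ℝ × Plane) : ℝ := 2 * dX L z + dX u z - 1 / 2 * (g z * (dY f z - dX g z))

/-- Left-hand side of the fourth equation of the quasi-linear system. -/
def res4 (z : ℝ × Plane) : ℝ := 2 * dY L z - dY u z + 1 / 2 * (f z * (dY f z - dX g z))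

end Residuals

@[fun_prop]
lemma AnalyticAt.dirDeriv {V : Type*} [NormedAddCommGroup V] [NormedSpace ℝ V] {Y : V → ℝ} {z : V}
    (h : AnalyticAt ℝ Y z) (v : V) : AnalyticAt ℝ (dirDeriv v Y) z :=
  ((ContinuousLinearMap.apply ℝ ℝ v).analyticAt _).comp h.fderiv

namespace EvolutionSolution

variable {ε : ℝ} {L u f g : ℝ × Plane → ℝ} {z : ℝ × Plane}

lemma analyticOnNhd_residuals (h : EvolutionSolution ε L u f g) :
    AnalyticOnNhd ℝ (res1 f g) (slab Plane ε) ∧ AnalyticOnNhd ℝ (res2 L f g) (slab Plane ε) ∧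
    AnalyticOnNhd ℝ (res3 L u f g) (slab Plane ε) ∧
    AnalyticOnNhd ℝ (res4 L u f g) (slab Plane ε) := by
  unfold res1 res2 res3 res4
  refine ⟨fun z hz => ?_, fun z hz => ?_, fun z hz => ?_, fun z hz => ?_⟩ <;>
  · have hL := h.anL z hz
    have hu := h.anu z hz
    have hf := h.anf z hz
    have hg := h.ang z hz
    fun_prop

/-- The time derivatives of the residuals are linear in the residuals and their derivatives. -/
lemma dT_residuals (h : EvolutionSolution ε L u f g) (hz : z ∈ slab Plane ε) :
    dT (res1 f g) z = 0 ∧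
    dT (res2 L f g) z = (dX g z + dY f z) * res2 L f g z + f z * dY (res2 L f g) z +
      g z * dX (res2 L f g) z + 2 * dY L z * res3 L u f g z + 2 * L z * dY (res3 L u f g) z -
      2 * dX L z * res4 L u f g z - 2 * L z * dX (res4 L u f g) z +
      L z * f z * dY (res1 f g) z - L z * g z * dX (res1 f g) z +
      (f z * dY L z - L z * dX g z + L z * dY f z - g z * dX L z) * res1 f g z ∧
    dT (res3 L u f g) z = (2 * dY L z + dY u z) * res1 f g z + 2 * L z * dY (res1 f g) z +
      2 * dY (res2 L f g) z + dY f z * res3 L u f g z + f z * dY (res3 L u f g) z +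
      dY g z * res4 L u f g z + g z * dY (res4 L u f g) z ∧
    dT (res4 L u f g) z = (2 * dX L z - dX u z) * res1 f g z + 2 * L z * dX (res1 f g) z -
      2 * dX (res2 L f g) z + dX f z * res3 L u f g z + f z * dX (res3 L u f g) z +
      dX g z * res4 L u f g z + g z * dX (res4 L u f g) z := by
  have hL := h.anL z hz
  have hu := h.anu z hz
  have hf := h.anf z hz
  have hg := h.ang z hz
  have ho := isOpen_slab (P := Plane) ε
  -- Mixed time-space derivatives are eliminated by commuting them and differentiating the evolution
  -- equations in space. What remains is an identity between polynomials in space derivatives of L,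
  -- u, f, g.
  have tL := fun v : Plane => (dirDeriv_comm hL (1, 0) (0, v)).trans
    (dirDeriv_congr ho h.dTL (0, v) hz)
  have tu := fun v : Plane => (dirDeriv_comm hu (1, 0) (0, v)).trans
    (dirDeriv_congr ho h.dTu (0, v) hz)
  have tf := fun v : Plane => (dirDeriv_comm hf (1, 0) (0, v)).trans
    (dirDeriv_congr ho h.dTf (0, v) hz)
  have tg := fun v : Plane => (dirDeriv_comm hg (1, 0) (0, v)).trans
    (dirDeriv_congr ho h.dTg (0, v) hz)
  have cL : dY (dX L) z = dX (dY L) z := dirDeriv_comm hL _ _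
  have cu : dY (dX u) z = dX (dY u) z := dirDeriv_comm hu _ _
  have cf : dY (dX f) z = dX (dY f) z := dirDeriv_comm hf _ _
  have cg : dY (dX g) z = dX (dY g) z := dirDeriv_comm hg _ _
  have eL := h.dTL z hz
  have ef := h.dTf z hz
  have eg := h.dTg z hz
  have tLx := tL (Pi.single 0 1)
  have tLy := tL (Pi.single 1 1)
  have tux := tu (Pi.single 0 1)
  have tuy := tu (Pi.single 1 1)
  have tfx := tf (Pi.single 0 1)
  have tfy := tf (Pi.single 1 1)
  have tgx := tg (Pi.single 0 1)
  have tgy := tg (Pi.single 1 1)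
  unfold res1 res2 res3 res4
  simp only [dT, dX, dY] at *
  simp (disch := exact AnalyticAt.differentiableAt (by fun_prop)) only
    [dirDeriv_add, dirDeriv_sub, dirDeriv_mul, dirDeriv_const] at *
  refine ⟨?_, ?_, ?_, ?_⟩
  · rw [tfx, tgy, cu]; ring
  · rw [tfx, tgy, tLx, tLy, eL, ef, eg]
    simp only [cL, cu, cf, cg]
    ring
  · rw [tLx, tux, tfy, tgx, eg]
    simp only [cL, cu, cf, cg]
    ring
  · rw [tLy, tuy, tfy, tgx, ef]
    simp only [cL, cu, cg]
    ring

/-- By `dT_residuals` the four residuals obey a closed linear homogeneous evolution system. This is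
where (E), being a symmetry of (S), preserves solutions of (S). -/
theorem residuals_eq_zero (h : EvolutionSolution ε L u f g) (hε : 0 < ε)
    (h1 : ∀ q, res1 f g (0, q) = 0) (h2 : ∀ q, res2 L f g (0, q) = 0)
    (h3 : ∀ q, res3 L u f g (0, q) = 0) (h4 : ∀ q, res4 L u f g (0, q) = 0)
    (hz : z ∈ slab Plane ε) :
    res1 f g z = 0 ∧ res2 L f g z = 0 ∧ res3 L u f g z = 0 ∧ res4 L u f g z = 0 := by
  obtain ⟨a1, a2, a3, a4⟩ := h.analyticOnNhd_residuals
  have key := fun i => eqOn_zero_of_evolution (ι := Fin 4) hε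
    (Z := ![res1 f g, res2 L f g, res3 L u f g, res4 L u f g])
    (by intro i; fin_cases i <;> assumption)
    (by intro i; fin_cases i <;> assumption)
    (by
      intro n hV i
      have v1 : VanishesToOrder ε n (res1 f g) := hV 0
      have v2 : VanishesToOrder ε n (res2 L f g) := hV 1
      have v3 : VanishesToOrder ε n (res3 L u f g) := hV 2
      have v4 : VanishesToOrder ε n (res4 L u f g) := hV 3
      have d1 := fun v => (v1.dirDeriv_space hε v)
      have d2 := fun v => (v2.dirDeriv_space hε v)
      have d3 := fun v => (v3.dirDeriv_space hε v)
      have d4 := fun v => (v4.dirDeriv_space hε v)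
      have hL := h.anL
      have hu := h.anu
      have hf := h.anf
      have hg := h.ang
      have M : ∀ {a b : ℝ × Plane → ℝ}, (∀ z ∈ slab Plane ε, AnalyticAt ℝ a z) →
          VanishesToOrder ε n b → VanishesToOrder ε n (fun z => a z * b z) :=
        fun ha hb => hb.mul hε ha
      have T : ∀ z ∈ slab Plane ε, _ := fun z hz => h.dT_residuals hz
      fin_cases i
      · have hzero : VanishesToOrder ε n (fun z => (fun _ => (0 : ℝ)) z * res1 f g z) :=
          M (fun z hz => by fun_prop) v1
        refine hzero.congr hε (Y' := dT (res1 f g)) fun z hz => ?_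
        simp [(T z hz).1]
      · refine (((((((((M (a := fun z => dX g z + dY f z) ?_ v2).add hε
          (M (a := f) ?_ (d2 (Pi.single 1 1)))).add hε
          (M (a := g) ?_ (d2 (Pi.single 0 1)))).add hε
          (M (a := fun z => 2 * dY L z) ?_ v3)).add hε
          (M (a := fun z => 2 * L z) ?_ (d3 (Pi.single 1 1)))).add hε
          (M (a := fun z => -2 * dX L z) ?_ v4)).add hε
          (M (a := fun z => -2 * L z) ?_ (d4 (Pi.single 0 1)))).add hε
          ((M (a := fun z => L z * f z) ?_ (d1 (Pi.single 1 1))).add hε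
          (M (a := fun z => -(L z * g z)) ?_ (d1 (Pi.single 0 1))))).add hε
          (M (a := fun z => f z * dY L z - L z * dX g z + L z * dY f z - g z * dX L z) ?_ v1)).congr
          (Y' := dT (res2 L f g)) hε fun z hz => ?_
        on_goal 11 => rw [(T z hz).2.1]; ring
        all_goals
          intro z hz
          have := hL z hz; have := hu z hz; have := hf z hz; have := hg z hz
          fun_prop
      · refine (((((((M (a := fun z => 2 * dY L z + dY u z) ?_ v1).add hε
          (M (a := fun z => 2 * L z) ?_ (d1 (Pi.single 1 1)))).add hε
          (M (a := fun _ => 2) ?_ (d2 (Pi.single 1 1)))).add hε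
          (M (a := dY f) ?_ v3)).add hε
          (M (a := f) ?_ (d3 (Pi.single 1 1)))).add hε
          (M (a := dY g) ?_ v4)).add hε
          (M (a := g) ?_ (d4 (Pi.single 1 1)))).congr
          (Y' := dT (res3 L u f g)) hε fun z hz => ?_
        on_goal 8 => rw [(T z hz).2.2.1]
        all_goals
          intro z hz
          have := hL z hz; have := hu z hz; have := hf z hz; have := hg z hz
          fun_prop
      · refine (((((((M (a := fun z => 2 * dX L z - dX u z) ?_ v1).add hε
          (M (a := fun z => 2 * L z) ?_ (d1 (Pi.single 0 1)))).add hε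
          (M (a := fun _ => -2) ?_ (d2 (Pi.single 0 1)))).add hε
          (M (a := dX f) ?_ v3)).add hε
          (M (a := f) ?_ (d3 (Pi.single 0 1)))).add hε
          (M (a := dX g) ?_ v4)).add hε
          (M (a := g) ?_ (d4 (Pi.single 0 1)))).congr
          (Y' := dT (res4 L u f g)) hε fun z hz => ?_
        on_goal 8 => rw [(T z hz).2.2.2]; ring
        all_goals
          intro z hz
          have := hL z hz; have := hu z hz; have := hf z hz; have := hg z hz
          fun_prop)
    i hz
  have k0 := key 0
  have k1 := key 1
  have k2 := key 2
  have k3 := key 3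
  simp only [Matrix.cons_val] at k0 k1 k2 k3
  exact ⟨k0, k1, k2, k3⟩

end EvolutionSolution

end

noncomputable section

/-! ### Conformal diffeomorphisms of the plane -/

/-- An entire homeomorphism with non-zero derivative at the origin is affine. -/
theorem eq_affine_of_entire_homeomorph {F G : ℂ → ℂ} (hF : Differentiable ℂ F) (hG : Continuous G)
    (hGF : ∀ z, G (F z) = z) (h0 : deriv F 0 ≠ 0) (z : ℂ) : F z = F 0 + deriv F 0 * z := by
  have entire_dslope : ∀ f : ℂ → ℂ, Differentiable ℂ f → Differentiable ℂ (dslope f 0) := by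
    intro f hf
    rw [← differentiableOn_univ] at hf ⊢
    exact (Complex.differentiableOn_dslope Filter.univ_mem).2 hf
  have hslope : ∀ (f : ℂ → ℂ) (z : ℂ), z * dslope f 0 z = f z - f 0 := by
    intro f z
    have := sub_smul_dslope f 0 z
    simpa using this
  have hbdd : ∀ (f : ℂ → ℂ) (R : ℝ), Continuous f → ∃ C, 0 ≤ C ∧ ∀ z, ‖z‖ ≤ R → ‖f z‖ ≤ C := by
    intro f R hf
    obtain ⟨C, hC⟩ := (isCompact_closedBall (0 : ℂ) R).exists_bound_of_continuousOn hf.continuousOn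
    refine ⟨max C 0, le_max_right _ _, fun z hz => ?_⟩
    exact (hC z (by simpa using hz)).trans (le_max_left _ _)
  -- k is the entire function (F(z) - F(0))/z. It has no zeros: away from 0 since F is injective,
  -- and at 0 since F'(0) ≠ 0.
  set k := dslope F 0 with hk
  have hkd : Differentiable ℂ k := entire_dslope F hF
  have hk0 : ∀ z, k z ≠ 0 := by
    intro z hz
    rcases eq_or_ne z 0 with rfl | hne
    · rw [hk, dslope_same] at hz
      exact h0 hz
    · have h1 := hslope F z
      rw [← hk, hz, mul_zero] at h1
      have h2 : F z = F 0 := by linear_combination -h1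
      exact hne (by rw [← hGF z, h2, hGF])
  set g : ℂ → ℂ := fun z => (k z)⁻¹ with hg
  have hgd : Differentiable ℂ g := fun z => (hkd z).inv (hk0 z)
  -- F is proper: if F(z) is within 1 of F(0), then z = G(F(z)) lies in the bounded image of a
  -- closed ball under G.
  obtain ⟨R, hR0, hR⟩ : ∃ R, 0 ≤ R ∧ ∀ z, R < ‖z‖ → 1 ≤ ‖F z - F 0‖ := by
    obtain ⟨C, hC0, hC⟩ := hbdd G (‖F 0‖ + 1) hG
    refine ⟨C, hC0, fun z hz => ?_⟩
    by_contra! hlt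
    have h1 : ‖F z‖ ≤ ‖F 0‖ + 1 := by
      have := norm_add_le (F z - F 0) (F 0)
      rw [sub_add_cancel] at this
      linarith
    have h2 := hC _ h1
    rw [hGF] at h2
    linarith
  -- Outside the ball of radius R, 1/|k| = |z|/|F(z) - F(0)| ≤ |z|. The reciprocal therefore grows
  -- at most linearly.
  have hgrow : ∃ C, 0 ≤ C ∧ ∀ z, ‖g z‖ ≤ ‖z‖ + C := by
    obtain ⟨C, hC0, hC⟩ := hbdd g R hgd.continuous
    refine ⟨C, hC0, fun z => ?_⟩
    rcases le_or_gt ‖z‖ R with h | h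
    · linarith [hC z h, norm_nonneg z]
    · have h1 := hR z h
      have hz : z ≠ 0 := by
        rintro rfl
        simp at h
        linarith
      rw [← hslope F z, norm_mul] at h1
      have hkp : 0 < ‖k z‖ := norm_pos_iff.2 (hk0 z)
      have : ‖g z‖ ≤ ‖z‖ := by
        rw [hg]
        simp only [norm_inv]
        rwa [inv_le_iff_one_le_mul₀ hkp]
      linarith
  obtain ⟨C, hC0, hC⟩ := hgrow
  -- The divided difference of g is a bounded entire function, so Liouville's theorem makes g
  -- affine.
  have hconst : ∀ z, dslope g 0 z = dslope g 0 0 := by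
    intro z
    refine (entire_dslope g hgd).apply_eq_apply_of_bounded ?_ z 0
    obtain ⟨D, hD0, hD⟩ := hbdd _ 1 (entire_dslope g hgd).continuous
    refine Bornology.IsBounded.subset (Metric.isBounded_closedBall (x := 0)
      (r := max D (1 + C + ‖g 0‖))) ?_
    rintro _ ⟨w, rfl⟩
    rw [mem_closedBall_zero_iff]
    rcases le_or_gt ‖w‖ 1 with h | h
    · exact (hD w h).trans (le_max_left _ _)
    · refine le_trans ?_ (le_max_right _ _)
      have h1 : ‖w‖ * ‖dslope g 0 w‖ ≤ ‖w‖ + C + ‖g 0‖ := by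
        rw [← norm_mul, hslope g w]
        linarith [norm_sub_le (g w) (g 0), hC w]
      have h2 : ‖w‖ * ‖dslope g 0 w‖ ≤ ‖w‖ * (1 + C + ‖g 0‖) := by
        nlinarith [norm_nonneg (g 0)]
      exact le_of_mul_le_mul_left h2 (by linarith)
  set β := dslope g 0 0 with hβ
  have haff : ∀ z, g z = g 0 + z * β := by
    intro z
    have := hslope g z
    rw [hconst] at this
    linear_combination -this
  -- A non-constant affine function has a zero, while g is a reciprocal and has none. So g, and with
  -- it k, is constant.
  have hβ0 : β = 0 := by
    by_contra hne
    have h1 := haff (-(g 0) / β)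
    rw [div_mul_cancel₀ _ hne, add_neg_cancel] at h1
    exact inv_ne_zero (hk0 _) h1
  have h1 := haff z
  rw [hβ0, mul_zero, add_zero] at h1
  have h2 : k z = k 0 := inv_injective h1
  have h3 := hslope F z
  rw [← hk, h2, hk, dslope_same] at h3
  linear_combination -h3

lemma jac_mul_jac_symm (ψ : Plane ≃ Plane) (h : ContDiff ℝ ∞ ψ) (h' : ContDiff ℝ ∞ ψ.symm)
    (w : Plane) : jac ψ.symm (ψ w) * jac ψ w = 1 := by
  have e1 : HasFDerivAt ψ (fderiv ℝ ψ w) w := (h.differentiable (by simp) w).hasFDerivAt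
  have e2 : HasFDerivAt ψ.symm (fderiv ℝ ψ.symm (ψ w)) (ψ w) :=
    (h'.differentiable (by simp) _).hasFDerivAt
  have e3 := e2.comp w e1
  have e4 : (ψ.symm ∘ ψ) = id := by funext w; simp
  rw [e4] at e3
  have e5 := e3.unique (hasFDerivAt_id w)
  ext i j
  have e6 := congrFun (congrArg (fun f => f (Pi.single j 1)) e5) i
  simp only [ContinuousLinearMap.comp_apply, ContinuousLinearMap.id_apply] at e6
  have e7 : fderiv ℝ ψ w (Pi.single j 1) =
      ∑ l, (fderiv ℝ ψ w (Pi.single j 1)) l • (Pi.single l 1 : Plane) :=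
    pi_eq_sum_univ' _
  rw [e7, map_sum, Finset.sum_apply] at e6
  simp only [map_smul, Pi.smul_apply, smul_eq_mul] at e6
  rw [Matrix.mul_apply, Matrix.one_apply]
  simp only [jac, pd, Matrix.of_apply]
  rw [Pi.single_apply] at e6
  rw [← e6]
  exact Finset.sum_congr rfl fun l _ => mul_comm _ _

lemma continuous_jac_apply {ψ : Plane → Plane} (h : ContDiff ℝ ∞ ψ) (i j : Fin 2) :
    Continuous fun w => jac ψ w i j := by
  have : Continuous (fderiv ℝ ψ) := h.continuous_fderiv (by simp)
  simp only [jac, pd, Matrix.of_apply]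
  exact (continuous_apply i).comp (this.clm_apply continuous_const)

/-- The Jacobian of a diffeomorphism with conformal derivative is that of a holomorphic or of an
antiholomorphic map. -/
lemma exists_sign_cauchyRiemann (ψ : Plane ≃ Plane) (h : ContDiff ℝ ∞ ψ)
    (h' : ContDiff ℝ ∞ ψ.symm)
    (hc : ∀ w, ∃ s : ℝ, (jac ψ w)ᵀ * jac ψ w = s • (1 : Matrix (Fin 2) (Fin 2) ℝ)) :
    ∃ σ : ℝ, σ * σ = 1 ∧ ∀ w, jac ψ w 0 1 = -σ * jac ψ w 1 0 ∧ jac ψ w 1 1 = σ * jac ψ w 0 0 := by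
  have hdet : ∀ w, (jac ψ w).det ≠ 0 := by
    intro w h0
    have := congrArg Matrix.det (jac_mul_jac_symm ψ h h' w)
    rw [Matrix.det_mul, h0] at this
    simp at this
  have hcont : Continuous fun w => (jac ψ w).det := by
    simp only [Matrix.det_fin_two]
    exact ((continuous_jac_apply h 0 0).mul (continuous_jac_apply h 1 1)).sub
      ((continuous_jac_apply h 0 1).mul (continuous_jac_apply h 1 0))
  have key : ∀ w, ∀ σ : ℝ, σ * σ = 1 → 0 < σ * (jac ψ w).det →
      jac ψ w 0 1 = -σ * jac ψ w 1 0 ∧ jac ψ w 1 1 = σ * jac ψ w 0 0 := by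
    intro w σ hσ hpos
    obtain ⟨s, hs⟩ := hc w
    have h00 := congrFun (congrFun hs 0) 0
    have h01 := congrFun (congrFun hs 0) 1
    have h11 := congrFun (congrFun hs 1) 1
    simp only [Matrix.mul_apply, Matrix.transpose_apply, Fin.sum_univ_two, Matrix.smul_apply,
      Matrix.one_apply_eq, smul_eq_mul, mul_one] at h00 h01 h11
    rw [Matrix.one_apply_ne (by decide), mul_zero] at h01
    rw [Matrix.det_fin_two] at hpos
    generalize jac ψ w 0 0 = p at *
    generalize jac ψ w 0 1 = q at *
    generalize jac ψ w 1 0 = r at *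
    generalize jac ψ w 1 1 = v at *
    have h2 : (σ * (p * v - q * r)) ^ 2 = s ^ 2 := by
      have : (p * v - q * r) ^ 2 = s ^ 2 := by
        linear_combination (q * q + v * v) * h00 + s * h11 - (p * q + r * v) * h01
      rw [mul_pow, this, sq σ, hσ, one_mul]
    have hs0 : 0 ≤ s := by
      rw [← h00]; exact add_nonneg (mul_self_nonneg p) (mul_self_nonneg r)
    have h3 : σ * (p * v - q * r) = s := (sq_eq_sq₀ hpos.le hs0).1 h2
    -- For a conformal matrix with σ det = s, the failures of the Cauchy–Riemann equations have
    -- squares summing to 2s - 2σ det = 0.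
    have h4 : (v - σ * p) ^ 2 + (q + σ * r) ^ 2 = 0 := by
      linear_combination (p * p + r * r) * hσ + h00 + h11 - 2 * h3
    have h5 : v - σ * p = 0 := by nlinarith [sq_nonneg (v - σ * p), sq_nonneg (q + σ * r)]
    have h6 : q + σ * r = 0 := by nlinarith [sq_nonneg (v - σ * p), sq_nonneg (q + σ * r)]
    constructor <;> linarith
  -- The determinant is continuous and never zero on a connected plane, so a single sign σ serves
  -- everywhere.
  have hsign : (∀ w, 0 < (jac ψ w).det) ∨ ∀ w, (jac ψ w).det < 0 := by
    by_contra! hcon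
    obtain ⟨⟨w₁, h₁⟩, w₂, h₂⟩ := hcon
    obtain ⟨w, hw⟩ := mem_range_of_exists_le_of_exists_ge hcont ⟨w₁, h₁⟩ ⟨w₂, h₂⟩
    exact hdet w hw
  rcases hsign with hp | hn
  · exact ⟨1, by norm_num, fun w => key w 1 (by norm_num) (by simpa using hp w)⟩
  · exact ⟨-1, by norm_num, fun w => key w (-1) (by norm_num) (by simpa using hn w)⟩

/-- A conformal diffeomorphism of the plane is affine. -/
theorem exists_affine_of_conformal (ψ : Plane ≃ Plane) (h : ContDiff ℝ ∞ ψ)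
    (h' : ContDiff ℝ ∞ ψ.symm)
    (hc : ∀ w, ∃ s : ℝ, (jac ψ w)ᵀ * jac ψ w = s • (1 : Matrix (Fin 2) (Fin 2) ℝ)) :
    ∃ (σ a b : ℝ) (β : Plane), σ * σ = 1 ∧ a ^ 2 + b ^ 2 ≠ 0 ∧
      ∀ w : Plane, ψ w = β + w 0 • ![a, b] + w 1 • ![-σ * b, σ * a] := by
  obtain ⟨σ, hσ, hJ⟩ := exists_sign_cauchyRiemann ψ h h' hc
  -- The factor σ inserts a complex conjugation in the source when the orientation is reversed, so
  -- that F is holomorphic in both cases.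
  let ι : ℂ →L[ℝ] Plane := ContinuousLinearMap.pi ![Complex.reCLM, σ • Complex.imCLM]
  let κ : Plane →L[ℝ] ℂ := Complex.ofRealCLM.comp (ContinuousLinearMap.proj 0) +
    Complex.I • Complex.ofRealCLM.comp (ContinuousLinearMap.proj 1)
  have hι : ∀ z, ι z = ![z.re, σ * z.im] := by
    intro z; ext i; fin_cases i <;> simp [ι]
  have hκ : ∀ w, κ w = (w 0 : ℂ) + Complex.I * (w 1 : ℂ) := by
    intro w; simp [κ]
  set F : ℂ → ℂ := fun z => κ (ψ (ι z)) with hF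
  have hFd : ∀ z, HasFDerivAt F (κ.comp ((fderiv ℝ ψ (ι z)).comp ι)) z := by
    intro z
    exact κ.hasFDerivAt.comp z
      (((h.differentiable (by simp) (ι z)).hasFDerivAt).comp z ι.hasFDerivAt)
  have e1 : ι 1 = Pi.single 0 1 := by
    rw [hι]; ext i; fin_cases i <;> simp
  have eI : ι Complex.I = σ • Pi.single 1 1 := by
    rw [hι]; ext i; fin_cases i <;> simp
  have d1 : ∀ z, fderiv ℝ F z 1 = (jac ψ (ι z) 0 0 : ℂ) + Complex.I * (jac ψ (ι z) 1 0 : ℂ) := by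
    intro z
    rw [(hFd z).fderiv]
    simp only [ContinuousLinearMap.comp_apply, e1, hκ]
    rfl
  have dI : ∀ z, fderiv ℝ F z Complex.I =
      (σ : ℂ) * ((jac ψ (ι z) 0 1 : ℂ) + Complex.I * (jac ψ (ι z) 1 1 : ℂ)) := by
    intro z
    rw [(hFd z).fderiv]
    simp only [ContinuousLinearMap.comp_apply, eI, map_smul, hκ]
    simp only [jac, pd, Matrix.of_apply, Pi.smul_apply, smul_eq_mul, Complex.ofReal_mul]
    ring
  have hσC : (σ : ℂ) * σ = 1 := by exact_mod_cast hσ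
  have hFC : Differentiable ℂ F := by
    intro z
    rw [differentiableAt_complex_iff_differentiableAt_real]
    refine ⟨(hFd z).differentiableAt, ?_⟩
    rw [d1, dI, (hJ _).1, (hJ _).2]
    push_cast
    simp only [smul_eq_mul]
    linear_combination (-(jac ψ (ι z) 1 0 : ℂ) + Complex.I * (jac ψ (ι z) 0 0 : ℂ)) * hσC -
      (jac ψ (ι z) 1 0 : ℂ) * Complex.I_sq
  let G : ℂ → ℂ := fun z => ((ψ.symm ![z.re, z.im] 0 : ℝ) : ℂ) +
    Complex.I * ((σ * ψ.symm ![z.re, z.im] 1 : ℝ) : ℂ)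
  have hG : Continuous G := by
    have h1 : Continuous fun z : ℂ => ψ.symm ![z.re, z.im] := by
      refine h'.continuous.comp (continuous_pi fun i => ?_)
      fin_cases i
      · exact Complex.continuous_re
      · exact Complex.continuous_im
    have h2 := fun i => (continuous_apply (i : Fin 2)).comp h1
    exact (Complex.continuous_ofReal.comp (h2 0)).add (continuous_const.mul
      (Complex.continuous_ofReal.comp (continuous_const.mul (h2 1))))
  have hGF : ∀ z, G (F z) = z := by
    intro z
    have h1 : ![(F z).re, (F z).im] = ψ (ι z) := by
      ext i; fin_cases i <;> simp [hF, hκ]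
    simp only [G]
    rw [h1, Equiv.symm_apply_apply, hι]
    apply Complex.ext <;> simp
    rw [← mul_assoc, hσ, one_mul]
  have hderiv : deriv F 0 = fderiv ℝ F 0 1 := by
    rw [← fderiv_apply_one_eq_deriv, (hFC 0).fderiv_restrictScalars ℝ]
    rfl
  have h0 : deriv F 0 ≠ 0 := by
    rw [hderiv, d1]
    intro hz
    have hp := congrArg Complex.re hz
    have hr := congrArg Complex.im hz
    simp at hp hr
    have hd := congrArg Matrix.det (jac_mul_jac_symm ψ h h' (ι 0))
    rw [Matrix.det_mul, Matrix.det_fin_two (jac ψ (ι 0))] at hd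
    simp [hp, hr] at hd
  have haff := eq_affine_of_entire_homeomorph hFC hG hGF h0
  refine ⟨σ, (deriv F 0).re, (deriv F 0).im, ![(F 0).re, (F 0).im], hσ, ?_, fun w => ?_⟩
  · intro hz
    apply h0
    apply Complex.ext
    · simp; nlinarith [sq_nonneg (deriv F 0).re, sq_nonneg (deriv F 0).im]
    · simp; nlinarith [sq_nonneg (deriv F 0).re, sq_nonneg (deriv F 0).im]
  · have hz := haff ⟨w 0, σ * w 1⟩
    have hιw : ι ⟨w 0, σ * w 1⟩ = w := by
      rw [hι]; ext i; fin_cases i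
      · simp
      · simp [← mul_assoc, hσ]
    have hz' : κ (ψ w) = F 0 + deriv F 0 * ⟨w 0, σ * w 1⟩ := by
      rw [← hz, hF]
      simp only [hιw]
    rw [hκ] at hz'
    have hre := congrArg Complex.re hz'
    have him := congrArg Complex.im hz'
    simp at hre him
    ext i
    fin_cases i
    · simp; linarith
    · simp; linarith

end

noncomputable section

/-! ### Liouville metrics -/

section

variable {V : Type*} [NormedAddCommGroup V] [NormedSpace ℝ V]

lemma dirDeriv_add_left (v w : V) (Y : V → ℝ) (z : V) :
    dirDeriv (v + w) Y z = dirDeriv v Y z + dirDeriv w Y z := map_add _ _ _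

lemma dirDeriv_smul_left (c : ℝ) (v : V) (Y : V → ℝ) (z : V) :
    dirDeriv (c • v) Y z = c * dirDeriv v Y z := map_smul _ _ _

lemma hasDerivAt_line {Y : V → ℝ} {z v : V} {s : ℝ} (h : DifferentiableAt ℝ Y (z + s • v)) :
    HasDerivAt (fun s : ℝ => Y (z + s • v)) (dirDeriv v Y (z + s • v)) s := by
  have h1 : HasDerivAt (fun s : ℝ => z + s • v) v s := by
    simpa using ((hasDerivAt_id s).smul_const v).const_add z
  exact h.hasFDerivAt.comp_hasDerivAt s h1

/-- The mixed derivative of a sum of functions of one variable each vanishes. -/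
lemma dirDeriv_dirDeriv_eq_zero_of_separated {Y : V → ℝ} (hY : AnalyticOnNhd ℝ Y Set.univ)
    {z e₁ e₂ : V} {k₁ k₂ : ℝ → ℝ} (h : ∀ x y : ℝ, Y (z + x • e₁ + y • e₂) = k₁ x + k₂ y) :
    dirDeriv e₁ (dirDeriv e₂ Y) z = 0 := by
  have h1 : ∀ x : ℝ, dirDeriv e₂ Y (z + x • e₁) = dirDeriv e₂ Y z := by
    intro x
    have d1 := hasDerivAt_line (v := e₂) (s := 0) (z := z + x • e₁)
      (hY _ (Set.mem_univ _)).differentiableAt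
    have d0 := hasDerivAt_line (v := e₂) (s := 0) (z := z) (hY _ (Set.mem_univ _)).differentiableAt
    have e : (fun y : ℝ => Y (z + x • e₁ + y • e₂)) =
        fun y => Y (z + y • e₂) + (k₁ x - k₁ 0) := by
      funext y
      have h0 := h 0 y
      rw [zero_smul, add_zero] at h0
      rw [h x y, h0]
      ring
    rw [e] at d1
    have := d1.unique (d0.add_const (k₁ x - k₁ 0))
    simpa using this
  have d := hasDerivAt_line (v := e₁) (s := 0) (z := z)
    ((hY.dirDeriv e₂) _ (Set.mem_univ _)).differentiableAt
  have e : (fun x : ℝ => dirDeriv e₂ Y (z + x • e₁)) = fun _ => dirDeriv e₂ Y z := funext h1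
  rw [e] at d
  have := d.unique (hasDerivAt_const _ _)
  simpa using this

end

/-- In a Liouville metric the conformal factor satisfies a wave equation in rotated coordinates. -/
theorem IsLiouvilleMetric.exists_wave_equation {Λ : Plane → ℝ}
    (hΛ : AnalyticOnNhd ℝ Λ Set.univ) (hpos : ∀ q, 0 < Λ q)
    (h : IsLiouvilleMetric (conformalMetric Λ)) :
    ∃ a b : ℝ, a ^ 2 + b ^ 2 ≠ 0 ∧ ∀ q,
      a * b * (dirDeriv (Pi.single 1 1) (dirDeriv (Pi.single 1 1) Λ) q -
        dirDeriv (Pi.single 0 1) (dirDeriv (Pi.single 0 1) Λ) q) +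
      (a ^ 2 - b ^ 2) * dirDeriv (Pi.single 0 1) (dirDeriv (Pi.single 1 1) Λ) q = 0 := by
  obtain ⟨ψ, h₁, h₂, hs, hs', hm⟩ := h
  have hm' : ∀ w, Λ (ψ w) • ((jac ψ w)ᵀ * jac ψ w) =
      (h₁ (w 0) + h₂ (w 1)) • (1 : Matrix (Fin 2) (Fin 2) ℝ) := by
    intro w
    rw [← hm w, conformalMetric]
    simp
  obtain ⟨σ, a, b, β, hσ, hab, haff⟩ := exists_affine_of_conformal ψ hs hs' fun w => by
    refine ⟨(Λ (ψ w))⁻¹ * (h₁ (w 0) + h₂ (w 1)), ?_⟩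
    rw [mul_smul, ← hm' w, smul_smul, inv_mul_cancel₀ (hpos _).ne', one_smul]
  refine ⟨a, b, hab, fun q => ?_⟩
  have hψd : ∀ w, fderiv ℝ ψ w (Pi.single 0 1) = ![a, b] := by
    intro w
    let T : Plane →L[ℝ] Plane := (ContinuousLinearMap.proj 0 : Plane →L[ℝ] ℝ).smulRight ![a, b] +
      (ContinuousLinearMap.proj 1 : Plane →L[ℝ] ℝ).smulRight ![-σ * b, σ * a]
    have hT : ⇑ψ = fun w => β + T w := by
      funext w
      rw [haff w, add_assoc]
      rfl
    rw [hT, fderiv_const_add, T.fderiv]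
    simp [T]
  set w₀ := ψ.symm q with hw₀
  have hq : ψ w₀ = q := by simp [hw₀]
  -- An affine conformal map has the constant conformal factor a² + b². Hence Λ itself, and not just
  -- its pullback multiplied by a Jacobian, is a sum along two orthogonal directions.
  have hsep : ∀ x y : ℝ, Λ (q + x • ![a, b] + y • ![-σ * b, σ * a]) =
      (a ^ 2 + b ^ 2)⁻¹ * h₁ (w₀ 0 + x) + (a ^ 2 + b ^ 2)⁻¹ * h₂ (w₀ 1 + y) := by
    intro x y
    have e1 : q + x • ![a, b] + y • ![-σ * b, σ * a] = ψ ![w₀ 0 + x, w₀ 1 + y] := by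
      rw [← hq, haff w₀, haff]
      simp only [Matrix.cons_val_zero, Matrix.cons_val_one, add_smul]
      abel
    have e2 := congrFun (congrFun (hm' ![w₀ 0 + x, w₀ 1 + y]) 0) 0
    rw [e1]
    simp only [Matrix.smul_apply, Matrix.mul_apply, Matrix.transpose_apply, Fin.sum_univ_two,
      Matrix.one_apply_eq, smul_eq_mul, Matrix.cons_val_zero, Matrix.cons_val_one, mul_one] at e2
    simp only [jac, pd, Matrix.of_apply, hψd, Matrix.cons_val_zero, Matrix.cons_val_one] at e2
    field_simp
    linear_combination e2
  have hz := dirDeriv_dirDeriv_eq_zero_of_separated hΛ hsep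
  have v1 : (![a, b] : Plane) = a • Pi.single 0 1 + b • Pi.single 1 1 := by
    ext i; fin_cases i <;> simp
  have v2 : (![-σ * b, σ * a] : Plane) = (-σ * b) • Pi.single 0 1 + (σ * a) • Pi.single 1 1 := by
    ext i; fin_cases i <;> simp
  have hΛ1 := hΛ.dirDeriv (Pi.single 0 1)
  have hΛ2 := hΛ.dirDeriv (Pi.single 1 1)
  have e3 : dirDeriv ![-σ * b, σ * a] Λ = fun z =>
      (-σ * b) * dirDeriv (Pi.single 0 1) Λ z + (σ * a) * dirDeriv (Pi.single 1 1) Λ z := by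
    funext z
    rw [v2, dirDeriv_add_left, dirDeriv_smul_left, dirDeriv_smul_left]
  have e4 : ∀ v, dirDeriv v (dirDeriv ![-σ * b, σ * a] Λ) q =
      (-σ * b) * dirDeriv v (dirDeriv (Pi.single 0 1) Λ) q +
        (σ * a) * dirDeriv v (dirDeriv (Pi.single 1 1) Λ) q := by
    intro v
    have k1 := (hΛ1 q (Set.mem_univ _)).differentiableAt
    have k2 := (hΛ2 q (Set.mem_univ _)).differentiableAt
    rw [e3, dirDeriv_add (k1.const_mul _) (k2.const_mul _), dirDeriv_const_mul _ k1,
      dirDeriv_const_mul _ k2]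
  rw [v1, dirDeriv_add_left, dirDeriv_smul_left, dirDeriv_smul_left, e4, e4,
    dirDeriv_comm (hΛ q (Set.mem_univ _)) (Pi.single 1 1) (Pi.single 0 1)] at hz
  linear_combination σ * hz + (-(a * b * (dirDeriv (Pi.single 1 1) (dirDeriv (Pi.single 1 1) Λ) q -
        dirDeriv (Pi.single 0 1) (dirDeriv (Pi.single 0 1) Λ) q) +
      (a ^ 2 - b ^ 2) * dirDeriv (Pi.single 0 1) (dirDeriv (Pi.single 1 1) Λ) q)) * hσ

/-- If a Liouville metric is periodic, then either its coordinate lines are parallel to the axes or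
`Λ_xx` has zeros on all lines `x = const`. -/
theorem IsLiouvilleMetric.mixed_eq_zero_or {Λ : Plane → ℝ}
    (hΛ : AnalyticOnNhd ℝ Λ Set.univ) (hpos : ∀ q, 0 < Λ q)
    (hper : ∀ q, Λ (q + Pi.single 1 1) = Λ q)
    (h : IsLiouvilleMetric (conformalMetric Λ)) :
    (∀ q, dirDeriv (Pi.single 0 1) (dirDeriv (Pi.single 1 1) Λ) q = 0) ∨
    ∀ q : Plane, ∃ y : ℝ,
      dirDeriv (Pi.single 0 1) (dirDeriv (Pi.single 0 1) Λ) (q + y • Pi.single 1 1) = 0 := by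
  obtain ⟨a, b, hab, hw⟩ := h.exists_wave_equation hΛ hpos
  rcases eq_or_ne (a * b) 0 with h0 | h0
  · left
    intro q
    have h1 := hw q
    rw [h0, zero_mul, zero_add] at h1
    refine (mul_eq_zero.1 h1).resolve_left fun h2 => hab ?_
    have : (a ^ 2 + b ^ 2) ^ 2 = 0 := by
      linear_combination (a ^ 2 - b ^ 2) * h2 + 4 * a * b * h0
    exact pow_eq_zero_iff (two_ne_zero) |>.1 this
  · right
    intro q
    set c := (a ^ 2 - b ^ 2) / (a * b) with hc
    have hΛ1 := hΛ.dirDeriv (Pi.single 0 1)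
    have hΛ2 := hΛ.dirDeriv (Pi.single 1 1)
    have hperD : ∀ v q, dirDeriv v Λ (q + Pi.single 1 1) = dirDeriv v Λ q := by
      intro v q
      rw [dirDeriv, dirDeriv, ← fderiv_comp_add_right]
      congr 2
      funext q
      exact hper q
    -- Divided by ab, the wave equation reads Λ_xx = ∂_y (Λ_y + c Λ_x). The function in brackets is
    -- periodic in y, so Rolle's theorem gives a zero of Λ_xx on each line x = const.
    have hd : ∀ y : ℝ, HasDerivAt (fun y : ℝ => dirDeriv (Pi.single 1 1) Λ (q + y • Pi.single 1 1) +
        c * dirDeriv (Pi.single 0 1) Λ (q + y • Pi.single 1 1))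
        (dirDeriv (Pi.single 1 1) (dirDeriv (Pi.single 1 1) Λ) (q + y • Pi.single 1 1) +
          c * dirDeriv (Pi.single 1 1) (dirDeriv (Pi.single 0 1) Λ) (q + y • Pi.single 1 1)) y :=
      fun y => (hasDerivAt_line (hΛ2 _ (Set.mem_univ _)).differentiableAt).add
        ((hasDerivAt_line (hΛ1 _ (Set.mem_univ _)).differentiableAt).const_mul c)
    obtain ⟨y, _, hy⟩ := exists_hasDerivAt_eq_zero (a := (0 : ℝ)) (b := 1) zero_lt_one
      (fun y _ => (hd y).continuousAt.continuousWithinAt) (by simp [hperD]) (fun y _ => hd y)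
    refine ⟨y, ?_⟩
    have h1 := hw (q + y • Pi.single 1 1)
    rw [dirDeriv_comm (hΛ _ (Set.mem_univ _)) (Pi.single 1 1) (Pi.single 0 1)] at hy
    have h2 : a * b * c = a ^ 2 - b ^ 2 := by rw [hc]; exact mul_div_cancel₀ _ h0
    have h3 : a * b * dirDeriv (Pi.single 0 1) (dirDeriv (Pi.single 0 1) Λ)
        (q + y • Pi.single 1 1) = 0 := by
      linear_combination (a * b) * hy - h1 -
        dirDeriv (Pi.single 0 1) (dirDeriv (Pi.single 1 1) Λ) (q + y • Pi.single 1 1) * h2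
    exact (mul_eq_zero.1 h3).resolve_left h0

end

noncomputable section

/-! ### The quasi-linear system and quadratic integrals -/

lemma pd_apply {n m : ℕ} {U : (Fin n → ℝ) → Fin m → ℝ} {q : Fin n → ℝ}
    (hU : DifferentiableAt ℝ U q) (i : Fin n) (j : Fin m) :
    pd i (fun q => U q j) q = pd i U q j := by
  rw [pd, pd, (hasFDerivAt_pi'.1 hU.hasFDerivAt j).fderiv]
  rfl

lemma magSystem_eq_zero_iff {U : Plane → State} {q : Plane} (hU : DifferentiableAt ℝ U q) :
    magA (U q) *ᵥ pd 0 U q + magB (U q) *ᵥ pd 1 U q = 0 ↔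
      pd 0 (fun q => U q 2) q + pd 1 (fun q => U q 3) q = 0 ∧
      U q 2 * pd 0 (fun q => U q 0) q + U q 0 * pd 0 (fun q => U q 2) q -
        U q 3 * pd 1 (fun q => U q 0) q - U q 0 * pd 1 (fun q => U q 3) q = 0 ∧
      2 * pd 0 (fun q => U q 0) q + pd 0 (fun q => U q 1) q -
        1 / 2 * (U q 3 * (pd 1 (fun q => U q 2) q - pd 0 (fun q => U q 3) q)) = 0 ∧
      2 * pd 1 (fun q => U q 0) q - pd 1 (fun q => U q 1) q +
        1 / 2 * (U q 2 * (pd 1 (fun q => U q 2) q - pd 0 (fun q => U q 3) q)) = 0 := by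
  simp only [pd_apply hU, funext_iff, Fin.forall_fin_succ, Pi.add_apply, Pi.zero_apply, magA, magB]
  simp only [Matrix.mulVec, dotProduct, Fin.sum_univ_four, Matrix.of_apply, Matrix.cons_val]
  simp only [Fin.isValue, Fin.succ_zero_eq_one, Matrix.cons_val, Fin.succ_one_eq_two,
    IsEmpty.forall_iff, and_true]
  refine and_congr ?_ (and_congr ?_ (and_congr ?_ ?_)) <;> apply Eq.congr_left <;> simp <;> ring

lemma hamiltonian_conformalMetric {L : Plane → ℝ} (z : Phase) (h : L z.1 ≠ 0) :
    hamiltonian (conformalMetric L) z = (z.2 0 ^ 2 + z.2 1 ^ 2) / (2 * L z.1) := by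
  have : (conformalMetric L z.1)⁻¹ = (L z.1)⁻¹ • (1 : Matrix (Fin 2) (Fin 2) ℝ) := by
    apply Matrix.inv_eq_right_inv
    rw [conformalMetric]
    simp [h]
  rw [hamiltonian, this, Matrix.smul_mulVec, Matrix.one_mulVec]
  simp only [dotProduct, Fin.sum_univ_two, Pi.smul_apply, smul_eq_mul]
  field_simp

lemma hasFDerivAt_hamiltonian {L : Plane → ℝ} (hL : Differentiable ℝ L) (hpos : ∀ q, 0 < L q)
    (z : Phase) :
    HasFDerivAt (hamiltonian (conformalMetric L))
      ((2 * L z.1)⁻¹ • ((2 * z.2 0) •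
          (ContinuousLinearMap.proj 0 : Plane →L[ℝ] ℝ).comp (ContinuousLinearMap.snd ℝ Plane Plane) +
        (2 * z.2 1) •
          (ContinuousLinearMap.proj 1 : Plane →L[ℝ] ℝ).comp (ContinuousLinearMap.snd ℝ Plane Plane)) +
        (-(z.2 0 ^ 2 + z.2 1 ^ 2) / (2 * L z.1 ^ 2)) •
          (fderiv ℝ L z.1).comp (ContinuousLinearMap.fst ℝ Plane Plane)) z := by
  have e : hamiltonian (conformalMetric L) =
      fun z : Phase => (z.2 0 ^ 2 + z.2 1 ^ 2) * (2 * L z.1)⁻¹ := by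
    funext z
    rw [hamiltonian_conformalMetric z (hpos _).ne', div_eq_mul_inv]
  have hp : ∀ i : Fin 2, HasFDerivAt (fun z : Phase => z.2 i)
      ((ContinuousLinearMap.proj i : Plane →L[ℝ] ℝ).comp (ContinuousLinearMap.snd ℝ Plane Plane)) z :=
    fun i => ((ContinuousLinearMap.proj i : Plane →L[ℝ] ℝ).comp
      (ContinuousLinearMap.snd ℝ Plane Plane)).hasFDerivAt
  have hq : HasFDerivAt (fun z : Phase => L z.1)
      ((fderiv ℝ L z.1).comp (ContinuousLinearMap.fst ℝ Plane Plane)) z :=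
    (hL z.1).hasFDerivAt.comp z hasFDerivAt_fst
  have h0 : 2 * L z.1 ≠ 0 := by have := hpos z.1; positivity
  have hinv := (hasDerivAt_inv h0).comp_hasFDerivAt z (hq.const_mul 2)
  have hne := (hpos z.1).ne'
  rw [e]
  refine ((((hp 0).pow 2).add ((hp 1).pow 2)).mul hinv).congr_fderiv ?_
  ext v <;> simp <;> field_simp <;> ring

lemma hasFDerivAt_magIntegral {U : Plane → State} (hU : Differentiable ℝ U) (z : Phase) :
    HasFDerivAt (magIntegral U)
      ((4 * z.2 0 + 2 * U z.1 2) •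
          (ContinuousLinearMap.proj 0 : Plane →L[ℝ] ℝ).comp (ContinuousLinearMap.snd ℝ Plane Plane) +
        (-4 * z.2 1 - 2 * U z.1 3) •
          (ContinuousLinearMap.proj 1 : Plane →L[ℝ] ℝ).comp (ContinuousLinearMap.snd ℝ Plane Plane) +
        ((2 * z.2 0) • fderiv ℝ (fun q => U q 2) z.1 - (2 * z.2 1) • fderiv ℝ (fun q => U q 3) z.1 +
          fderiv ℝ (fun q => U q 1) z.1).comp (ContinuousLinearMap.fst ℝ Plane Plane)) z := by
  have hp : ∀ i : Fin 2, HasFDerivAt (fun z : Phase => z.2 i)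
      ((ContinuousLinearMap.proj i : Plane →L[ℝ] ℝ).comp (ContinuousLinearMap.snd ℝ Plane Plane)) z :=
    fun i => ((ContinuousLinearMap.proj i : Plane →L[ℝ] ℝ).comp
      (ContinuousLinearMap.snd ℝ Plane Plane)).hasFDerivAt
  have hq : ∀ i : Fin 4, HasFDerivAt (fun z : Phase => U z.1 i)
      ((fderiv ℝ (fun q => U q i) z.1).comp (ContinuousLinearMap.fst ℝ Plane Plane)) z := fun i =>
    (differentiableAt_pi.1 (hU z.1) i).hasFDerivAt.comp z hasFDerivAt_fst
  have := ((((((hp 0).pow 2).sub ((hp 1).pow 2)).const_mul 2).add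
    (((hq 2).const_mul 2).mul (hp 0))).sub (((hq 3).const_mul 2).mul (hp 1))).add (hq 1)
  refine this.congr_fderiv ?_
  ext v <;>
  · simp
    ring

/-- The only cubic terms come from ∂H/∂x, which contains p₁² + p₂²; on the level this is Λ, so the
degree drops to two. The coefficients linear in p are the residuals of the last two equations of
(S). The even part equals the second residual plus (p₁² - p₂²) times the first. -/
lemma magBracket_eq {U : Plane → State} (hU : Differentiable ℝ U) (hpos : ∀ q, 0 < confFactor U q)
    (z : Phase) (hz : z.2 0 ^ 2 + z.2 1 ^ 2 = U z.1 0) :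
    U z.1 0 * magBracket (magField U) (magIntegral U) (hamiltonian (conformalMetric (confFactor U))) z =
      2 * pd 0 (fun q => U q 2) z.1 * z.2 0 ^ 2 - 2 * pd 1 (fun q => U q 3) z.1 * z.2 1 ^ 2 +
      (2 * pd 0 (fun q => U q 0) z.1 + pd 0 (fun q => U q 1) z.1 -
        1 / 2 * (U z.1 3 * (pd 1 (fun q => U q 2) z.1 - pd 0 (fun q => U q 3) z.1))) * z.2 0 -
      (2 * pd 1 (fun q => U q 0) z.1 - pd 1 (fun q => U q 1) z.1 +
        1 / 2 * (U z.1 2 * (pd 1 (fun q => U q 2) z.1 - pd 0 (fun q => U q 3) z.1))) * z.2 1 +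
      U z.1 2 * pd 0 (fun q => U q 0) z.1 - U z.1 3 * pd 1 (fun q => U q 0) z.1 := by
  have hL : Differentiable ℝ (confFactor U) := fun q => differentiableAt_pi.1 (hU q) 0
  have hne : U z.1 0 ≠ 0 := (hpos z.1).ne'
  have hH := (hasFDerivAt_hamiltonian hL hpos z).fderiv
  have hF := (hasFDerivAt_magIntegral hU z).fderiv
  have hc : (fun q => U q 0) = confFactor U := rfl
  simp only [magBracket, dpos, dmom, hH, hF, Fin.sum_univ_two, magField, hz]
  simp [← pd.eq_1, hc]
  simp only [confFactor]
  field_simp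
  ring

/-- Evaluating at (±√Λ, 0) and (0, ±√Λ) suffices: differences of opposite momenta isolate the third
and fourth equations, and combinations of the sums give the first and second. -/
theorem solvesSystem_iff_isConservedOnLevel {U : Plane → State} (hU : Differentiable ℝ U)
    (hpos : ∀ q, 0 < confFactor U q) :
    SolvesSystem magA magB U ↔
      IsConservedOnLevel (conformalMetric (confFactor U)) (magField U) (magIntegral U) := by
  have hlev : ∀ z : Phase, hamiltonian (conformalMetric (confFactor U)) z = 1 / 2 ↔
      z.2 0 ^ 2 + z.2 1 ^ 2 = U z.1 0 := by
    intro z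
    have hne : U z.1 0 ≠ 0 := (hpos z.1).ne'
    rw [hamiltonian_conformalMetric z hne, confFactor, div_eq_div_iff (by simpa using hne) (by simp)]
    constructor <;> intro h <;> linarith
  constructor
  · intro h z hz
    rw [hlev] at hz
    have hb := magBracket_eq hU hpos z hz
    obtain ⟨h1, h2, h3, h4⟩ := (magSystem_eq_zero_iff (hU z.1)).1 (h z.1)
    rw [h3, h4] at hb
    have hne : U z.1 0 ≠ 0 := (hpos z.1).ne'
    refine (mul_eq_zero.1 (hb.trans ?_)).resolve_left hne
    rw [← hz] at h2
    linear_combination h2 + (z.2 0 ^ 2 - z.2 1 ^ 2) * h1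
  · intro h q
    rw [magSystem_eq_zero_iff (hU q)]
    have hL : 0 < U q 0 := hpos q
    have hs : √(U q 0) ^ 2 = U q 0 := Real.sq_sqrt hL.le
    have hs0 : √(U q 0) ≠ 0 := (Real.sqrt_pos.2 hL).ne'
    have key : ∀ p : Plane, p 0 ^ 2 + p 1 ^ 2 = U q 0 → _ := fun p hp =>
      (magBracket_eq hU hpos (q, p) hp).symm.trans
        (by rw [h (q, p) ((hlev (q, p)).2 hp), mul_zero])
    have k1 := key ![√(U q 0), 0] (by simp [hs])
    have k2 := key ![-√(U q 0), 0] (by simp [hs])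
    have k3 := key ![0, √(U q 0)] (by simp [hs])
    have k4 := key ![0, -√(U q 0)] (by simp [hs])
    simp only [Matrix.cons_val_zero, Matrix.cons_val_one] at k1 k2 k3 k4
    generalize √(U q 0) = s at *
    have h3 : 2 * pd 0 (fun q => U q 0) q + pd 0 (fun q => U q 1) q -
        1 / 2 * (U q 3 * (pd 1 (fun q => U q 2) q - pd 0 (fun q => U q 3) q)) = 0 := by
      refine (mul_eq_zero.1 ?_).resolve_right hs0
      linear_combination (k1 - k2) / 2
    have h4 : 2 * pd 1 (fun q => U q 0) q - pd 1 (fun q => U q 1) q +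
        1 / 2 * (U q 2 * (pd 1 (fun q => U q 2) q - pd 0 (fun q => U q 3) q)) = 0 := by
      refine (mul_eq_zero.1 ?_).resolve_right hs0
      linear_combination -(k3 - k4) / 2
    have h1 : pd 0 (fun q => U q 2) q + pd 1 (fun q => U q 3) q = 0 := by
      refine (mul_eq_zero.1 ?_).resolve_right hL.ne'
      linear_combination (k1 + k2 - k3 - k4) / 4 -
        (pd 0 (fun q => U q 2) q + pd 1 (fun q => U q 3) q) * hs
    refine ⟨h1, ?_, h3, h4⟩
    linear_combination (k1 + k2 + k3 + k4) / 4 -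
      (pd 0 (fun q => U q 2) q - pd 1 (fun q => U q 3) q) * hs

end

noncomputable section

/-! ### The integral is quadratic and independent of the energy -/

/-- The zeros of a non-trivial analytic function on the line form a null set. Non-triviality holds
because the first harmonics change sign under φ ↦ φ + π, so the values at π/4 and 5π/4 add up to the
second harmonic alone, which is not zero. -/
lemma volume_trig_zero_eq_zero {r f g : ℝ} (hr : r ≠ 0) :
    MeasureTheory.volume {φ : ℝ | 4 * r * (Real.cos φ * Real.sin φ) + g * Real.cos φ +
      f * Real.sin φ = 0} = 0 := by
  have ha : AnalyticOnNhd ℝ (fun φ : ℝ => 4 * r * (Real.cos φ * Real.sin φ) + g * Real.cos φ +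
      f * Real.sin φ) Set.univ := fun φ _ => by
    have h1 := Real.analyticAt_cos (x := φ)
    have h2 := Real.analyticAt_sin (x := φ)
    fun_prop
  have hx : ∃ φ : ℝ, 4 * r * (Real.cos φ * Real.sin φ) + g * Real.cos φ + f * Real.sin φ ≠ 0 := by
    by_contra! hcon
    have h1 := hcon (Real.pi / 4)
    have h2 := hcon (Real.pi / 4 + Real.pi)
    rw [Real.cos_add_pi, Real.sin_add_pi] at h2
    rw [Real.cos_pi_div_four, Real.sin_pi_div_four] at h1 h2
    have h3 : (√2 : ℝ) ^ 2 = 2 := Real.sq_sqrt (by norm_num)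
    apply hr
    linear_combination (h1 + h2) / 4 - r / 2 * h3
  obtain ⟨φ, hφ⟩ := hx
  have hcod := ha.preimage_zero_mem_codiscrete hφ
  have hae := ae_restrict_le_codiscreteWithin (μ := MeasureTheory.volume)
    (U := (Set.univ : Set ℝ)) MeasurableSet.univ hcod
  rw [MeasureTheory.Measure.restrict_univ] at hae
  have h0 := MeasureTheory.mem_ae_iff.1 hae
  simpa [Set.compl_def] using h0

/-- It suffices to compare momentum derivatives. On a fibre circle dH is radial, so dependence with
dF forces ∂F/∂φ = 0. That is the equation D = 0, whose solution set is null by Fubini. -/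
theorem isIndependentOnLevel_magIntegral {U : Plane → State} (hU : Differentiable ℝ U)
    (hpos : ∀ q, 0 < confFactor U q) :
    IsIndependentOnLevel (conformalMetric (confFactor U)) (magIntegral U) := by
  have hUc : ∀ i, Continuous fun q => U q i := fun i => (continuous_apply i).comp hU.continuous
  have hL : Differentiable ℝ (confFactor U) := fun q => differentiableAt_pi.1 (hU q) 0
  let D : Plane × ℝ → ℝ := fun w => 4 * √(U w.1 0) * (Real.cos w.2 * Real.sin w.2) +
    U w.1 3 * Real.cos w.2 + U w.1 2 * Real.sin w.2
  have hD : Continuous D := by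
    have := fun i => (hUc i).comp (continuous_fst (X := Plane) (Y := ℝ))
    have h0 := this 0
    have h2 := this 2
    have h3 := this 3
    simp only [Function.comp_def] at h0 h2 h3
    fun_prop
  have hnull : MeasureTheory.volume {w | D w = 0} = 0 := by
    have hm : MeasurableSet {w | D w = 0} := (isClosed_eq hD continuous_const).measurableSet
    rw [MeasureTheory.Measure.volume_eq_prod, MeasureTheory.Measure.measure_prod_null hm]
    refine Filter.Eventually.of_forall fun q => ?_
    exact volume_trig_zero_eq_zero (r := √(U q 0)) (f := U q 2) (g := U q 3)
      (Real.sqrt_pos.2 (hpos q)).ne'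
  have hae : ∀ᵐ w : Plane × ℝ, D w ≠ 0 := by
    rw [MeasureTheory.ae_iff]
    simpa using hnull
  filter_upwards [hae] with w hw r hr hlev
  have hne : U w.1 0 ≠ 0 := (hpos w.1).ne'
  rw [hamiltonian_conformalMetric _ hne] at hlev
  have hr2 : r ^ 2 = U w.1 0 := by
    simp only [confFactor, Pi.smul_apply, Matrix.cons_val_zero, Matrix.cons_val_one,
      smul_eq_mul] at hlev
    rw [div_eq_div_iff (by simpa using hne) (by simp)] at hlev
    linear_combination hlev / 2 - r ^ 2 * Real.sin_sq_add_cos_sq w.2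
  have hrs : √(U w.1 0) = r := by rw [← hr2, Real.sqrt_sq hr.le]
  simp only [D, hrs] at hw
  rw [LinearIndependent.pair_iff]
  intro s t hst
  rw [(hasFDerivAt_hamiltonian hL hpos _).fderiv, (hasFDerivAt_magIntegral hU _).fderiv] at hst
  have e0 := congrArg (fun T => T ((0, Pi.single 0 1) : Phase)) hst
  have e1 := congrArg (fun T => T ((0, Pi.single 1 1) : Phase)) hst
  simp at e0 e1
  have hcf : confFactor U w.1 = U w.1 0 := rfl
  rw [hcf] at e0 e1
  have ht : t = 0 := by
    by_contra ht
    refine hw (mul_left_cancel₀ (mul_ne_zero ht (mul_ne_zero two_ne_zero hr.ne')) ?_)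
    -- Pairing the relation with the tangent of the fibre circle annihilates dH and leaves t D = 0,
    -- up to a non-zero factor.
    linear_combination r * Real.sin w.2 * e0 - r * Real.cos w.2 * e1
  subst ht
  simp only [zero_mul, add_zero, mul_eq_zero, inv_eq_zero] at e0 e1
  refine ⟨?_, rfl⟩
  by_contra hs
  have hc : Real.cos w.2 = 0 := by simpa [hs, hne, hr.ne'] using e0
  have hsn : Real.sin w.2 = 0 := by simpa [hs, hne, hr.ne'] using e1
  have := Real.sin_sq_add_cos_sq w.2
  rw [hc, hsn] at this
  norm_num at this

theorem isQuadraticInMomenta_magIntegral {U : Plane → State} (hU : AnalyticOnNhd ℝ U Set.univ)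
    (hper : DoublyPeriodic U) :
    IsQuadraticInMomenta (conformalMetric (confFactor U)) (magIntegral U) := by
  have hc : ∀ i, AnalyticOnNhd ℝ (fun q => U q i) Set.univ := fun i q hq =>
    analyticAt_pi_iff.1 (hU q hq) i
  refine ⟨fun _ => !![2, 0; 0, -2], fun q => ![2 * U q 2, -(2 * U q 3)], fun q => U q 1,
    fun i j => analyticOnNhd_const, fun q hq => ?_, hc 1, fun _ _ => rfl, fun q i => ?_,
    fun q i => ?_, fun q => ?_, fun z => ?_, 0, fun s hs => ?_⟩
  · refine analyticAt_pi_iff.2 fun i => ?_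
    have h2 := hc 2 q hq
    have h3 := hc 3 q hq
    fin_cases i <;> simp <;> fun_prop
  · simp only [hper q i]
  · simp only [hper q i]
  · ext i j; fin_cases i <;> fin_cases j <;> rfl
  · simp [magIntegral, Matrix.mulVec, dotProduct, Fin.sum_univ_two]
    ring
  · have hinv : (conformalMetric (confFactor U) 0)⁻¹ =
        (Ring.inverse (confFactor U 0)) • (1 : Matrix (Fin 2) (Fin 2) ℝ) := by
      rcases eq_or_ne (confFactor U 0) 0 with h | h
      · simp [conformalMetric, h]
      · apply Matrix.inv_eq_right_inv
        simp [conformalMetric, h]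
    rw [hinv] at hs
    have h0 := congrFun (congrFun hs 0) 0
    have h1 := congrFun (congrFun hs 1) 1
    simp at h0 h1
    linarith

lemma pd_add_period {u : Plane → State} (h : DoublyPeriodic u) (i : Fin 2) (k : Fin 4) :
    DoublyPeriodic (pd i fun q => u q k) := by
  intro q j
  rw [pd, pd, ← fderiv_comp_add_right]
  congr 2
  funext q'
  rw [h q' j]

lemma AnalyticOnNhd.pd {u : Plane → ℝ} (h : AnalyticOnNhd ℝ u Set.univ) (i : Fin 2) :
    AnalyticOnNhd ℝ (pd i u) Set.univ := h.dirDeriv _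

theorem isAnalyticTorusMetric_conformalMetric {U : Plane → State}
    (hU : AnalyticOnNhd ℝ U Set.univ) (hper : DoublyPeriodic U) (hpos : ∀ q, 0 < confFactor U q) :
    IsAnalyticTorusMetric (conformalMetric (confFactor U)) := by
  refine ⟨fun i j q hq => ?_, fun q i => ?_, fun q => ?_⟩
  · have h0 : AnalyticAt ℝ (fun q => U q 0) q := analyticAt_pi_iff.1 (hU q hq) 0
    simp only [conformalMetric, Matrix.smul_apply, smul_eq_mul, confFactor]
    exact h0.mul analyticAt_const
  · simp only [conformalMetric, confFactor, hper q i]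
  · exact Matrix.PosDef.one.smul (hpos q)

theorem analyticOnNhd_magField {U : Plane → State} (hU : AnalyticOnNhd ℝ U Set.univ) :
    AnalyticOnNhd ℝ (magField U) Set.univ := by
  have hc : ∀ i, AnalyticOnNhd ℝ (fun q => U q i) Set.univ := fun i q hq =>
    analyticAt_pi_iff.1 (hU q hq) i
  intro q hq
  exact analyticAt_const.mul (((hc 3).pd 0 q hq).sub ((hc 2).pd 1 q hq))

theorem doublyPeriodic_magField {U : Plane → State} (hper : DoublyPeriodic U) :
    DoublyPeriodic (magField U) := by
  intro q i
  rw [magField, magField, pd_add_period hper 0 3 q i, pd_add_period hper 1 2 q i]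

end

noncomputable section

/-! ### Riemann invariants and conservation laws -/

theorem exists_analytic_implicit {E : Type*} [NormedAddCommGroup E] [NormedSpace ℝ E]
    [CompleteSpace E] {G : E × ℝ → ℝ} {U : E} {x d : ℝ} (hG : AnalyticAt ℝ G (U, x))
    (h0 : G (U, x) = 0) (hd : HasDerivAt (fun y => G (U, y)) d x) (hd0 : d ≠ 0) :
    ∃ φ : E → ℝ, AnalyticAt ℝ φ U ∧ φ U = x ∧ ∀ᶠ W in 𝓝 U, G (W, φ W) = 0 := by
  have hc : ContDiffAt ℝ ω G (U, x) := hG.contDiffAt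
  have hinv : (fderiv ℝ G (U, x) ∘L .inr ℝ E ℝ).IsInvertible := by
    refine ⟨ContinuousLinearEquiv.unitsEquivAut ℝ (Units.mk0 d hd0), ?_⟩
    refine ContinuousLinearMap.ext_ring ?_
    have h1 : HasFDerivAt (fun y : ℝ => (U, y)) (.inr ℝ E ℝ) x := hasFDerivAt_prodMk_right U x
    have h2 := (hG.differentiableAt.hasFDerivAt.comp x h1).hasDerivAt
    simpa using hd.unique h2
  refine ⟨hc.implicitFunction (by simp) hinv,
    (hc.contDiffAt_implicitFunction (by simp) hinv).analyticAt,
    hc.implicitFunction_apply_self (by simp) hinv, ?_⟩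
  filter_upwards [hc.eventually_apply_implicitFunction (by simp) hinv] with W hW
  rw [hW, h0]

/-- If the derivative vanished at x₀, removing the factor (x - x₀)² would leave a quadratic with
three distinct roots. -/
lemma quartic_deriv_ne_zero {a b c d e x₀ x₁ x₂ x₃ : ℝ} (ha : a ≠ 0)
    (h₀ : a * x₀ ^ 4 + b * x₀ ^ 3 + c * x₀ ^ 2 + d * x₀ + e = 0)
    (h₁ : a * x₁ ^ 4 + b * x₁ ^ 3 + c * x₁ ^ 2 + d * x₁ + e = 0)
    (h₂ : a * x₂ ^ 4 + b * x₂ ^ 3 + c * x₂ ^ 2 + d * x₂ + e = 0)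
    (h₃ : a * x₃ ^ 4 + b * x₃ ^ 3 + c * x₃ ^ 2 + d * x₃ + e = 0)
    (n₁ : x₁ ≠ x₀) (n₂ : x₂ ≠ x₀) (n₃ : x₃ ≠ x₀) (n₁₂ : x₁ ≠ x₂) (n₁₃ : x₁ ≠ x₃) (n₂₃ : x₂ ≠ x₃) :
    4 * a * x₀ ^ 3 + 3 * b * x₀ ^ 2 + 2 * c * x₀ + d ≠ 0 := by
  intro hd
  have key : ∀ x, x ≠ x₀ → a * x ^ 4 + b * x ^ 3 + c * x ^ 2 + d * x + e = 0 →
      a * x ^ 2 + (b + 2 * a * x₀) * x + (c + 2 * b * x₀ + 3 * a * x₀ ^ 2) = 0 := by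
    intro x hx h
    refine mul_left_cancel₀ (pow_ne_zero 2 (sub_ne_zero.2 hx)) ?_
    linear_combination h - h₀ - (x - x₀) * hd
  have k₁ := key x₁ n₁ h₁
  have k₂ := key x₂ n₂ h₂
  have k₃ := key x₃ n₃ h₃
  have e₁₂ : a * (x₁ + x₂) + (b + 2 * a * x₀) = 0 :=
    mul_left_cancel₀ (sub_ne_zero.2 n₁₂) (by linear_combination k₁ - k₂)
  have e₁₃ : a * (x₁ + x₃) + (b + 2 * a * x₀) = 0 :=
    mul_left_cancel₀ (sub_ne_zero.2 n₁₃) (by linear_combination k₁ - k₃)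
  exact mul_ne_zero ha (sub_ne_zero.2 n₂₃) (by linear_combination e₁₂ - e₁₃)

lemma det_magA (U : State) : (magA U).det = -(U 2 ^ 2 / 2) := by
  simp [magA, Matrix.det_succ_row_zero, Fin.sum_univ_succ, Fin.succAbove]
  ring

lemma det_magB_sub (U : State) (x : ℝ) : (magB U - x • magA U).det =
    (16 * U 0 * x ^ 2 - (U 2 * x + U 3) ^ 2 * (1 + x ^ 2)) / 2 := by
  simp [magA, magB, Matrix.det_succ_row_zero, Fin.sum_univ_succ, Fin.succAbove]
  ring

/-- f ≠ 0 is det A ≠ 0. If g = 0, at least three non-zero roots would satisfy f² (1 + λ²) = 16Λ, so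
any two of them would be opposite. If Λ ≤ 0, every root would satisfy fλ + g = 0. The last clause
says that the roots are simple, which the implicit function theorem needs. -/
theorem IsStrictlyHyperbolicAt.exists_roots {U : State} (h : IsStrictlyHyperbolicAt magA magB U) :
    0 < U 0 ∧ U 2 ≠ 0 ∧ U 3 ≠ 0 ∧ ∃ lam : Fin 4 → ℝ, Function.Injective lam ∧
      (∀ i, (U 2 * lam i + U 3) ^ 2 * (1 + lam i ^ 2) = 16 * U 0 * lam i ^ 2) ∧
      ∀ i, 2 * (U 2 * lam i + U 3) * U 2 * (1 + lam i ^ 2) + 2 * lam i * (U 2 * lam i + U 3) ^ 2 -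
        32 * U 0 * lam i ≠ 0 := by
  obtain ⟨hA, lam, hinj, hdet⟩ := h
  rw [det_magA] at hA
  have hf : U 2 ≠ 0 := fun h => hA (by simp [h])
  have hroot : ∀ i, (U 2 * lam i + U 3) ^ 2 * (1 + lam i ^ 2) = 16 * U 0 * lam i ^ 2 := by
    intro i
    have := hdet i
    rw [det_magB_sub] at this
    linarith
  have hne : ∀ {i j}, i ≠ j → lam i ≠ lam j := fun h => hinj.ne h
  have hg : U 3 ≠ 0 := by
    intro hg
    have key : ∀ i, lam i ≠ 0 → U 2 ^ 2 * (1 + lam i ^ 2) = 16 * U 0 := by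
      intro i hi
      refine mul_left_cancel₀ (pow_ne_zero 2 hi) ?_
      have := hroot i
      rw [hg] at this
      linear_combination this
    have three : ∀ i j k, i ≠ j → i ≠ k → j ≠ k → lam i ≠ 0 → lam j ≠ 0 → lam k ≠ 0 → False := by
      intro i j k hij hik hjk hi hj hk
      have e : ∀ a b, a ≠ b → lam a ≠ 0 → lam b ≠ 0 → lam a + lam b = 0 := by
        intro a b hab ha hb
        refine mul_left_cancel₀ (mul_ne_zero (pow_ne_zero 2 hf) (sub_ne_zero.2 (hne hab))) ?_
        linear_combination key a ha - key b hb
      exact hne hjk (by linear_combination e i j hij hi hj - e i k hik hi hk)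
    by_cases z0 : lam 0 = 0
    · exact three 1 2 3 (by decide) (by decide) (by decide) (z0 ▸ hne (by decide))
        (z0 ▸ hne (by decide)) (z0 ▸ hne (by decide))
    by_cases z1 : lam 1 = 0
    · exact three 0 2 3 (by decide) (by decide) (by decide) z0
        (z1 ▸ hne (by decide)) (z1 ▸ hne (by decide))
    by_cases z2 : lam 2 = 0
    · exact three 0 1 3 (by decide) (by decide) (by decide) z0 z1 (z2 ▸ hne (by decide))
    exact three 0 1 2 (by decide) (by decide) (by decide) z0 z1 z2
  have hL : 0 < U 0 := by
    by_contra! hL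
    have key : ∀ i, U 2 * lam i + U 3 = 0 := by
      intro i
      have h1 := hroot i
      have h2 : 0 ≤ (U 2 * lam i + U 3) ^ 2 * lam i ^ 2 := by positivity
      have h3 : U 0 * lam i ^ 2 ≤ 0 := mul_nonpos_of_nonpos_of_nonneg hL (sq_nonneg _)
      have h4 : (U 2 * lam i + U 3) ^ 2 ≤ 0 := by nlinarith
      exact pow_eq_zero_iff two_ne_zero |>.1 (le_antisymm h4 (sq_nonneg _))
    exact hne (i := 0) (j := 1) (by decide)
      (mul_left_cancel₀ hf (by linear_combination key 0 - key 1))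
  refine ⟨hL, hf, hg, lam, hinj, hroot, ?_⟩
  have hpoly : ∀ i, U 2 ^ 2 * lam i ^ 4 + 2 * U 2 * U 3 * lam i ^ 3 +
      (U 2 ^ 2 + U 3 ^ 2 - 16 * U 0) * lam i ^ 2 + 2 * U 2 * U 3 * lam i + U 3 ^ 2 = 0 :=
    fun i => by linear_combination hroot i
  have key : ∀ i j k l, j ≠ i → k ≠ i → l ≠ i → j ≠ k → j ≠ l → k ≠ l →
      2 * (U 2 * lam i + U 3) * U 2 * (1 + lam i ^ 2) + 2 * lam i * (U 2 * lam i + U 3) ^ 2 -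
        32 * U 0 * lam i ≠ 0 := by
    intro i j k l a b c d e f
    have := quartic_deriv_ne_zero (pow_ne_zero 2 hf) (hpoly i) (hpoly j) (hpoly k) (hpoly l)
      (hne a) (hne b) (hne c) (hne d) (hne e) (hne f)
    contrapose! this
    linear_combination this
  intro i
  fin_cases i
  · exact key 0 1 2 3 (by decide) (by decide) (by decide) (by decide) (by decide) (by decide)
  · exact key 1 0 2 3 (by decide) (by decide) (by decide) (by decide) (by decide) (by decide)
  · exact key 2 0 1 3 (by decide) (by decide) (by decide) (by decide) (by decide) (by decide)
  · exact key 3 0 1 2 (by decide) (by decide) (by decide) (by decide) (by decide) (by decide)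

/-- `∂F/∂φ`, up to the factor `-2 √Λ`, for `F = u₀ + 2 Λ cos 2φ + 2 √Λ (f cos φ - g sin φ)`. -/
def phaseSlope (p : State × ℝ) : ℝ :=
  4 * √(p.1 0) * (Real.cos p.2 * Real.sin p.2) + p.1 2 * Real.sin p.2 + p.1 3 * Real.cos p.2

lemma analyticAt_phaseSlope {U : State} {x : ℝ} (hU : 0 < U 0) :
    AnalyticAt ℝ phaseSlope (U, x) := by
  have h0 : ∀ i, AnalyticAt ℝ (fun p : State × ℝ => p.1 i) (U, x) := fun i =>
    ((ContinuousLinearMap.proj (R := ℝ) i).comp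
      (ContinuousLinearMap.fst ℝ State ℝ)).analyticAt _
  have hs : AnalyticAt ℝ (fun p : State × ℝ => √(p.1 0)) (U, x) := by
    have h1 : AnalyticAt ℝ Real.sqrt (U 0) :=
      (Real.contDiffAt_sqrt hU.ne').analyticAt
    exact AnalyticAt.fun_comp (f := fun p : State × ℝ => p.1 0) h1 (h0 0)
  have hc : AnalyticAt ℝ (fun p : State × ℝ => Real.cos p.2) (U, x) :=
    AnalyticAt.fun_comp (f := fun p : State × ℝ => p.2) Real.analyticAt_cos analyticAt_snd
  have hn : AnalyticAt ℝ (fun p : State × ℝ => Real.sin p.2) (U, x) :=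
    AnalyticAt.fun_comp (f := fun p : State × ℝ => p.2) Real.analyticAt_sin analyticAt_snd
  exact (((analyticAt_const.mul hs).mul (hc.mul hn)).add ((h0 2).mul hn)).add ((h0 3).mul hc)

/-- Dividing the critical equation by cos φ gives fx + g = -4√Λ x cos φ with x = tan φ, and the
quartic is its square. Squaring loses only the sign of cos φ, which is restored by choosing between
arctan x and arctan x + π. -/
lemma exists_phase {L f g x : ℝ} (hL : 0 < L)
    (h : (f * x + g) ^ 2 * (1 + x ^ 2) = 16 * L * x ^ 2) :
    ∃ φ, Real.cos φ ≠ 0 ∧ Real.sin φ = x * Real.cos φ ∧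
      4 * √L * (Real.cos φ * Real.sin φ) + f * Real.sin φ + g * Real.cos φ = 0 := by
  set c := Real.cos (Real.arctan x) with hc
  have hc0 : c ≠ 0 := (Real.cos_arctan_pos x).ne'
  have hs : Real.sin (Real.arctan x) = x * c := by
    rw [hc, ← Real.tan_mul_cos (by exact hc0), Real.tan_arctan]
  have hsc : c ^ 2 * (1 + x ^ 2) = 1 := by
    have := Real.sin_sq_add_cos_sq (Real.arctan x)
    rw [hs, ← hc] at this
    linear_combination this
  have hr : √L ^ 2 = L := Real.sq_sqrt hL.le
  have hprod : (4 * √L * (c * (x * c)) + f * (x * c) + g * c) *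
      (4 * √L * (c * (x * c)) - f * (x * c) - g * c) = 0 := by
    linear_combination 16 * c ^ 4 * x ^ 2 * hr - c ^ 4 * h + c ^ 2 * (f * x + g) ^ 2 * hsc
  rcases mul_eq_zero.1 hprod with h1 | h1
  · exact ⟨Real.arctan x, hc0, hs, by rw [hs]; exact h1⟩
  · refine ⟨Real.arctan x + Real.pi, ?_, ?_, ?_⟩
    · rw [Real.cos_add_pi]; exact neg_ne_zero.2 hc0
    · rw [Real.cos_add_pi, Real.sin_add_pi, hs]; ring
    · rw [Real.cos_add_pi, Real.sin_add_pi, hs]; linear_combination h1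

/-- Simplicity of the root x of the quartic is equivalent to what is needed here, non-degeneracy of
the critical phase, so that the phase continues analytically in the state. -/
lemma exists_phase_function {U : State} (hL : 0 < U 0) {x : ℝ}
    (h : (U 2 * x + U 3) ^ 2 * (1 + x ^ 2) = 16 * U 0 * x ^ 2)
    (hd : 2 * (U 2 * x + U 3) * U 2 * (1 + x ^ 2) + 2 * x * (U 2 * x + U 3) ^ 2 -
      32 * U 0 * x ≠ 0) :
    ∃ φ : State → ℝ, AnalyticAt ℝ φ U ∧ Real.cos (φ U) ≠ 0 ∧ Real.tan (φ U) = x ∧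
      ∀ᶠ W in 𝓝 U, phaseSlope (W, φ W) = 0 := by
  obtain ⟨y, hc, hs, h0⟩ := exists_phase hL h
  have hder : HasDerivAt (fun t => phaseSlope (U, t))
      (4 * √(U 0) * (-Real.sin y * Real.sin y + Real.cos y * Real.cos y) + U 2 * Real.cos y +
        U 3 * -Real.sin y) y :=
    ((((Real.hasDerivAt_cos y).mul (Real.hasDerivAt_sin y)).const_mul (4 * √(U 0))).add
      ((Real.hasDerivAt_sin y).const_mul (U 2))).add ((Real.hasDerivAt_cos y).const_mul (U 3))
  obtain ⟨φ, h1, h2, h3⟩ := exists_analytic_implicit (analyticAt_phaseSlope hL) h0 hder (by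
    contrapose! hd
    have hr : √(U 0) ^ 2 = U 0 := Real.sq_sqrt hL.le
    have hsc := Real.sin_sq_add_cos_sq y
    generalize Real.sin y = s at *
    generalize Real.cos y = c at *
    subst hs
    have e0 : 4 * √(U 0) * c * x + U 2 * x + U 3 = 0 :=
      mul_left_cancel₀ hc (by linear_combination h0)
    have e1 : 4 * √(U 0) * c + U 2 * (1 + x ^ 2) = 0 :=
      mul_left_cancel₀ hc (by linear_combination hd + x * c * e0)
    have e2 : U 2 * x + U 3 = -4 * √(U 0) * c * x := by linear_combination e0
    rw [e2]
    linear_combination -8 * √(U 0) * c * x * e1 + 32 * √(U 0) ^ 2 * x * hsc + 32 * x * hr)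
  refine ⟨φ, h1, by rwa [h2], ?_, h3⟩
  rw [h2, Real.tan_eq_sin_div_cos, hs, mul_div_cancel_right₀ _ hc]

/-- The value of the integral at the critical phase. -/
def riemannInvariant (φ : State → ℝ) (W : State) : ℝ :=
  W 1 + 2 * (W 0 * (Real.cos (φ W) ^ 2 - Real.sin (φ W) ^ 2)) +
    2 * (√(W 0) * (W 2 * Real.cos (φ W) - W 3 * Real.sin (φ W)))

/-- The gradient of `riemannInvariant`. -/
def riemannGradient (W : State) (x : ℝ) : State :=
  ![2 * (Real.cos x ^ 2 - Real.sin x ^ 2) + (W 2 * Real.cos x - W 3 * Real.sin x) / √(W 0), 1,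
    2 * √(W 0) * Real.cos x, -2 * √(W 0) * Real.sin x]

/-- Envelope argument: every term containing the derivative of φ is a multiple of `phaseSlope`,
which vanishes. The gradient is thus the one taken with φ frozen. -/
lemma fderiv_riemannInvariant {φ : State → ℝ} {W : State} (hφ : DifferentiableAt ℝ φ W)
    (hL : 0 < W 0) (h : phaseSlope (W, φ W) = 0) (j : Fin 4) :
    fderiv ℝ (riemannInvariant φ) W (Pi.single j 1) = riemannGradient W (φ W) j := by
  have hp : ∀ i : Fin 4, HasFDerivAt (fun V : State => V i)
      (ContinuousLinearMap.proj (R := ℝ) i) W := fun i => hasFDerivAt_apply i W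
  have hc := hφ.hasFDerivAt.cos
  have hs := hφ.hasFDerivAt.sin
  have hq := (hp 0).sqrt hL.ne'
  have hF := (((hp 1).add (((hp 0).mul ((hc.pow 2).sub (hs.pow 2))).const_mul 2))).add
    ((hq.mul (((hp 2).mul hc).sub ((hp 3).mul hs))).const_mul 2)
  have hr0 : √(W 0) ≠ 0 := (Real.sqrt_pos.2 hL).ne'
  have hr : √(W 0) ^ 2 = W 0 := Real.sq_sqrt hL.le
  have hF' : HasFDerivAt (riemannInvariant φ) _ W := hF
  rw [hF'.fderiv]
  simp only [phaseSlope] at h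
  have hj : ∀ i : Fin 4, (Pi.single j (1 : ℝ) : State) i = if i = j then 1 else 0 :=
    fun i => Pi.single_apply j 1 i
  generalize hD : fderiv ℝ φ W (Pi.single j 1) = D
  simp only [hD, add_apply, sub_apply,
    smul_apply, ContinuousLinearMap.proj_apply, smul_eq_mul, nsmul_eq_mul,
    Pi.mul_apply, Pi.sub_apply, hj]
  clear hj hD hF hF' hc hs hq hp hφ
  fin_cases j <;> simp [riemannGradient]
  · field_simp
    linear_combination -2 * √(W 0) ^ 2 * D * h +
      8 * D * √(W 0) * Real.cos (φ W) * Real.sin (φ W) * hr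
  · linear_combination -2 * √(W 0) * D * h + 8 * D * Real.cos (φ W) * Real.sin (φ W) * hr
  · linear_combination -2 * √(W 0) * D * h + 8 * D * Real.cos (φ W) * Real.sin (φ W) * hr
  · linear_combination -2 * √(W 0) * D * h + 8 * D * Real.cos (φ W) * Real.sin (φ W) * hr

lemma analyticAt_riemannInvariant {φ : State → ℝ} {W : State} (hφ : AnalyticAt ℝ φ W)
    (hL : 0 < W 0) : AnalyticAt ℝ (riemannInvariant φ) W := by
  have hp : ∀ i : Fin 4, AnalyticAt ℝ (fun V : State => V i) W := fun i =>
    (ContinuousLinearMap.proj (R := ℝ) (φ := fun _ : Fin 4 => ℝ) i).analyticAt W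
  have hs : AnalyticAt ℝ (fun V : State => √(V 0)) W :=
    AnalyticAt.fun_comp (f := fun V : State => V 0)
      (Real.contDiffAt_sqrt hL.ne').analyticAt (hp 0)
  have hc : AnalyticAt ℝ (fun V : State => Real.cos (φ V)) W :=
    AnalyticAt.fun_comp Real.analyticAt_cos hφ
  have hn : AnalyticAt ℝ (fun V : State => Real.sin (φ V)) W :=
    AnalyticAt.fun_comp Real.analyticAt_sin hφ
  exact ((hp 1).add (analyticAt_const.mul ((hp 0).mul ((hc.pow 2).sub (hn.pow 2))))).add
    (analyticAt_const.mul (hs.mul (((hp 2).mul hc).sub ((hp 3).mul hn))))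

/-- A row vector m is exhibited with mA = cos φ · ∇r and mB = sin φ · ∇r. The combination m of the
equations of (S) is cos φ r_x + sin φ r_y = 0, whence the eigenvalue tan φ. -/
lemma riemannGradient_vecMul {W : State} {x : ℝ} (hL : 0 < W 0) (hf : W 2 ≠ 0)
    (hc : Real.cos x ≠ 0) (h : phaseSlope (W, x) = 0) :
    riemannGradient W x ᵥ* ((magA W)⁻¹ * magB W) = Real.tan x • riemannGradient W x := by
  have hr0 : √(W 0) ≠ 0 := (Real.sqrt_pos.2 hL).ne'
  have hr : √(W 0) ^ 2 = W 0 := Real.sq_sqrt hL.le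
  have hsc := Real.sin_sq_add_cos_sq x
  have hq : (√(W 0))⁻¹ * W 0 = √(W 0) := by
    nth_rewrite 2 [← hr]
    field_simp
  simp only [phaseSlope] at h
  set m : State := ![√(W 0) * (2 * Real.cos x ^ 2 - 1), 1 / √(W 0), Real.cos x, -Real.sin x]
    with hm
  have hA : m ᵥ* magA W = Real.cos x • riemannGradient W x := by
    ext j
    fin_cases j <;> simp [hm, Matrix.vecMul, dotProduct, Fin.sum_univ_four, magA, riemannGradient]
    · field_simp
      linear_combination Real.sin x * h - (W 2 + 2 * Real.cos x * √(W 0)) * hsc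
    · linear_combination hq
    · linear_combination h / 2
  have hB : m ᵥ* magB W = Real.sin x • riemannGradient W x := by
    ext j
    fin_cases j <;> simp [hm, Matrix.vecMul, dotProduct, Fin.sum_univ_four, magB, riemannGradient]
    · field_simp
      linear_combination -Real.cos x * h + (W 3 + 2 * Real.sin x * √(W 0)) * hsc
    · linear_combination -h / 2
    · linear_combination 2 * √(W 0) * hsc - hq
  have hdet : IsUnit (magA W).det := by
    rw [det_magA]
    exact (neg_ne_zero.2 (div_ne_zero (pow_ne_zero 2 hf) two_ne_zero)).isUnit
  have hmul : Real.cos x • (riemannGradient W x ᵥ* ((magA W)⁻¹ * magB W)) =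
      Real.sin x • riemannGradient W x := by
    rw [← Matrix.smul_vecMul, ← hA, Matrix.vecMul_vecMul, Matrix.mul_nonsing_inv_cancel_left _ _ hdet,
      hB]
  rw [Real.tan_eq_sin_div_cos, div_eq_inv_mul, mul_smul, ← hmul, smul_smul, inv_mul_cancel₀ hc,
    one_smul]

/-- The four roots give four critical values. Their gradients are eigenvectors for distinct
eigenvalues, hence independent, so the critical values form a coordinate system. All conditions used
are open. -/
theorem hasRiemannInvariantsNear_of_hyperbolic {U : State}
    (h : IsStrictlyHyperbolicAt magA magB U) : HasRiemannInvariantsNear magA magB U := by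
  obtain ⟨hL, hf, -, lam, hinj, hroot, hsimple⟩ := h.exists_roots
  choose φ han hcos htan hφ using fun j => exists_phase_function hL (hroot j) (hsimple j)
  have hev : ∀ᶠ W in 𝓝 U, (0 < W 0 ∧ W 2 ≠ 0) ∧
      (∀ j, AnalyticAt ℝ (φ j) W ∧ Real.cos (φ j W) ≠ 0 ∧ phaseSlope (W, φ j W) = 0) ∧
      ∀ i j, i ≠ j → Real.tan (φ i W) ≠ Real.tan (φ j W) := by
    refine ((continuous_apply 0).continuousAt.eventually (lt_mem_nhds hL)).and
      ((continuous_apply 2).continuousAt.eventually_ne hf) |>.and (.and ?_ ?_)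
    · refine Filter.eventually_all.2 fun j => (han j).eventually_analyticAt.and (.and ?_ (hφ j))
      exact (Real.continuous_cos.continuousAt.comp (han j).continuousAt).eventually_ne (hcos j)
    · refine Filter.eventually_all.2 fun i => Filter.eventually_all.2 fun j => ?_
      by_cases hij : i = j
      · simp [hij]
      have hc : ∀ i, ContinuousAt (fun W => Real.tan (φ i W)) U := fun i =>
        (Real.continuousAt_tan.2 (hcos i)).comp (han i).continuousAt
      have hne : Real.tan (φ i U) ≠ Real.tan (φ j U) := by
        rw [htan, htan]; exact hinj.ne hij
      filter_upwards [((hc i).sub (hc j)).eventually_ne (sub_ne_zero.2 hne)] with W hW _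
      exact sub_ne_zero.1 hW
  obtain ⟨N, hN, hopen, hmem⟩ := eventually_nhds_iff.1 hev
  have hana : ∀ j, ∀ W ∈ N, AnalyticAt ℝ (riemannInvariant (φ j)) W := fun j W hW =>
    analyticAt_riemannInvariant ((hN W hW).2.1 j).1 (hN W hW).1.1
  refine ⟨N, hopen, hmem, fun W j => riemannInvariant (φ j) W, fun W j => Real.tan (φ j W),
    contDiffOn_pi.2 fun j W hW => (hana j W hW).contDiffAt.contDiffWithinAt, fun W hW => ?_⟩
  obtain ⟨⟨hL, hf⟩, hph, hne⟩ := hN W hW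
  have hinjW : Function.Injective fun j => Real.tan (φ j W) := fun i j hij => by
    by_contra hc
    exact hne i j hc hij
  have hdiff : DifferentiableAt ℝ (fun W j => riemannInvariant (φ j) W) W :=
    differentiableAt_pi.2 fun j => (hana j W hW).differentiableAt
  have hjac : jac (fun W j => riemannInvariant (φ j) W) W =
      Matrix.of fun i => riemannGradient W (φ i W) := by
    ext i j
    refine (pd_apply hdiff j i).symm.trans ?_
    exact fderiv_riemannInvariant (hph i).1.differentiableAt hL (hph i).2.2 j
  have hrow : ∀ i, riemannGradient W (φ i W) ᵥ* ((magA W)⁻¹ * magB W) =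
      Real.tan (φ i W) • riemannGradient W (φ i W) := fun i =>
    riemannGradient_vecMul hL hf (hph i).2.1 (hph i).2.2
  refine ⟨?_, ?_, hinjW, ?_⟩
  · rw [det_magA]
    exact neg_ne_zero.2 (div_ne_zero (pow_ne_zero 2 hf) two_ne_zero)
  · have hli := Module.End.eigenvectors_linearIndependent'
      (Matrix.toLin' (((magA W)⁻¹ * magB W)ᵀ)) (fun j => Real.tan (φ j W)) hinjW
      (fun i => riemannGradient W (φ i W)) (fun i => by
        refine ⟨Module.End.mem_eigenspace_iff.2 ?_, fun h0 => ?_⟩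
        · rw [Matrix.toLin'_apply, Matrix.mulVec_transpose, hrow]
        · have := congrFun h0 1
          simp [riemannGradient] at this)
    rw [hjac]
    have hu : IsUnit (Matrix.of fun i => riemannGradient W (φ i W)) :=
      Matrix.linearIndependent_rows_iff_isUnit.1 hli
    exact ((Matrix.isUnit_iff_isUnit_det _).1 hu).ne_zero
  · rw [hjac]
    ext i j
    rw [Matrix.diagonal_mul]
    exact congrFun (hrow i) j


/-- Densities of the conservation laws. -/
def magDensity (U : State) : State :=
  ![U 2, U 0 * U 2, U 0 * U 2 * (U 0 + U 1),
    U 0 * U 2 * (U 1 ^ 2 + 2 * U 0 * U 1 + 2 * U 0 ^ 2 + U 0 * (U 2 ^ 2 + U 3 ^ 2))]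

/-- Fluxes of the conservation laws. -/
def magFlux (U : State) : State :=
  ![U 3, -(U 0 * U 3), U 0 * U 3 * (U 0 - U 1),
    -(U 0 * U 3 * (U 1 ^ 2 - 2 * U 0 * U 1 + 2 * U 0 ^ 2 + U 0 * (U 2 ^ 2 + U 3 ^ 2)))]

/-- The matrix `Z` with `jac magDensity = Z * A` and `jac magFlux = Z * B`. -/
def magMultiplier (U : State) : Matrix (Fin 4) (Fin 4) ℝ :=
  !![1, 0, 0, 0;
     0, 1, 0, 0;
     U 0 ^ 2, U 1, U 0 * U 2, U 0 * U 3;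
     U 0 ^ 2 * (2 * U 1 + U 2 ^ 2 - U 3 ^ 2),
     U 1 ^ 2 + 2 * U 0 ^ 2 + 2 * U 0 * (U 2 ^ 2 + U 3 ^ 2),
     2 * U 0 * U 2 * (U 1 + U 0), 2 * U 0 * U 3 * (U 1 - U 0)]

lemma contDiff_magDensity : ContDiff ℝ ∞ magDensity := by
  refine contDiff_pi.2 fun i => ?_
  fin_cases i <;> simp [magDensity] <;> fun_prop

lemma contDiff_magFlux : ContDiff ℝ ∞ magFlux := by
  refine contDiff_pi.2 fun i => ?_
  fin_cases i <;> simp [magFlux] <;> fun_prop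

lemma jac_magDensity (U : State) : jac magDensity U = magMultiplier U * magA U := by
  ext i j
  refine (pd_apply ((contDiff_magDensity.differentiable (by simp)) U) j i).symm.trans ?_
  have hp : ∀ i : Fin 4, HasFDerivAt (fun V : State => V i)
      (ContinuousLinearMap.proj (R := ℝ) i) U := fun i => hasFDerivAt_apply i U
  have h1 := (hp 0).mul (hp 2)
  have h3 := h1.mul (((((hp 1).pow 2).add (((hp 0).const_mul 2).mul (hp 1))).add
    (((hp 0).pow 2).const_mul 2)).add ((hp 0).mul (((hp 2).pow 2).add ((hp 3).pow 2))))
  have key : fderiv ℝ (fun V => magDensity V i) U (Pi.single j 1) = (magMultiplier U * magA U) i j := by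
    fin_cases i
    · have k : HasFDerivAt (fun V => magDensity V 0) _ U := hp 2
      refine (congrArg (fun T => T (Pi.single j 1)) k.fderiv).trans ?_
      fin_cases j <;> simp [magMultiplier, magA, Matrix.mul_apply, Fin.sum_univ_four]
    · have k : HasFDerivAt (fun V => magDensity V 1) _ U := h1
      refine (congrArg (fun T => T (Pi.single j 1)) k.fderiv).trans ?_
      fin_cases j <;> simp [magMultiplier, magA, Matrix.mul_apply, Fin.sum_univ_four]
    · have k : HasFDerivAt (fun V => magDensity V 2) _ U := (h1.mul ((hp 0).add (hp 1)))
      refine (congrArg (fun T => T (Pi.single j 1)) k.fderiv).trans ?_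
      fin_cases j <;> simp [magMultiplier, magA, Matrix.mul_apply, Fin.sum_univ_four] <;> ring
    · have k : HasFDerivAt (fun V => magDensity V 3) _ U := h3
      refine (congrArg (fun T => T (Pi.single j 1)) k.fderiv).trans ?_
      fin_cases j <;> simp [magMultiplier, magA, Matrix.mul_apply, Fin.sum_univ_four] <;> ring
  exact key

lemma jac_magFlux (U : State) : jac magFlux U = magMultiplier U * magB U := by
  ext i j
  refine (pd_apply ((contDiff_magFlux.differentiable (by simp)) U) j i).symm.trans ?_
  have hp : ∀ i : Fin 4, HasFDerivAt (fun V : State => V i)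
      (ContinuousLinearMap.proj (R := ℝ) i) U := fun i => hasFDerivAt_apply i U
  have h1 := (hp 0).mul (hp 3)
  have h3 := (h1.mul (((((hp 1).pow 2).sub (((hp 0).const_mul 2).mul (hp 1))).add
    (((hp 0).pow 2).const_mul 2)).add ((hp 0).mul (((hp 2).pow 2).add ((hp 3).pow 2))))).neg
  have key : fderiv ℝ (fun V => magFlux V i) U (Pi.single j 1) = (magMultiplier U * magB U) i j := by
    fin_cases i
    · have k : HasFDerivAt (fun V => magFlux V 0) _ U := hp 3
      refine (congrArg (fun T => T (Pi.single j 1)) k.fderiv).trans ?_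
      fin_cases j <;> simp [magMultiplier, magB, Matrix.mul_apply, Fin.sum_univ_four]
    · have k : HasFDerivAt (fun V => magFlux V 1) _ U := h1.neg
      refine (congrArg (fun T => T (Pi.single j 1)) k.fderiv).trans ?_
      fin_cases j <;> simp [magMultiplier, magB, Matrix.mul_apply, Fin.sum_univ_four]
    · have k : HasFDerivAt (fun V => magFlux V 2) _ U := (h1.mul ((hp 0).sub (hp 1)))
      refine (congrArg (fun T => T (Pi.single j 1)) k.fderiv).trans ?_
      fin_cases j <;> simp [magMultiplier, magB, Matrix.mul_apply, Fin.sum_univ_four] <;> ring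
    · have k : HasFDerivAt (fun V => magFlux V 3) _ U := h3
      refine (congrArg (fun T => T (Pi.single j 1)) k.fderiv).trans ?_
      fin_cases j <;> simp [magMultiplier, magB, Matrix.mul_apply, Fin.sum_univ_four] <;> ring
  exact key

/-- As the densities and fluxes share the multiplier Z, R' = ZB = (ZA) A⁻¹B = Q' A⁻¹B. The densities
are coordinates because det Z = -4Λ³fg, which is non-zero in the hyperbolic region. -/
theorem hasConservationFormNear_of_hyperbolic {U : State}
    (h : IsStrictlyHyperbolicAt magA magB U) : HasConservationFormNear magA magB U := by
  obtain ⟨hL, hf, hg, -⟩ := h.exists_roots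
  refine ⟨{W | 0 < W 0 ∧ W 2 ≠ 0 ∧ W 3 ≠ 0}, ?_, ⟨hL, hf, hg⟩, magDensity, magFlux,
    contDiff_magDensity.contDiffOn, contDiff_magFlux.contDiffOn, ?_⟩
  · exact (isOpen_lt continuous_const (continuous_apply 0)).inter
      ((isOpen_ne_fun (continuous_apply 2) continuous_const).inter
        (isOpen_ne_fun (continuous_apply 3) continuous_const))
  rintro W ⟨hL, hf, hg⟩
  have hA : (magA W).det ≠ 0 := by
    rw [det_magA]
    exact neg_ne_zero.2 (div_ne_zero (pow_ne_zero 2 hf) two_ne_zero)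
  refine ⟨hA, ?_, ?_⟩
  · have hZ : (magMultiplier W).det = -(4 * W 0 ^ 3 * W 2 * W 3) := by
      simp [magMultiplier, Matrix.det_succ_row_zero, Fin.sum_univ_succ, Fin.succAbove]
      ring
    rw [jac_magDensity, Matrix.det_mul, hZ]
    have := hL.ne'
    exact mul_ne_zero (by simp [*]) hA
  · rw [jac_magDensity, jac_magFlux, Matrix.mul_assoc,
      Matrix.mul_nonsing_inv_cancel_left _ _ hA.isUnit]

theorem isSemiHamiltonian_mag : IsSemiHamiltonian magA magB := fun _ h =>
  ⟨hasRiemannInvariantsNear_of_hyperbolic h, hasConservationFormNear_of_hyperbolic h⟩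

/-- With f = g = 1 the quartic is reciprocal, and Λ = 45/64 is chosen to make 2 a root; it then
splits into x² - 5x/2 + 1 and x² + 9x/2 + 1. Differentiating it along the eigenvector for λ = 2 with
a stationary λ would give 180 = 0. -/
theorem not_isLinearlyDegenerate_mag : ¬ IsLinearlyDegenerate magA magB := by
  intro h
  set U : State := ![45 / 64, 0, 1, 1] with hU
  have e0 : U 0 = 45 / 64 := rfl
  have e2 : U 2 = 1 := rfl
  have e3 : U 3 = 1 := rfl
  have hs : √65 ^ 2 = 65 := Real.sq_sqrt (by norm_num)
  have hs8 : (8 : ℝ) < √65 := by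
    rw [Real.lt_sqrt] <;> norm_num
  have hs9 : √65 < (9 : ℝ) := by
    rw [Real.sqrt_lt'] <;> norm_num
  have hquad : ∀ x : ℝ, x ^ 2 + 9 / 2 * x + 1 = 0 →
      16 * (45 / 64) * x ^ 2 - (x + 1) ^ 2 * (1 + x ^ 2) = 0 :=
    fun x hx => by linear_combination (-(x ^ 2 - 5 / 2 * x + 1)) * hx
  have hyp : IsStrictlyHyperbolicAt magA magB U := by
    refine ⟨by rw [det_magA, e2]; norm_num, ![2, 1 / 2, (-9 + √65) / 4, (-9 - √65) / 4], ?_, ?_⟩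
    · intro i j hij
      fin_cases i <;> fin_cases j <;> simp at hij ⊢ <;> linarith
    · intro i
      rw [det_magB_sub, e0, e2, e3]
      fin_cases i <;> simp
      · norm_num
      · norm_num
      · exact hquad _ (by linear_combination hs / 16)
      · exact hquad _ (by linear_combination hs / 16)
  let G : State × ℝ → ℝ := fun p =>
    (p.1 2 * p.2 + p.1 3) ^ 2 * (1 + p.2 ^ 2) - 16 * p.1 0 * p.2 ^ 2
  have hG : ContDiff ℝ ω G := by fun_prop
  have hd : HasDerivAt (fun x => G (U, x)) 21 2 := by
    simp only [G, e0, e2, e3]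
    have hx := hasDerivAt_id (2 : ℝ)
    refine HasDerivAt.congr_deriv (((((hx.const_mul 1).add_const 1).pow 2).mul
      ((hx.pow 2).const_add 1)).sub ((hx.pow 2).const_mul (16 * (45 / 64)))) ?_
    norm_num
  obtain ⟨lam, han, hval, hroot⟩ := exists_analytic_implicit (x := 2)
    (hG.contDiffAt.analyticAt) (by simp only [G, e0, e2, e3]; norm_num) hd (by norm_num)
  have hlam := h U hyp lam han.contDiffAt (by
    filter_upwards [hroot] with W hW
    rw [det_magB_sub]
    simp only [G] at hW
    linarith) ![-15 / 16, 5 / 8, 1, 2] (by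
      rw [hval]
      ext i
      fin_cases i <;>
        simp [magA, magB, Matrix.mulVec, dotProduct, Fin.sum_univ_four, hU] <;> norm_num)
  have hp : ∀ i : Fin 4, HasFDerivAt (fun V : State => V i)
      (ContinuousLinearMap.proj (R := ℝ) i) U := fun i => hasFDerivAt_apply i U
  have hl := han.differentiableAt.hasFDerivAt
  have hcomp := (((((hp 2).mul hl).add (hp 3)).pow 2).mul ((hl.pow 2).const_add 1)).sub
    (((hp 0).const_mul 16).mul (hl.pow 2))
  have hzero := (hasFDerivAt_const (𝕜 := ℝ) (0 : ℝ) U).congr_of_eventuallyEq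
    (f₁ := fun W : State => G (W, lam W)) hroot
  have hv := congrArg (fun T : State →L[ℝ] ℝ => T ![-15 / 16, 5 / 8, 1, 2]) (hcomp.unique hzero)
  simp [hlam, hval, e0, e2, e3] at hv
  norm_num at hv

end

noncomputable section

/-! ### Cauchy estimates for the initial data -/

-- The power series is re-expanded at every y within r/2 of x. The coefficients of all these
-- expansions are dominated by one absolutely convergent sum, which supplies C, and the k-th
-- derivative is k! times the k-th coefficient.
open scoped NNReal ENNReal in
lemma AnalyticAt.exists_cauchy_estimate {L : ℝ → ℝ} {x : ℝ} (h : AnalyticAt ℝ L x) :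
    ∃ C A : ℝ, 0 ≤ C ∧ 0 ≤ A ∧ ∀ᶠ y in 𝓝 x, ∀ k : ℕ,
      ‖iteratedFDeriv ℝ k L y‖ ≤ C * A ^ k * k.factorial := by
  obtain ⟨p, R, hp⟩ := h
  obtain ⟨r, hr0, hr⟩ := ENNReal.lt_iff_exists_nnreal_btwn.1 hp.r_pos
  have hr0 : 0 < r := by exact_mod_cast hr0
  have h2 : ((r / 2 : ℝ≥0) + (r / 2 : ℝ≥0) : ℝ≥0∞) < p.radius := by
    rw [← ENNReal.coe_add, add_halves]
    exact hr.trans_le hp.r_le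
  have hs := p.changeOriginSeries_summable_aux₁ h2
  set ρ : ℝ≥0 := r / 2 with hρ
  have hρ0 : 0 < ρ := half_pos hr0
  set T : (Σ k l : ℕ, { s : Finset (Fin (k + l)) // s.card = l }) → ℝ≥0 :=
    fun s => ‖p (s.1 + s.2.1)‖₊ * ρ ^ s.2.1 * ρ ^ s.1 with hT
  refine ⟨(∑' s, T s : ℝ≥0), (ρ : ℝ)⁻¹, by positivity, by positivity, ?_⟩
  have hρr : (ρ : ℝ≥0∞) < p.radius := lt_of_le_of_lt le_self_add h2
  have hρR : (ρ : ℝ≥0∞) < R := lt_of_le_of_lt (by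
    rw [hρ]; exact_mod_cast half_le_self zero_le) hr
  filter_upwards [Metric.ball_mem_nhds x (NNReal.coe_pos.2 hρ0)] with y hy k
  have hy' : ‖y - x‖₊ < ρ := by simpa [dist_eq_norm, ← NNReal.coe_lt_coe] using hy
  have hyR : (‖y - x‖₊ : ℝ≥0∞) < R := (ENNReal.coe_lt_coe.2 hy').trans hρR
  have hy1 := hp.changeOrigin hyR
  rw [add_sub_cancel] at hy1
  have hcoef : ‖p.changeOrigin (y - x) k‖₊ * ρ ^ k ≤ ∑' s, T s := by
    have h1 := p.nnnorm_changeOrigin_le k ((ENNReal.coe_lt_coe.2 hy').trans hρr)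
    have hsk' := p.changeOriginSeries_summable_aux₂ hρr k
    calc ‖p.changeOrigin (y - x) k‖₊ * ρ ^ k
        ≤ (∑' s : Σ l : ℕ, { s : Finset (Fin (k + l)) // s.card = l },
            ‖p (k + s.1)‖₊ * ρ ^ s.1) * ρ ^ k := by
          gcongr
          refine h1.trans (Summable.tsum_le_tsum (fun s => ?_) ?_ hsk')
          · gcongr
          · exact NNReal.summable_of_le (fun s => by gcongr) hsk'
      _ = ∑' s : Σ l : ℕ, { s : Finset (Fin (k + l)) // s.card = l }, T ⟨k, s⟩ := by
          exact (NNReal.tsum_mul_right _ _).symm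
      _ ≤ ∑' s, T s := by
          rw [hs.tsum_sigma' (NNReal.summable_sigma.1 hs).1]
          exact (NNReal.summable_sigma.1 hs).2.le_tsum k (fun _ _ => zero_le)
  have hf := hy1.factorial_smul 1 k
  have hnorm : ‖iteratedFDeriv ℝ k L y‖ ≤ k.factorial * ‖p.changeOrigin (y - x) k‖ := by
    rw [norm_iteratedFDeriv_eq_norm_iteratedDeriv, iteratedDeriv_eq_iteratedFDeriv, ← hf,
      nsmul_eq_mul, norm_mul, Real.norm_natCast]
    gcongr
    simp
  have hcoef' : ‖p.changeOrigin (y - x) k‖ * (ρ : ℝ) ^ k ≤ (∑' s, T s : ℝ≥0) := by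
    exact_mod_cast hcoef
  have hρk : (0 : ℝ) < (ρ : ℝ) ^ k := by positivity
  calc ‖iteratedFDeriv ℝ k L y‖ ≤ k.factorial * ‖p.changeOrigin (y - x) k‖ := hnorm
    _ ≤ k.factorial * ((∑' s, T s : ℝ≥0) / (ρ : ℝ) ^ k) := by
        gcongr
        rwa [le_div_iff₀ hρk]
    _ = _ := by rw [inv_pow]; ring

/-- Compactness of a period makes the local estimates uniform, and periodicity spreads them over the
line. This is what yields a time of existence independent of the point. -/
lemma exists_uniform_cauchy_estimate {L : ℝ → ℝ} (h : AnalyticOnNhd ℝ L Set.univ)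
    (hper : ∀ s, L (s + 1) = L s) :
    ∃ C A : ℝ, 0 ≤ C ∧ 0 ≤ A ∧ ∀ k y, ‖iteratedFDeriv ℝ k L y‖ ≤ C * A ^ k * k.factorial := by
  have key : ∃ C A : ℝ, 0 ≤ C ∧ 0 ≤ A ∧ ∀ y ∈ Set.Icc (0 : ℝ) 1, ∀ k,
      ‖iteratedFDeriv ℝ k L y‖ ≤ C * A ^ k * k.factorial := by
    refine isCompact_Icc.induction_on ⟨0, 0, le_rfl, le_rfl, by simp⟩ ?_ ?_ ?_
    · rintro s t hst ⟨C, A, hC, hA, hb⟩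
      exact ⟨C, A, hC, hA, fun y hy => hb y (hst hy)⟩
    · rintro s t ⟨C, A, hC, hA, hb⟩ ⟨C', A', hC', hA', hb'⟩
      refine ⟨max C C', max A A', le_max_of_le_left hC, le_max_of_le_left hA, ?_⟩
      rintro y (hy | hy) k
      · exact (hb y hy k).trans (by gcongr <;> exact le_max_left _ _)
      · exact (hb' y hy k).trans (by gcongr <;> exact le_max_right _ _)
    · intro x _
      obtain ⟨C, A, hC, hA, hb⟩ := (h x (Set.mem_univ x)).exists_cauchy_estimate
      exact ⟨_, mem_nhdsWithin_of_mem_nhds hb, C, A, hC, hA, fun y hy => hy⟩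
  obtain ⟨C, A, hC, hA, hb⟩ := key
  refine ⟨C, A, hC, hA, fun k y => ?_⟩
  have hp : Function.Periodic (iteratedFDeriv ℝ k L) 1 := by
    intro y
    rw [← iteratedFDeriv_comp_add_right k (1 : ℝ) y]
    simp only [hper]
  obtain ⟨z, hz, hzy⟩ := hp.exists_mem_Ico₀ one_pos y
  rw [hzy]
  exact hb z (Set.Ico_subset_Icc_self hz) k

lemma liouvilleState_eq (L₁ L₂ : ℝ → ℝ) : liouvilleState L₁ L₂ = fun q : Plane =>
    ContinuousLinearMap.toSpanSingleton ℝ (![1, -2, 0, 0] : State)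
      (L₁ (ContinuousLinearMap.proj (R := ℝ) (φ := fun _ : Fin 2 => ℝ) 0 q)) +
    ContinuousLinearMap.toSpanSingleton ℝ (![1, 2, 0, 0] : State)
      (L₂ (ContinuousLinearMap.proj (R := ℝ) (φ := fun _ : Fin 2 => ℝ) 1 q)) := by
  funext q i
  fin_cases i <;> simp [liouvilleState]; ring

lemma norm_iteratedFDeriv_comp_linear_le {L : ℝ → ℝ} (hL : ContDiff ℝ ∞ L) (ℓ : Plane →L[ℝ] ℝ)
    (w : ℝ →L[ℝ] State) (hl : ‖ℓ‖ ≤ 1) (k : ℕ) (q : Plane) :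
    ‖iteratedFDeriv ℝ k (fun q => w (L (ℓ q))) q‖ ≤ ‖w‖ * ‖iteratedFDeriv ℝ k L (ℓ q)‖ := by
  have hk : ((k : ℕ∞) : WithTop ℕ∞) ≤ ∞ := by exact_mod_cast le_top
  have h1 := w.norm_iteratedFDeriv_comp_left (f := fun q => L (ℓ q)) (x := q) (N := ∞)
    ((hL.comp ℓ.contDiff).contDiffAt) hk
  refine h1.trans ?_
  gcongr
  have h2 := ℓ.iteratedFDeriv_comp_right hL q hk
  rw [show (fun q => L (ℓ q)) = L ∘ ℓ from rfl, h2]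
  refine (ContinuousMultilinearMap.norm_compContinuousLinearMap_le _ _).trans ?_
  refine mul_le_of_le_one_right (norm_nonneg _) ?_
  exact Finset.prod_le_one (fun _ _ => norm_nonneg _) fun _ _ => hl

lemma exists_cauchy_estimate_liouvilleState {L₁ L₂ : ℝ → ℝ} (h₁ : AnalyticOnNhd ℝ L₁ Set.univ)
    (h₂ : AnalyticOnNhd ℝ L₂ Set.univ) (p₁ : ∀ s, L₁ (s + 1) = L₁ s) (p₂ : ∀ s, L₂ (s + 1) = L₂ s) :
    ∃ C A : ℝ, 0 ≤ C ∧ 0 ≤ A ∧ ∀ k q,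
      ‖iteratedFDeriv ℝ k (liouvilleState L₁ L₂) q‖ ≤ C * A ^ k * k.factorial := by
  obtain ⟨C, A, hC, hA, hb⟩ := exists_uniform_cauchy_estimate h₁ p₁
  obtain ⟨C', A', hC', hA', hb'⟩ := exists_uniform_cauchy_estimate h₂ p₂
  have c₁ : ContDiff ℝ ∞ L₁ := h₁.contDiff
  have c₂ : ContDiff ℝ ∞ L₂ := h₂.contDiff
  set w₁ := ContinuousLinearMap.toSpanSingleton ℝ (![1, -2, 0, 0] : State)
  set w₂ := ContinuousLinearMap.toSpanSingleton ℝ (![1, 2, 0, 0] : State)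
  have hproj : ∀ i : Fin 2, ‖ContinuousLinearMap.proj (R := ℝ) (φ := fun _ : Fin 2 => ℝ) i‖ ≤ 1 :=
    fun i => ContinuousLinearMap.opNorm_le_bound _ zero_le_one fun x => by
      simpa using norm_le_pi_norm x i
  refine ⟨‖w₁‖ * C + ‖w₂‖ * C', max A A', by positivity, le_max_of_le_left hA, fun k q => ?_⟩
  have hk : ((k : ℕ∞) : WithTop ℕ∞) ≤ ∞ := by exact_mod_cast le_top
  have a₁ : ContDiff ℝ k fun q : Plane =>
      w₁ (L₁ (ContinuousLinearMap.proj (R := ℝ) (φ := fun _ : Fin 2 => ℝ) 0 q)) :=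
    (w₁.contDiff.comp (c₁.comp (ContinuousLinearMap.contDiff _))).of_le hk
  have a₂ : ContDiff ℝ k fun q : Plane =>
      w₂ (L₂ (ContinuousLinearMap.proj (R := ℝ) (φ := fun _ : Fin 2 => ℝ) 1 q)) :=
    (w₂.contDiff.comp (c₂.comp (ContinuousLinearMap.contDiff _))).of_le hk
  rw [liouvilleState_eq, fun_iteratedFDeriv_add_apply a₁.contDiffAt a₂.contDiffAt]
  refine (norm_add_le _ _).trans ?_
  have e₁ := norm_iteratedFDeriv_comp_linear_le c₁ _ w₁ (hproj 0) k q
  have e₂ := norm_iteratedFDeriv_comp_linear_le c₂ _ w₂ (hproj 1) k q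
  have m₁ : ‖w₁‖ * ‖iteratedFDeriv ℝ k L₁ (q 0)‖ ≤ ‖w₁‖ * (C * max A A' ^ k * k.factorial) := by
    gcongr
    exact (hb k _).trans (by gcongr; exact le_max_left _ _)
  have m₂ : ‖w₂‖ * ‖iteratedFDeriv ℝ k L₂ (q 1)‖ ≤ ‖w₂‖ * (C' * max A A' ^ k * k.factorial) := by
    gcongr
    exact (hb' k _).trans (by gcongr; exact le_max_right _ _)
  calc _ ≤ _ := add_le_add (e₁.trans m₁) (e₂.trans m₂)
    _ = _ := by ring

/-! ### The symmetry as an abstract evolution equation -/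

/-- The quadratic part of the symmetry. -/
def symQuadratic : State →L[ℝ] (Plane →L[ℝ] State) →L[ℝ] State :=
  LinearMap.toContinuousLinearMap
    { toFun := fun U =>
        (Matrix.toLin' (symA U - symA 0)).toContinuousLinearMap ∘L
          ContinuousLinearMap.apply ℝ State (Pi.single 0 1 : Plane) +
        (Matrix.toLin' (symB U - symB 0)).toContinuousLinearMap ∘L
          ContinuousLinearMap.apply ℝ State (Pi.single 1 1 : Plane)
      map_add' := fun U V => by
        ext T i
        fin_cases i <;>
          simp [symA, symB, dotProduct, Fin.sum_univ_four] <;> ring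
      map_smul' := fun c U => by
        ext T i
        fin_cases i <;>
          simp [symA, symB, dotProduct, Fin.sum_univ_four] <;> ring }

/-- The linear part of the symmetry. -/
def symLinear : (Plane →L[ℝ] State) →L[ℝ] State :=
  LinearMap.toContinuousLinearMap
    { toFun := fun T => symA 0 *ᵥ T (Pi.single 0 1) + symB 0 *ᵥ T (Pi.single 1 1)
      map_add' := fun S T => by
        simp only [add_apply, Matrix.mulVec_add]
        abel
      map_smul' := fun c T => by
        simp only [smul_apply, Matrix.mulVec_smul, smul_add, RingHom.id_apply] }

/-- The matrices `symA` and `symB` are affine in U. Subtracting their values at 0 isolates the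
bilinear part and brings (E) to the form treated by `exists_analytic_solution`. -/
lemma symQuadratic_add_symLinear (U : State) (T : Plane →L[ℝ] State) :
    symQuadratic U T + symLinear T =
      symA U *ᵥ T (Pi.single 0 1) + symB U *ᵥ T (Pi.single 1 1) := by
  simp only [symQuadratic, symLinear, LinearMap.coe_toContinuousLinearMap', LinearMap.coe_mk,
    AddHom.coe_mk, add_apply, ContinuousLinearMap.comp_apply, ContinuousLinearMap.apply_apply,
    Matrix.toLin'_apply, Matrix.sub_mulVec]
  abel

/-! ### Periodic functions of one variable -/

lemma deriv_add_period {L : ℝ → ℝ} (hper : ∀ s, L (s + 1) = L s) (s : ℝ) :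
    deriv L (s + 1) = deriv L s := by
  rw [← deriv_comp_add_const]
  simp only [hper]

lemma eq_of_deriv_deriv_eq_zero {L : ℝ → ℝ} (h : AnalyticOnNhd ℝ L Set.univ)
    (hper : ∀ s, L (s + 1) = L s) (h2 : ∀ s, deriv (deriv L) s = 0) (s s' : ℝ) : L s = L s' := by
  have hd : Differentiable ℝ L := fun x => (h x (Set.mem_univ x)).differentiableAt
  have hd' : Differentiable ℝ (deriv L) := fun x => (h.deriv x (Set.mem_univ x)).differentiableAt
  obtain ⟨ξ, -, hξ⟩ := exists_deriv_eq_zero (f := L) zero_lt_one hd.continuous.continuousOn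
    (by simpa using (hper 0).symm)
  exact is_const_of_deriv_eq_zero hd
    (fun x => (is_const_of_deriv_eq_zero hd' h2 x ξ).trans hξ) s s'

/-- P = L'L'' has derivative L''² + c L'² ≥ 0. A monotone periodic function is constant, so L'' ≡ 0.
-/
lemma eq_of_deriv_deriv_deriv_eq_mul {L : ℝ → ℝ} (h : AnalyticOnNhd ℝ L Set.univ)
    (hper : ∀ s, L (s + 1) = L s) {c : ℝ} (hc : 0 ≤ c)
    (h3 : ∀ s, deriv (deriv (deriv L)) s = c * deriv L s) (s s' : ℝ) : L s = L s' := by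
  have d1 : ∀ x, HasDerivAt (deriv L) (deriv (deriv L) x) x := fun x =>
    (h.deriv x (Set.mem_univ x)).differentiableAt.hasDerivAt
  have d2 : ∀ x, HasDerivAt (deriv (deriv L)) (c * deriv L x) x := fun x =>
    h3 x ▸ (h.deriv.deriv x (Set.mem_univ x)).differentiableAt.hasDerivAt
  have hP := fun x => (d1 x).mul (d2 x)
  set P := deriv L * deriv (deriv L) with hPdef
  have hmono : Monotone P := monotone_of_hasDerivAt_nonneg hP fun x => by
    have : 0 ≤ deriv (deriv L) x * deriv (deriv L) x + c * (deriv L x * deriv L x) :=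
      add_nonneg (mul_self_nonneg _) (mul_nonneg hc (mul_self_nonneg _))
    simpa [mul_left_comm] using this
  have hPper : ∀ s, P (s + 1) = P s := fun s => by
    simp only [hPdef, Pi.mul_apply, deriv_add_period hper, deriv_add_period (deriv_add_period hper)]
  refine eq_of_deriv_deriv_eq_zero h hper (fun x => ?_) s s'
  have hconst : P =ᶠ[𝓝 x] fun _ => P x := by
    filter_upwards [Ioo_mem_nhds (sub_one_lt x) (lt_add_one x)] with y hy
    have e1 := hPper (x - 1)
    rw [sub_add_cancel] at e1
    rcases le_total x y with hxy | hxy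
    · exact le_antisymm ((hmono hy.2.le).trans_eq (hPper x)) (hmono hxy)
    · exact le_antisymm (hmono hxy) (e1.trans_le (hmono hy.1.le))
  have h0 := (hP x).unique ((hasDerivAt_const x (P x)).congr_of_eventuallyEq hconst)
  have h1 : 0 ≤ c * (deriv L x * deriv L x) := mul_nonneg hc (mul_self_nonneg _)
  have h2 : deriv (deriv L) x ^ 2 ≤ 0 := by nlinarith
  exact pow_eq_zero_iff two_ne_zero |>.1 (le_antisymm h2 (sq_nonneg _))

lemma exists_deriv_deriv_ne {L₁ L₂ : ℝ → ℝ} (h₁ : AnalyticOnNhd ℝ L₁ Set.univ)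
    (p₁ : ∀ s, L₁ (s + 1) = L₁ s) (n₁ : ∃ s s', L₁ s ≠ L₁ s') :
    ∃ x y, deriv (deriv L₁) x ≠ deriv (deriv L₂) y := by
  by_contra! hcon
  obtain ⟨ξ, -, hξ⟩ := exists_deriv_eq_zero (f := deriv L₁) zero_lt_one
    (fun x _ => (h₁.deriv x (Set.mem_univ x)).continuousAt.continuousWithinAt)
    (by simpa using (deriv_add_period p₁ 0).symm)
  obtain ⟨s, s', hs⟩ := n₁
  exact hs (eq_of_deriv_deriv_eq_zero h₁ p₁
    (fun x => (hcon x 0).trans ((hcon ξ 0).symm.trans hξ)) s s')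

/-- Otherwise the variables separate: L₁''' = c L₁' and L₂''' = -c L₂'. One of c, -c is
non-negative, which makes the corresponding periodic function constant. -/
lemma exists_third_derivatives_ne_zero {L₁ L₂ : ℝ → ℝ} (h₁ : AnalyticOnNhd ℝ L₁ Set.univ)
    (h₂ : AnalyticOnNhd ℝ L₂ Set.univ) (p₁ : ∀ s, L₁ (s + 1) = L₁ s) (p₂ : ∀ s, L₂ (s + 1) = L₂ s)
    (n₁ : ∃ s s', L₁ s ≠ L₁ s') (n₂ : ∃ s s', L₂ s ≠ L₂ s') :
    ∃ x y, deriv (deriv (deriv L₁)) x * deriv L₂ y + deriv L₁ x * deriv (deriv (deriv L₂)) y ≠ 0 := by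
  by_contra! hcon
  have hex : ∀ {L : ℝ → ℝ}, AnalyticOnNhd ℝ L Set.univ → (∃ s s', L s ≠ L s') →
      ∃ x, deriv L x ≠ 0 := by
    rintro L h ⟨s, s', hs⟩
    by_contra! h0
    exact hs (is_const_of_deriv_eq_zero (fun x => (h x (Set.mem_univ x)).differentiableAt) h0 s s')
  obtain ⟨x₀, hx₀⟩ := hex h₁ n₁
  obtain ⟨y₀, hy₀⟩ := hex h₂ n₂
  set c := -(deriv (deriv (deriv L₂)) y₀ / deriv L₂ y₀) with hc
  have e₁ : ∀ x, deriv (deriv (deriv L₁)) x = c * deriv L₁ x := by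
    intro x
    have := hcon x y₀
    rw [hc]
    field_simp
    linear_combination this
  have e₂ : ∀ y, deriv (deriv (deriv L₂)) y = -c * deriv L₂ y := by
    intro y
    have := hcon x₀ y
    rw [e₁] at this
    exact mul_left_cancel₀ hx₀ (by linear_combination this)
  rcases le_total 0 c with h0 | h0
  · obtain ⟨s, s', hs⟩ := n₁
    exact hs (eq_of_deriv_deriv_deriv_eq_mul h₁ p₁ h0 e₁ s s')
  · obtain ⟨s, s', hs⟩ := n₂
    exact hs (eq_of_deriv_deriv_deriv_eq_mul h₂ p₂ (neg_nonneg.2 h0) e₂ s s')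

end

noncomputable section

/-! ### Restrictions of functions on space-time -/

section Slices

variable {Y : ℝ × Plane → ℝ} {t x y : ℝ} {q : Plane}

lemma dirDeriv_slice (h : DifferentiableAt ℝ Y (t, q)) (v : Plane) :
    dirDeriv v (fun q => Y (t, q)) q = dirDeriv (0, v) Y (t, q) := by
  have := h.hasFDerivAt.comp q (hasFDerivAt_prodMk_right t q)
  rw [dirDeriv, show (fun q => Y (t, q)) = Y ∘ fun q => (t, q) from rfl, this.fderiv]
  rfl

lemma hasDerivAt_dT (h : DifferentiableAt ℝ Y (t, q)) :
    HasDerivAt (fun s => Y (s, q)) (dT Y (t, q)) t :=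
  h.hasFDerivAt.comp_hasDerivAt t ((hasDerivAt_id t).prodMk (hasDerivAt_const t q))

lemma hasDerivAt_dX (h : DifferentiableAt ℝ Y (t, ![x, y])) :
    HasDerivAt (fun s => Y (t, ![s, y])) (dX Y (t, ![x, y])) x := by
  have h1 : HasDerivAt (fun s : ℝ => (![s, y] : Plane)) (Pi.single 0 1) x := by
    refine hasDerivAt_pi.2 fun i => ?_
    fin_cases i
    · simpa using hasDerivAt_id' x
    · simpa using hasDerivAt_const x y
  exact h.hasFDerivAt.comp_hasDerivAt x ((hasDerivAt_const x t).prodMk h1)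

lemma hasDerivAt_dY (h : DifferentiableAt ℝ Y (t, ![x, y])) :
    HasDerivAt (fun s => Y (t, ![x, s])) (dY Y (t, ![x, y])) y := by
  have h1 : HasDerivAt (fun s : ℝ => (![x, s] : Plane)) (Pi.single 1 1) y := by
    refine hasDerivAt_pi.2 fun i => ?_
    fin_cases i
    · simpa using hasDerivAt_const y x
    · simpa using hasDerivAt_id' y
  exact h.hasFDerivAt.comp_hasDerivAt y ((hasDerivAt_const y t).prodMk h1)

/-- In t the function is analytic, so near 0 it is either identically zero or zero at most at t = 0;
a non-zero time derivative excludes the former. Hence conclusions hold for all small t ≠ 0, not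
merely for some. -/
lemma eventually_ne_zero_of_dT {ε : ℝ} (hε : 0 < ε) (hY : AnalyticOnNhd ℝ Y (slab Plane ε))
    (h : dT Y (0, q) ≠ 0 ∨ dT (dT Y) (0, q) ≠ 0) : ∀ᶠ t in 𝓝[≠] 0, Y (t, q) ≠ 0 := by
  have hmem : ∀ᶠ t : ℝ in 𝓝 0, (t, q) ∈ slab Plane ε := by
    filter_upwards [Metric.ball_mem_nhds (0 : ℝ) hε] with t ht
    simpa [slab] using ht
  have han : AnalyticAt ℝ (fun t => Y (t, q)) 0 :=
    AnalyticAt.fun_comp (f := fun t : ℝ => (t, q)) (hY (0, q) hmem.self_of_nhds)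
      (analyticAt_id.prod analyticAt_const)
  refine han.eventually_eq_zero_or_eventually_ne_zero.resolve_left fun h0 => ?_
  have key : ∀ {Z : ℝ × Plane → ℝ}, AnalyticOnNhd ℝ Z (slab Plane ε) →
      (∀ᶠ t in 𝓝 0, Z (t, q) = 0) → ∀ᶠ t in 𝓝 0, dT Z (t, q) = 0 := by
    intro Z hZ hz
    filter_upwards [hz.eventually_nhds, hmem] with t ht hs
    exact (hasDerivAt_dT (hZ _ hs).differentiableAt).unique
      ((hasDerivAt_const t (0 : ℝ)).congr_of_eventuallyEq ht)
  have h1 := key hY h0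
  have h2 := key (hY.dirDeriv _) h1
  exact h.elim (fun h => h h1.self_of_nhds) fun h => h h2.self_of_nhds

lemma dT_dT_dX_dY {ε : ℝ} (hY : AnalyticOnNhd ℝ Y (slab Plane ε)) :
    Set.EqOn (dT (dT (dX (dY Y)))) (dX (dY (dT (dT Y)))) (slab Plane ε) := by
  have ho := isOpen_slab (P := Plane) ε
  have c : ∀ {Z : ℝ × Plane → ℝ}, AnalyticOnNhd ℝ Z (slab Plane ε) → ∀ v w,
      Set.EqOn (dirDeriv v (dirDeriv w Z)) (dirDeriv w (dirDeriv v Z)) (slab Plane ε) :=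
    fun hZ v w z hz => dirDeriv_comm (hZ z hz) v w
  have e1 : Set.EqOn (dT (dX (dY Y))) (dX (dY (dT Y))) (slab Plane ε) :=
    (c (hY.dirDeriv _) _ _).trans (dirDeriv_congr ho (c hY _ _) _)
  have e2 : Set.EqOn (dT (dX (dY (dT Y)))) (dX (dY (dT (dT Y)))) (slab Plane ε) :=
    (c ((hY.dirDeriv _).dirDeriv _) _ _).trans (dirDeriv_congr ho (c (hY.dirDeriv _) _ _) _)
  exact (dirDeriv_congr ho e1 _).trans e2

end Slices

/-! ### Components of the symmetry flow -/

namespace IsSymmetryFlow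

variable {ε : ℝ} {U₀ : Plane → State} {U : ℝ → Plane → State}

lemma analyticOnNhd_component (h : IsSymmetryFlow ε U₀ U) (k : Fin 4) :
    AnalyticOnNhd ℝ (fun z : ℝ × Plane => U z.1 z.2 k) (slab Plane ε) := fun z hz =>
  analyticAt_pi_iff.1 (h.1 z hz) k

lemma analyticOnNhd_slice (h : IsSymmetryFlow ε U₀ U) {t : ℝ} (ht : |t| < ε) :
    AnalyticOnNhd ℝ (U t) Set.univ := fun q _ =>
  AnalyticAt.fun_comp (f := fun q : Plane => (t, q)) (h.1 (t, q) ht)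
    (analyticAt_const.prod analyticAt_id)

lemma pd_eq (h : IsSymmetryFlow ε U₀ U) {t : ℝ} (ht : |t| < ε) (q : Plane) (i : Fin 2)
    (k : Fin 4) : pd i (fun q => U t q k) q =
      dirDeriv (0, Pi.single i 1) (fun z : ℝ × Plane => U z.1 z.2 k) (t, q) :=
  dirDeriv_slice (Y := fun z : ℝ × Plane => U z.1 z.2 k)
    (h.analyticOnNhd_component k (t, q) ht).differentiableAt _

theorem evolutionSolution (h : IsSymmetryFlow ε U₀ U) :
    EvolutionSolution ε (fun z => U z.1 z.2 0) (fun z => U z.1 z.2 1) (fun z => U z.1 z.2 2)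
      (fun z => U z.1 z.2 3) := by
  have key : ∀ z ∈ slab Plane ε, ∀ k, dT (fun z => U z.1 z.2 k) z =
      (symA (U z.1 z.2) *ᵥ pd 0 (U z.1) z.2 + symB (U z.1 z.2) *ᵥ pd 1 (U z.1) z.2) k := by
    rintro ⟨t, q⟩ hz k
    rw [← h.2.2 t hz q]
    have hd : ∀ k, HasDerivAt (fun s => U s q k) (dT (fun z => U z.1 z.2 k) (t, q)) t := fun k =>
      hasDerivAt_dT (Y := fun z : ℝ × Plane => U z.1 z.2 k)
        (h.analyticOnNhd_component k (t, q) hz).differentiableAt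
    exact (congrFun (hasDerivAt_pi.2 hd).deriv k).symm
  have hpd : ∀ z ∈ slab Plane ε, ∀ i k, pd i (U z.1) z.2 k =
      dirDeriv (0, Pi.single i 1) (fun z => U z.1 z.2 k) z := by
    rintro ⟨t, q⟩ hz i k
    exact (pd_apply (h.analyticOnNhd_slice hz q (Set.mem_univ q)).differentiableAt i k).symm.trans
      (h.pd_eq hz q i k)
  refine ⟨h.analyticOnNhd_component 0, h.analyticOnNhd_component 1, h.analyticOnNhd_component 2,
    h.analyticOnNhd_component 3, fun z hz => ?_, fun z hz => ?_, fun z hz => ?_, fun z hz => ?_⟩ <;>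
  · rw [key z hz]
    simp [symA, symB, dotProduct, Fin.sum_univ_four, hpd z hz]
    try ring

theorem eq_of_isSymmetryFlow (h : IsSymmetryFlow ε U₀ U) {δ : ℝ} (hδ : 0 < δ) (hδε : δ ≤ ε)
    {W : ℝ → Plane → State} (hW : IsSymmetryFlow δ U₀ W) {t : ℝ} (ht : |t| < δ) : W t = U t := by
  have h' : IsSymmetryFlow δ U₀ U :=
    ⟨h.1.mono fun z (hz : |z.1| < δ) => hz.trans_le hδε, h.2.1,
      fun t ht => h.2.2 t (ht.trans_le hδε)⟩
  have h0 : ∀ q k, W 0 q k = U 0 q k := fun q k => by rw [hW.2.1, h.2.1]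
  funext q k
  have := EvolutionSolution.unique hδ hW.evolutionSolution h'.evolutionSolution
    (fun q => h0 q 0) (fun q => h0 q 1) (fun q => h0 q 2) (fun q => h0 q 3) (t, q) ht
  obtain ⟨a, b, c, d⟩ := this
  fin_cases k
  exacts [a, b, c, d]

lemma magField_eq (h : IsSymmetryFlow ε U₀ U) {t : ℝ} (ht : |t| < ε) (q : Plane) :
    magField (U t) q = 1 / 4 * (dX (fun z => U z.1 z.2 3) (t, q) -
      dY (fun z => U z.1 z.2 2) (t, q)) := by
  rw [magField, h.pd_eq ht, h.pd_eq ht]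

end IsSymmetryFlow

/-! ### Taylor coefficients at a Liouville metric -/

section LiouvilleData

variable {ε : ℝ} {L u f g : ℝ × Plane → ℝ} {L₁ L₂ : ℝ → ℝ}

/-- An analytic solution of the evolution system whose initial value is a Liouville metric without
magnetic field. -/
structure HasLiouvilleData (ε : ℝ) (L u f g : ℝ × Plane → ℝ) (L₁ L₂ : ℝ → ℝ) : Prop where
  pos : 0 < ε
  sol : EvolutionSolution ε L u f g
  an₁ : AnalyticOnNhd ℝ L₁ Set.univ
  an₂ : AnalyticOnNhd ℝ L₂ Set.univ
  initL : ∀ x y, L (0, ![x, y]) = L₁ x + L₂ y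
  initu : ∀ x y, u (0, ![x, y]) = 2 * L₂ y - 2 * L₁ x
  initf : ∀ x y, f (0, ![x, y]) = 0
  initg : ∀ x y, g (0, ![x, y]) = 0

namespace HasLiouvilleData

lemma mem (h : HasLiouvilleData ε L u f g L₁ L₂) (q : Plane) : ((0 : ℝ), q) ∈ slab Plane ε := by
  simpa [slab] using h.pos

lemma dX_eq (h : HasLiouvilleData ε L u f g L₁ L₂) {Y : ℝ × Plane → ℝ}
    (hY : AnalyticOnNhd ℝ Y (slab Plane ε)) {x y : ℝ} {k : ℝ → ℝ} {d : ℝ}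
    (he : ∀ x, Y (0, ![x, y]) = k x) (hk : HasDerivAt k d x) : dX Y (0, ![x, y]) = d := by
  have := hasDerivAt_dX (hY _ (h.mem ![x, y])).differentiableAt
  rw [funext he] at this
  exact this.unique hk

lemma dY_eq (h : HasLiouvilleData ε L u f g L₁ L₂) {Y : ℝ × Plane → ℝ}
    (hY : AnalyticOnNhd ℝ Y (slab Plane ε)) {x y : ℝ} {k : ℝ → ℝ} {d : ℝ}
    (he : ∀ y, Y (0, ![x, y]) = k y) (hk : HasDerivAt k d y) : dY Y (0, ![x, y]) = d := by
  have := hasDerivAt_dY (hY _ (h.mem ![x, y])).differentiableAt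
  rw [funext he] at this
  exact this.unique hk

lemma first_derivatives (h : HasLiouvilleData ε L u f g L₁ L₂) (x y : ℝ) :
    dX L (0, ![x, y]) = deriv L₁ x ∧ dY L (0, ![x, y]) = deriv L₂ y ∧
    dX u (0, ![x, y]) = -2 * deriv L₁ x ∧ dY u (0, ![x, y]) = 2 * deriv L₂ y ∧
    dX f (0, ![x, y]) = 0 ∧ dY f (0, ![x, y]) = 0 ∧
    dX g (0, ![x, y]) = 0 ∧ dY g (0, ![x, y]) = 0 := by
  have d₁ := (h.an₁ x (Set.mem_univ x)).differentiableAt.hasDerivAt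
  have d₂ := (h.an₂ y (Set.mem_univ y)).differentiableAt.hasDerivAt
  refine ⟨h.dX_eq h.sol.anL (h.initL · y) (d₁.add_const _),
    h.dY_eq h.sol.anL (h.initL x) (d₂.const_add _),
    h.dX_eq h.sol.anu (h.initu · y) ?_,
    h.dY_eq h.sol.anu (h.initu x) ((d₂.const_mul 2).sub_const _),
    h.dX_eq h.sol.anf (h.initf · y) (hasDerivAt_const _ _),
    h.dY_eq h.sol.anf (h.initf x) (hasDerivAt_const _ _),
    h.dX_eq h.sol.ang (h.initg · y) (hasDerivAt_const _ _),
    h.dY_eq h.sol.ang (h.initg x) (hasDerivAt_const _ _)⟩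
  simpa using (d₁.const_mul 2).const_sub (2 * L₂ y)

lemma second_derivatives (h : HasLiouvilleData ε L u f g L₁ L₂) (x y : ℝ) :
    dX (dX L) (0, ![x, y]) = deriv (deriv L₁) x ∧
    dX (dX u) (0, ![x, y]) = -2 * deriv (deriv L₁) x ∧
    dY (dY u) (0, ![x, y]) = 2 * deriv (deriv L₂) y := by
  have d₁ := (h.an₁.deriv x (Set.mem_univ x)).differentiableAt.hasDerivAt
  have d₂ := (h.an₂.deriv y (Set.mem_univ y)).differentiableAt.hasDerivAt
  exact ⟨h.dX_eq (h.sol.anL.dirDeriv _) (fun x => (h.first_derivatives x y).1) d₁,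
    h.dX_eq (h.sol.anu.dirDeriv _) (fun x => (h.first_derivatives x y).2.2.1) (d₁.const_mul _),
    h.dY_eq (h.sol.anu.dirDeriv _) (fun y => (h.first_derivatives x y).2.2.2.1) (d₂.const_mul _)⟩

/-- With f = g = 0 the system reduces to 2Λ_x + (u₀)_x = 0 and 2Λ_y - (u₀)_y = 0, which the
Liouville data satisfy; vanishing then propagates in time. -/
lemma residuals_eq_zero (h : HasLiouvilleData ε L u f g L₁ L₂) {z : ℝ × Plane}
    (hz : z ∈ slab Plane ε) :
    res1 f g z = 0 ∧ res2 L f g z = 0 ∧ res3 L u f g z = 0 ∧ res4 L u f g z = 0 := by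
  have hq : ∀ q : Plane, q = ![q 0, q 1] := fun q => by ext i; fin_cases i <;> rfl
  refine h.sol.residuals_eq_zero h.pos (fun q => ?_) (fun q => ?_) (fun q => ?_) (fun q => ?_) hz <;>
  · rw [hq q]
    obtain ⟨a, b, c, d, e, i, j, k⟩ := h.first_derivatives (q 0) (q 1)
    simp only [res1, res2, res3, res4, a, b, c, d, e, i, j, k, h.initf, h.initg]
    ring

lemma dT_magField (h : HasLiouvilleData ε L u f g L₁ L₂) (x y : ℝ) :
    dT (fun z => dX g z - dY f z) (0, ![x, y]) =
      4 * (deriv (deriv L₁) x - deriv (deriv L₂) y) := by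
  have hm := h.mem ![x, y]
  have ho := isOpen_slab (P := Plane) ε
  obtain ⟨-, e1, e2⟩ := h.second_derivatives x y
  rw [dT, dirDeriv_sub (h.sol.ang.dirDeriv _ _ hm).differentiableAt
    (h.sol.anf.dirDeriv _ _ hm).differentiableAt, dirDeriv_comm (h.sol.ang _ hm),
    dirDeriv_comm (h.sol.anf _ hm), dirDeriv_congr ho h.sol.dTg _ hm,
    dirDeriv_congr ho h.sol.dTf _ hm,
    dirDeriv_const_mul _ (h.sol.anu.dirDeriv _ _ hm).differentiableAt,
    dirDeriv_const_mul _ (h.sol.anu.dirDeriv _ _ hm).differentiableAt]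
  linear_combination -2 * e1 - 2 * e2

/-- Since f = g = 0 at t = 0, Λ_t vanishes there and the deformation of Λ appears only at second
order, through g_t = 4L₁' and f_t = 4L₂'. -/
lemma dT_dT_conformalFactor (h : HasLiouvilleData ε L u f g L₁ L₂) (x y : ℝ) :
    dT (dT L) (0, ![x, y]) = 4 * (deriv L₁ x ^ 2 + deriv L₂ y ^ 2 +
      (L₁ x + L₂ y) * (deriv (deriv L₁) x + deriv (deriv L₂) y)) := by
  have hm := h.mem ![x, y]
  have ho := isOpen_slab (P := Plane) ε
  obtain ⟨a, b, c, d, e, i, j, k⟩ := h.first_derivatives x y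
  obtain ⟨-, e1, e2⟩ := h.second_derivatives x y
  have hL := h.sol.anL _ hm
  have hu := h.sol.anu _ hm
  have hf := h.sol.anf _ hm
  have hg := h.sol.ang _ hm
  have tg : dT (dX g) (0, ![x, y]) = -2 * dX (dX u) (0, ![x, y]) := by
    rw [dT, dirDeriv_comm hg, dirDeriv_congr ho h.sol.dTg _ hm,
      dirDeriv_const_mul _ (hu.dirDeriv _).differentiableAt]
  have tf : dT (dY f) (0, ![x, y]) = 2 * dY (dY u) (0, ![x, y]) := by
    rw [dT, dirDeriv_comm hf, dirDeriv_congr ho h.sol.dTf _ hm,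
      dirDeriv_const_mul _ (hu.dirDeriv _).differentiableAt]
  rw [dT, dirDeriv_congr ho h.sol.dTL _ hm]
  simp (disch := exact AnalyticAt.differentiableAt (by fun_prop)) only
    [dirDeriv_add, dirDeriv_mul]
  have sg := h.sol.dTg _ hm
  have sf := h.sol.dTf _ hm
  simp only [dT, dX, dY] at *
  rw [tg, tf, e1, e2, sg, sf, a, b, c, d, i, j, h.initL, h.initf, h.initg]
  ring

/-- Only the product (L₁ + L₂)(L₁'' + L₂'') in Λ_tt contributes to the mixed derivative, the squares
depending on one variable each. -/
lemma dT_dT_mixed (h : HasLiouvilleData ε L u f g L₁ L₂) (x y : ℝ) :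
    dT (dT (dX (dY L))) (0, ![x, y]) = 4 * (deriv (deriv (deriv L₁)) x * deriv L₂ y +
      deriv L₁ x * deriv (deriv (deriv L₂)) y) := by
  rw [dT_dT_dX_dY h.sol.anL (h.mem _)]
  have a : ∀ x, HasDerivAt L₁ (deriv L₁ x) x := fun x =>
    (h.an₁ x (Set.mem_univ x)).differentiableAt.hasDerivAt
  have a'' : ∀ x, HasDerivAt (deriv (deriv L₁)) (deriv (deriv (deriv L₁)) x) x := fun x =>
    (h.an₁.deriv.deriv x (Set.mem_univ x)).differentiableAt.hasDerivAt
  have b : ∀ x, HasDerivAt L₂ (deriv L₂ x) x := fun x =>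
    (h.an₂ x (Set.mem_univ x)).differentiableAt.hasDerivAt
  have b' : ∀ x, HasDerivAt (deriv L₂) (deriv (deriv L₂) x) x := fun x =>
    (h.an₂.deriv x (Set.mem_univ x)).differentiableAt.hasDerivAt
  have b'' : ∀ x, HasDerivAt (deriv (deriv L₂)) (deriv (deriv (deriv L₂)) x) x := fun x =>
    (h.an₂.deriv.deriv x (Set.mem_univ x)).differentiableAt.hasDerivAt
  have hZ := (h.sol.anL.dirDeriv (1, 0)).dirDeriv (1, 0)
  have hy : ∀ x, dY (dT (dT L)) (0, ![x, y]) = 4 * (2 * deriv L₂ y * deriv (deriv L₂) y +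
      (deriv L₂ y * (deriv (deriv L₁) x + deriv (deriv L₂) y) +
        (L₁ x + L₂ y) * deriv (deriv (deriv L₂)) y)) := fun x =>
    h.dY_eq hZ (h.dT_dT_conformalFactor x)
      ((((((b' y).pow 2).const_add _).add
        (((b y).const_add _).mul ((b'' y).const_add _))).const_mul 4).congr_deriv (by simp))
  refine h.dX_eq (hZ.dirDeriv _) hy ((((((((a'' x).add_const _).const_mul _).add
    (((a x).add_const _).mul_const _))).const_add _).const_mul 4).congr_deriv (by ring))

end HasLiouvilleData

end LiouvilleData

end

noncomputable section

/-! ### The deformation of a Liouville metric -/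

lemma norm_iteratedFDeriv_component_le {W : Plane → State} (hW : ContDiff ℝ ∞ W) (i : Fin 4)
    (k : ℕ) (q : Plane) :
    ‖iteratedFDeriv ℝ k (fun q => W q i) q‖ ≤ ‖iteratedFDeriv ℝ k W q‖ := by
  have hk : ((k : ℕ∞) : WithTop ℕ∞) ≤ ∞ := by exact_mod_cast le_top
  have h1 := (ContinuousLinearMap.proj (R := ℝ) (φ := fun _ : Fin 4 => ℝ)
    i).norm_iteratedFDeriv_comp_left (f := W) (x := q) (N := ∞) hW.contDiffAt hk
  refine h1.trans (mul_le_of_le_one_left (norm_nonneg _) ?_)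
  exact ContinuousLinearMap.opNorm_le_bound _ zero_le_one fun x => by
    simpa using norm_le_pi_norm x i

/-- The curl `¼ (g_x - f_y)` as a linear function of the derivative. -/
def curlMap : (Plane →L[ℝ] State) →L[ℝ] ℝ :=
  (1 / 4 : ℝ) • (ContinuousLinearMap.proj (R := ℝ) (φ := fun _ : Fin 4 => ℝ) 3 ∘L
      ContinuousLinearMap.apply ℝ State (Pi.single 0 1 : Plane) -
    ContinuousLinearMap.proj (R := ℝ) (φ := fun _ : Fin 4 => ℝ) 2 ∘L
      ContinuousLinearMap.apply ℝ State (Pi.single 1 1 : Plane))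

lemma magField_eq_curlMap {W : Plane → State} (hW : Differentiable ℝ W) (q : Plane) :
    magField W q = curlMap (fderiv ℝ W q) := by
  rw [magField, pd_apply (hW q), pd_apply (hW q)]
  rfl

lemma contDiff_liouvilleState {L₁ L₂ : ℝ → ℝ} (h₁ : AnalyticOnNhd ℝ L₁ Set.univ)
    (h₂ : AnalyticOnNhd ℝ L₂ Set.univ) : ContDiff ℝ ∞ (liouvilleState L₁ L₂) := by
  have c₁ : ContDiff ℝ ∞ L₁ := h₁.contDiff
  have c₂ : ContDiff ℝ ∞ L₂ := h₂.contDiff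
  rw [liouvilleState_eq]
  fun_prop

lemma magField_sub_liouvilleState {W : Plane → State} {L₁ L₂ : ℝ → ℝ} (hW : Differentiable ℝ W)
    (hu : Differentiable ℝ (liouvilleState L₁ L₂)) (q : Plane) :
    magField W q = curlMap (fderiv ℝ (fun q => W q - liouvilleState L₁ L₂ q) q) := by
  refine Eq.trans ?_ (magField_eq_curlMap (hW.sub hu) q)
  simp [magField, liouvilleState]

/-- Ω is linear in DU and vanishes on the Liouville state, so its derivatives of order j are
controlled by those of U - U₀ of order j + 1. -/
lemma ckClose_of_bounds {L₁ L₂ : ℝ → ℝ} {U : ℝ → Plane → State} {ε : ℝ} (hε : 0 < ε)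
    (hu : ContDiff ℝ ∞ (liouvilleState L₁ L₂)) (hU : ∀ t, |t| < ε → ContDiff ℝ ∞ (U t))
    (hb : ∀ k, ∃ M : ℝ, 0 < M ∧ ∀ t, |t| < ε → ∀ q,
      ‖iteratedFDeriv ℝ k (fun q => U t q - liouvilleState L₁ L₂ q) q‖ ≤ M * |t|)
    (k : ℕ) {δ : ℝ} (hδ : 0 < δ) : ∃ τ : ℝ, 0 < τ ∧ ∀ t, |t| < τ →
      CkClose k δ (confFactor (U t)) (fun q => L₁ (q 0) + L₂ (q 1)) ∧
      CkClose k δ (magField (U t)) (fun _ => 0) := by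
  choose M hM hMb using hb
  have hev : ∀ᶠ t : ℝ in 𝓝 0, |t| < ε ∧ ∀ j ∈ Finset.range (k + 1),
      M j * |t| ≤ δ ∧ ‖curlMap‖ * (M (j + 1) * |t|) ≤ δ := by
    have hlin : ∀ c : ℝ, ∀ᶠ t : ℝ in 𝓝 0, c * |t| < δ := fun c => by
      have : Filter.Tendsto (fun t : ℝ => c * |t|) (𝓝 0) (𝓝 (c * |0|)) :=
        (continuous_const.mul continuous_abs).tendsto 0
      rw [abs_zero, mul_zero] at this
      exact this.eventually_lt_const hδ
    refine Filter.Eventually.and ?_ ((Finset.eventually_all _).2 fun j _ => ?_)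
    · filter_upwards [Metric.ball_mem_nhds (0 : ℝ) hε] with t ht
      simpa using ht
    · filter_upwards [hlin (M j), hlin (‖curlMap‖ * M (j + 1))] with t h1 h2
      exact ⟨h1.le, by rw [← mul_assoc]; exact h2.le⟩
  obtain ⟨τ, hτ, hτb⟩ := Metric.eventually_nhds_iff.1 hev
  refine ⟨τ, hτ, fun t ht => ?_⟩
  obtain ⟨htε, hj⟩ := hτb (y := t) (by simpa using ht)
  have hw : ContDiff ℝ ∞ fun q => U t q - liouvilleState L₁ L₂ q := (hU t htε).sub hu
  refine ⟨fun j hjk q => ?_, fun j hjk q => ?_⟩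
  · exact ((norm_iteratedFDeriv_component_le hw 0 j q).trans (hMb j t htε q)).trans
      (hj j (Finset.mem_range.2 (by omega))).1
  · have hj' : ((j : ℕ∞) : WithTop ℕ∞) ≤ ∞ := by exact_mod_cast le_top
    have he : (fun q' => magField (U t) q' - 0) =
        curlMap ∘ fderiv ℝ fun q => U t q - liouvilleState L₁ L₂ q := by
      funext q
      rw [sub_zero]
      exact magField_sub_liouvilleState ((hU t htε).differentiable (by simp))
        (hu.differentiable (by simp)) q
    have h1 := curlMap.norm_iteratedFDeriv_comp_left (x := q) (N := ∞)
      (hw.fderiv_right (m := ∞) (by simp)).contDiffAt hj'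
    rw [norm_iteratedFDeriv_fderiv] at h1
    rw [he]
    refine h1.trans (le_trans ?_ (hj j (Finset.mem_range.2 (by omega))).2)
    gcongr
    exact hMb (j + 1) t htε q

lemma abs_dirDeriv_dirDeriv_le {Y : Plane → ℝ} (hY : ContDiff ℝ ∞ Y) (i : Fin 2) (q : Plane) :
    |dirDeriv (Pi.single i 1) (dirDeriv (Pi.single i 1) Y) q| ≤ ‖iteratedFDeriv ℝ 2 Y q‖ := by
  have h1 : dirDeriv (Pi.single i 1) (dirDeriv (Pi.single i 1) Y) q =
      iteratedFDeriv ℝ 2 Y q ![Pi.single i 1, Pi.single i 1] := by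
    rw [iteratedFDeriv_two_apply, dirDeriv,
      show dirDeriv (Pi.single i 1) Y = fun z => fderiv ℝ Y z (Pi.single i 1) from rfl,
      fderiv_clm_apply ((hY.fderiv_right (m := ∞) (by simp)).differentiable (by simp) q)
        (differentiableAt_const _)]
    simp
  rw [h1, ← Real.norm_eq_abs]
  refine (ContinuousMultilinearMap.le_opNorm _ _).trans ?_
  have hn : ‖(Pi.single i 1 : Plane)‖ = 1 := by rw [Pi.norm_single, norm_one]
  simp [Fin.prod_univ_two, hn]

lemma exists_pos_lower_bound {L : ℝ → ℝ} (hL : Continuous L) (hper : ∀ s, L (s + 1) = L s)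
    (hpos : ∀ s, 0 < L s) : ∃ m : ℝ, 0 < m ∧ ∀ s, m ≤ L s := by
  obtain ⟨x, -, hx⟩ := isCompact_Icc.exists_isMinOn (Set.nonempty_Icc.2 (zero_le_one' ℝ))
    hL.continuousOn
  refine ⟨L x, hpos x, fun s => ?_⟩
  obtain ⟨z, hz, hzs⟩ := (show Function.Periodic L 1 from hper).exists_mem_Ico₀ one_pos s
  rw [hzs]
  exact hx (Set.Ico_subset_Icc_self hz)

theorem exists_liouville_deformation {L₁ L₂ : ℝ → ℝ} (h₁ : AnalyticOnNhd ℝ L₁ Set.univ)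
    (h₂ : AnalyticOnNhd ℝ L₂ Set.univ) (p₁ : ∀ s, L₁ (s + 1) = L₁ s) (p₂ : ∀ s, L₂ (s + 1) = L₂ s)
    (pos₁ : ∀ s, 0 < L₁ s) (pos₂ : ∀ s, 0 < L₂ s)
    (n₁ : ∃ s s', L₁ s ≠ L₁ s') (n₂ : ∃ s s', L₂ s ≠ L₂ s') :
    ∃ ε : ℝ, 0 < ε ∧ ∃ U : ℝ → Plane → State,
      IsSymmetryFlow ε (liouvilleState L₁ L₂) U ∧
      (∀ k, ∃ M : ℝ, 0 < M ∧ ∀ t, |t| < ε → ∀ q,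
        ‖iteratedFDeriv ℝ k (fun q => U t q - liouvilleState L₁ L₂ q) q‖ ≤ M * |t|) ∧
      ∀ t, |t| < ε → DoublyPeriodic (U t) ∧ (∀ q, 0 < confFactor (U t) q) ∧
        SolvesSystem magA magB (U t) ∧ (t ≠ 0 →
          ¬ IsLiouvilleMetric (conformalMetric (confFactor (U t))) ∧
          ∃ q, magField (U t) q ≠ 0) := by
  have hu := contDiff_liouvilleState h₁ h₂
  obtain ⟨C, A, hC, hA, hcauchy⟩ := exists_cauchy_estimate_liouvilleState h₁ h₂ p₁ p₂
  obtain ⟨ε, hε, U, han, hU0, hder, hper, hbound⟩ :=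
    exists_analytic_solution symQuadratic symLinear hu hC hA hcauchy
  have hflow : IsSymmetryFlow ε (liouvilleState L₁ L₂) U :=
    ⟨han, hU0, fun t ht q => (hder t ht q).deriv.trans (symQuadratic_add_symLinear _ _)⟩
  have hperU : ∀ t, DoublyPeriodic (U t) := fun t q i => hper (Pi.single i 1) (fun q => by
    ext k
    fin_cases i <;> simp [liouvilleState, p₁, p₂]) t q
  have hdata : HasLiouvilleData ε (fun z => U z.1 z.2 0) (fun z => U z.1 z.2 1)
      (fun z => U z.1 z.2 2) (fun z => U z.1 z.2 3) L₁ L₂ := by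
    refine ⟨hε, hflow.evolutionSolution, h₁, h₂, fun x y => ?_, fun x y => ?_, fun x y => ?_,
      fun x y => ?_⟩ <;> simp [hU0, liouvilleState]
  have hsmooth : ∀ t, |t| < ε → ContDiff ℝ ∞ (U t) := fun t ht =>
    (hflow.analyticOnNhd_slice ht).contDiff
  have hsys : ∀ t, |t| < ε → SolvesSystem magA magB (U t) := by
    intro t ht q
    obtain ⟨r1, r2, r3, r4⟩ := hdata.residuals_eq_zero (z := (t, q)) ht
    rw [magSystem_eq_zero_iff ((hsmooth t ht).differentiable (by simp) q)]
    simp only [hflow.pd_eq ht]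
    simp only [res1, res2, res3, res4] at r1 r2 r3 r4
    refine ⟨?_, ?_, ?_, ?_⟩
    · linear_combination r1
    · linear_combination r2
    · linear_combination r3
    · linear_combination r4
  obtain ⟨x₀, hx₀⟩ : ∃ x, deriv (deriv L₁) x ≠ 0 := by
    by_contra! h0
    obtain ⟨s, s', hs⟩ := n₁
    exact hs (eq_of_deriv_deriv_eq_zero h₁ p₁ h0 s s')
  obtain ⟨x₁, y₁, hxy₁⟩ := exists_deriv_deriv_ne (L₂ := L₂) h₁ p₁ n₁
  obtain ⟨x₂, y₂, hxy₂⟩ := exists_third_derivatives_ne_zero h₁ h₂ p₁ p₂ n₁ n₂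
  have hΩ : ∀ᶠ t in 𝓝[≠] 0, dX (fun z => U z.1 z.2 3) (t, ![x₁, y₁]) -
      dY (fun z => U z.1 z.2 2) (t, ![x₁, y₁]) ≠ 0 :=
    eventually_ne_zero_of_dT hε (Y := fun z => dX (fun z => U z.1 z.2 3) z -
      dY (fun z => U z.1 z.2 2) z) ((hdata.sol.ang.dirDeriv _).sub (hdata.sol.anf.dirDeriv _))
      (Or.inl (by
        rw [hdata.dT_magField]
        exact mul_ne_zero four_ne_zero (sub_ne_zero.2 hxy₁)))
  have hΛ : ∀ᶠ t in 𝓝[≠] 0, dX (dY (fun z => U z.1 z.2 0)) (t, ![x₂, y₂]) ≠ 0 :=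
    eventually_ne_zero_of_dT hε ((hdata.sol.anL.dirDeriv _).dirDeriv _)
      -- The second time derivative has to be used, since the first order variation of Λ vanishes.
      (Or.inr (by
        rw [hdata.dT_dT_mixed]
        exact mul_ne_zero four_ne_zero hxy₂))
  obtain ⟨m₁, hm₁, hm₁'⟩ := exists_pos_lower_bound (continuousOn_univ.1 h₁.continuousOn) p₁ pos₁
  obtain ⟨M₀, hM₀, hb₀⟩ := hbound 0
  obtain ⟨M₂, hM₂, hb₂⟩ := hbound 2
  have hlin : ∀ c δ : ℝ, 0 < δ → ∀ᶠ t : ℝ in 𝓝 0, c * |t| < δ := fun c δ hδ => by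
    have : Filter.Tendsto (fun t : ℝ => c * |t|) (𝓝 0) (𝓝 (c * |0|)) :=
      (continuous_const.mul continuous_abs).tendsto 0
    rw [abs_zero, mul_zero] at this
    exact this.eventually_lt_const hδ
  -- The time interval is shrunk so that Ω and Λ_xy are non-zero at chosen points for t ≠ 0, Λ stays
  -- positive, and Λ_xx moves by less than |L₁''(x₀)|.
  have hev := ((eventually_nhdsWithin_iff.1 hΩ).and (eventually_nhdsWithin_iff.1 hΛ)).and
    ((hlin M₀ m₁ hm₁).and (hlin M₂ |deriv (deriv L₁) x₀| (abs_pos.2 hx₀)))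
  obtain ⟨τ, hτ, hτb⟩ := Metric.eventually_nhds_iff.1 hev
  have hmin : ∀ {t : ℝ}, |t| < min ε τ → |t| < ε := fun h => h.trans_le (min_le_left _ _)
  refine ⟨min ε τ, lt_min hε hτ, U, ⟨han.mono fun z (hz : |z.1| < min ε τ) => hmin hz, hU0,
    fun t ht => hflow.2.2 t (hmin ht)⟩, fun k => ?_, fun t ht => ?_⟩
  · obtain ⟨M, hM, hb⟩ := hbound k
    exact ⟨M, hM, fun t ht => hb t (hmin ht)⟩
  have htε := hmin ht
  obtain ⟨⟨eΩ, eΛ⟩, e₀, e₂⟩ := hτb (y := t) (by simpa using ht.trans_le (min_le_right _ _))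
  have hw : ContDiff ℝ ∞ fun q => U t q - liouvilleState L₁ L₂ q := (hsmooth t htε).sub hu
  have hpos : ∀ q, 0 < confFactor (U t) q := by
    intro q
    have h0 := hb₀ t htε q
    rw [norm_iteratedFDeriv_zero] at h0
    have h1 := (norm_le_pi_norm (U t q - liouvilleState L₁ L₂ q) 0).trans h0
    rw [Pi.sub_apply, Real.norm_eq_abs] at h1
    have h2 := (abs_le.1 (h1.trans e₀.le)).1
    have h3 : liouvilleState L₁ L₂ q 0 = L₁ (q 0) + L₂ (q 1) := rfl
    have h4 := hm₁' (q 0)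
    have h5 := pos₂ (q 1)
    rw [h3] at h2
    change 0 < U t q 0
    linarith
  refine ⟨hperU t, hpos, hsys t htε, fun ht0 => ⟨fun hliou => ?_, ![x₁, y₁], ?_⟩⟩
  · have hanΛ : AnalyticOnNhd ℝ (confFactor (U t)) Set.univ := fun q hq =>
      analyticAt_pi_iff.1 (hflow.analyticOnNhd_slice htε q hq) 0
    have hslice : ∀ t, |t| < ε → ∀ v : Plane, dirDeriv v (fun q => U t q 0) =
        fun q => dirDeriv (0, v) (fun z => U z.1 z.2 0) (t, q) := fun t ht v => by
      funext q
      exact dirDeriv_slice (Y := fun z : ℝ × Plane => U z.1 z.2 0)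
        (hdata.sol.anL (t, q) ht).differentiableAt v
    rcases hliou.mixed_eq_zero_or hanΛ hpos (fun q => by simp only [confFactor, hperU t q 1])
      with h | h
    · refine eΛ ht0 ?_
      rw [← h ![x₂, y₂], show confFactor (U t) = fun q => U t q 0 from rfl, hslice t htε]
      exact (dirDeriv_slice ((hdata.sol.anL.dirDeriv _) (t, _) htε).differentiableAt _).symm
    -- On the line x = x₀ the initial Λ_xx is the constant L₁''(x₀), so a zero of Λ_xx would mean a
    -- change by |L₁''(x₀)|, more than M₂ |t| allows.
    · obtain ⟨y, hy⟩ := h ![x₀, 0]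
      have hpt : (![x₀, 0] : Plane) + y • Pi.single 1 1 = ![x₀, y] := by
        ext i
        fin_cases i <;> simp
      rw [hpt] at hy
      have hcomp : ContDiff ℝ ∞ fun q => U t q 0 - liouvilleState L₁ L₂ q 0 :=
        contDiff_pi.1 hw 0
      have h1 := ((abs_dirDeriv_dirDeriv_le hcomp 0 ![x₀, y]).trans
        (norm_iteratedFDeriv_component_le hw 0 2 _)).trans (hb₂ t htε _)
      have hinit : dirDeriv (Pi.single 0 1) (dirDeriv (Pi.single 0 1)
          fun q => liouvilleState L₁ L₂ q 0) ![x₀, y] = deriv (deriv L₁) x₀ := by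
        rw [← hU0, hslice 0 (by simpa using hε),
          ← (hdata.second_derivatives x₀ y).1]
        exact dirDeriv_slice ((hdata.sol.anL.dirDeriv _) _ (hdata.mem _)).differentiableAt _
      have hsub : dirDeriv (Pi.single 0 1) (dirDeriv (Pi.single 0 1)
          fun q => U t q 0 - liouvilleState L₁ L₂ q 0) ![x₀, y] = 0 - deriv (deriv L₁) x₀ := by
        have ha : AnalyticOnNhd ℝ (fun q => liouvilleState L₁ L₂ q 0) Set.univ := fun q hq =>
          analyticAt_pi_iff.1 (hU0 ▸ hflow.analyticOnNhd_slice (t := 0) (by simpa using hε) q hq) 0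
        have h2 : dirDeriv (Pi.single 0 1) (fun q => U t q 0 - liouvilleState L₁ L₂ q 0) =
            fun q => dirDeriv (Pi.single 0 1) (confFactor (U t)) q -
              dirDeriv (Pi.single 0 1) (fun q => liouvilleState L₁ L₂ q 0) q := by
          funext q
          exact dirDeriv_sub (hanΛ q (Set.mem_univ q)).differentiableAt
            (ha q (Set.mem_univ q)).differentiableAt
        rw [h2, dirDeriv_sub (hanΛ.dirDeriv _ _ (Set.mem_univ _)).differentiableAt
          (ha.dirDeriv _ _ (Set.mem_univ _)).differentiableAt, hy, hinit]
      rw [hsub, zero_sub, abs_neg] at h1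
      exact absurd h1 (not_le.2 e₂)
  · rw [hflow.magField_eq htε]
    exact mul_ne_zero (by norm_num) (eΩ ht0)


/-! ### Assembly of the theorem. -/

theorem theorem1 :
    -- the quasi-linear system is semi-Hamiltonian and not linearly degenerate
    IsSemiHamiltonian magA magB ∧ ¬ IsLinearlyDegenerate magA magB ∧
    -- its solutions correspond to quadratic integrals on the energy level
    (∀ U : Plane → State, ContDiff ℝ 1 U → (∀ q, 0 < confFactor U q) →
      (SolvesSystem magA magB U ↔
        IsConservedOnLevel (conformalMetric (confFactor U)) (magField U) (magIntegral U))) ∧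
    -- flowing a Liouville solution by the symmetry
    (∀ L₁ L₂ : ℝ → ℝ,
      AnalyticOnNhd ℝ L₁ Set.univ → AnalyticOnNhd ℝ L₂ Set.univ →
      (∀ s, L₁ (s + 1) = L₁ s) → (∀ s, L₂ (s + 1) = L₂ s) →
      (∀ s, 0 < L₁ s) → (∀ s, 0 < L₂ s) →
      (∃ s s', L₁ s ≠ L₁ s') → (∃ s s', L₂ s ≠ L₂ s') →
      ∃ ε : ℝ, 0 < ε ∧ ∃ U : ℝ → Plane → State,
        IsSymmetryFlow ε (liouvilleState L₁ L₂) U ∧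
        (∀ δ : ℝ, 0 < δ → δ ≤ ε → ∀ W : ℝ → Plane → State,
          IsSymmetryFlow δ (liouvilleState L₁ L₂) W → ∀ t, |t| < δ → W t = U t) ∧
        (∀ t, |t| < ε →
          DoublyPeriodic (U t) ∧
          SolvesSystem magA magB (U t) ∧
          IsAnalyticTorusMetric (conformalMetric (confFactor (U t))) ∧
          AnalyticOnNhd ℝ (magField (U t)) Set.univ ∧
          DoublyPeriodic (magField (U t)) ∧
          IsQuadraticIntegralOnLevel (conformalMetric (confFactor (U t))) (magField (U t))
            (magIntegral (U t))) ∧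
        (∀ t, 0 < |t| → |t| < ε →
          ¬ IsLiouvilleMetric (conformalMetric (confFactor (U t))) ∧
          ∃ q, magField (U t) q ≠ 0) ∧
        (∀ (k : ℕ) (δ : ℝ), 0 < δ → ∃ τ : ℝ, 0 < τ ∧ ∀ t, |t| < τ →
          CkClose k δ (confFactor (U t)) (fun q => L₁ (q 0) + L₂ (q 1)) ∧
          CkClose k δ (magField (U t)) (fun _ => 0))) := by
  refine ⟨isSemiHamiltonian_mag, not_isLinearlyDegenerate_mag,
    fun U hU hpos => solvesSystem_iff_isConservedOnLevel (hU.differentiable (by simp)) hpos, ?_⟩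
  intro L₁ L₂ h₁ h₂ p₁ p₂ pos₁ pos₂ n₁ n₂
  obtain ⟨ε, hε, U, hflow, hb, hU⟩ :=
    exists_liouville_deformation h₁ h₂ p₁ p₂ pos₁ pos₂ n₁ n₂
  have hsmooth : ∀ t, |t| < ε → ContDiff ℝ ∞ (U t) := fun t ht =>
    (hflow.analyticOnNhd_slice ht).contDiff
  refine ⟨ε, hε, U, hflow, fun δ hδ hδε W hW t ht => hflow.eq_of_isSymmetryFlow hδ hδε hW ht,
    fun t ht => ?_, fun t ht0 ht => (hU t ht).2.2.2 (abs_pos.1 ht0), fun k δ hδ =>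
    ckClose_of_bounds hε (contDiff_liouvilleState h₁ h₂) hsmooth hb k hδ⟩
  obtain ⟨hper, hpos, hsys, -⟩ := hU t ht
  have han := hflow.analyticOnNhd_slice ht
  have hdiff : Differentiable ℝ (U t) := (hsmooth t ht).differentiable (by simp)
  exact ⟨hper, hsys, isAnalyticTorusMetric_conformalMetric han hper hpos,
    analyticOnNhd_magField han, doublyPeriodic_magField hper,
    isQuadraticInMomenta_magIntegral han hper,
    (solvesSystem_iff_isConservedOnLevel hdiff hpos).1 hsys,
    isIndependentOnLevel_magIntegral hdiff hpos⟩

end
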